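/- **Setting.** Let $\mathbb T^2$ be identified with $[0,1)\times[0,1)\ni(q,p)$, and let $C^\infty(\mathbb T^2)$ be the smooth complex-valued $\mathbb Z^2$-periodic functions on $\mathbb R^2$, with $\|f\|_{C^0}=\sup|f|$ and $\|f\|_{C^j}=\sum_{\gamma_1+\gamma_2\le j}\|\partial_q^{\gamma_1}\partial_p^{\gamma_2}f\|_{C^0}$. The baker's map is the bijection $B(q,p)=(2q,p/2)$ if $q<1/2$, $B(q,p)=(2q-1,(p+1)/2)$ if $q\ge1/2$. For even $N\ge2$ let $\mathcal H_N=\mathbb C^N$ with its Hermitian inner product and orthonormal position basis $\mathbf q_0,\dots,\mathbf q_{N-1}$ (indices modulo $N$), and let $\|\cdot\|$ be the operator norm on $\mathcal H_N$. For $k\in\mathbb Z^2$ put $T(k)\mathbf q_j=e^{i\pi k_1k_2/N}e^{2\pi i k_2 j/N}\mathbf q_{j+k_1}$ (the quantum translation by $k/N$), and for $f\in C^\infty(\mathbb T^2)$ define the Weyl quantisation $\mathrm{Op}^W_N(f)=\sum_{k\in\mathbb Z^2}\tilde f(k)\,T(k)$, where $f(q,p)=\sum_k\tilde f(k)e^{2\pi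 i(qk_2-pk_1)}$. The quantised baker's map is the unitary matrix $\hat B_N=F_N^{-1}\begin{pmatrix}F_{N/2}&0\\0&F_{N/2}\end{pmatrix}$, with $(F_M)_{kj}=M^{-1/2}e^{-2\pi i kj/M}$, $0\le k,j<M$. Let $T_E=T_E(N)=\log N/\log 2$. For $0<\delta<1/4$ and $K>0$, a *cutoff of width $\delta$ with constant $K$* is a smooth $\mathbb Z$-periodic function $\tilde\chi_\delta:\mathbb R\to\mathbb R$ that vanishes on $[-\delta,\delta]$ modulo $\mathbb Z$, equals $1$ on $[2\delta,1-2\delta]$ modulo $\mathbb Z$, and satisfies $|\tilde\chi_\delta^{(j)}|\le K\delta^{-j}$ for $0\le j\le4$. For $n\ge0$ put $\chi_{\delta,n}(q,p)=\tilde\chi_\delta(2^nq)\,\tilde\chi_\delta(p)$ and $\chi_{\delta,-n}(q,p)=\tilde\chi_\delta(2^np)\,\tilde\chi_\delta(q)$; the *good part* of $a\in C^\infty(\mathbb T^2)$ is $a_n=a\,\chi_{\delta,n}$, $n\in\mathbb Z$. **Theorem.** For every $\varepsilon>0$ there is $N(\varepsilon)$, depending only on $\varepsilon$, and for every $K>0$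 there is a constant $C>0$, depending only on $K$ (in particular independent of $a$ and $\varepsilon$), such that the following holds. Let $\varepsilon>0$, $a\in C^\infty(\mathbb T^2)$, let $N\ge N(\varepsilon)$ be a positive even integer, let $\min(N^{-\varepsilon/4},1/10)\le\delta<1/4$, and let $\tilde\chi_\delta$ be a cutoff of width $\delta$ with constant $K$ ($\delta$ and $\tilde\chi_\delta$ may depend on $N$). Then for every $n\in\mathbb Z$ with $|n|\le(1-\varepsilon)T_E(N)$, the function $a_n\circ B^{-n}$ belongs to $C^\infty(\mathbb T^2)$ and $$\big\|\hat B_N^{n}\,\mathrm{Op}^W_N(a_n)\,\hat B_N^{-n}-\mathrm{Op}^W_N(a_n\circ B^{-n})\big\|\le C\Big(\|a\|_{C^0}\,N^{3/2}\,e^{-\pi N^{\varepsilon/2}}+\frac{\|a\|_{C^4}}{N^{\varepsilon/2}}\Big).$$ -/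

import Mathlib

open scoped ContDiff

noncomputable section

namespace QBaker

/-! ### The classical baker's map on the torus, identified with `[0,1) × [0,1)` -/

/-- The torus `𝕋²`, identified with the square `[0,1) × [0,1)`; points are `(q, p)`. -/
abbrev Square : Type := Set.Ico (0 : ℝ) 1 × Set.Ico (0 : ℝ) 1

/-- The baker's map: `(q, p) ↦ (2q, p/2)` for `q < 1/2` and `(2q - 1, (p+1)/2)` for `q ≥ 1/2`. -/
def bakerFun (x : Square) : Square :=
  if h : (x.1 : ℝ) < 1 / 2 then
    (⟨2 * x.1, by have := x.1.2.1; constructor <;> linarith⟩,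
     ⟨x.2 / 2, by have := x.2.2.1; have := x.2.2.2; constructor <;> linarith⟩)
  else
    (⟨2 * x.1 - 1, by have := x.1.2.2; push Not at h; constructor <;> linarith⟩,
     ⟨(x.2 + 1) / 2, by have := x.2.2.1; have := x.2.2.2; constructor <;> linarith⟩)

/-- The inverse map: `(q, p) ↦ (q/2, 2p)` for `p < 1/2` and `((q+1)/2, 2p - 1)` for `p ≥ 1/2`. -/
def bakerInv (x : Square) : Square :=
  if h : (x.2 : ℝ) < 1 / 2 then
    (⟨x.1 / 2, by have := x.1.2.1; have := x.1.2.2; constructor <;> linarith⟩,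
     ⟨2 * x.2, by have := x.2.2.1; constructor <;> linarith⟩)
  else
    (⟨(x.1 + 1) / 2, by have := x.1.2.1; have := x.1.2.2; constructor <;> linarith⟩,
     ⟨2 * x.2 - 1, by have := x.2.2.2; push Not at h; constructor <;> linarith⟩)

/-- The baker's map `B` as a bijection of the torus, so that `B ^ n` makes sense for `n : ℤ`. -/
def baker : Equiv.Perm Square where
  toFun := bakerFun
  invFun := bakerInv
  left_inv := by
    rintro ⟨⟨q, hq0, hq1⟩, ⟨p, hp0, hp1⟩⟩
    by_cases h : q < 1 / 2
    · have h2 : p / 2 < 1 / 2 := by linarith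
      simp only [bakerFun, h, dif_pos, bakerInv, h2]
      exact Prod.ext (Subtype.ext (by dsimp only; ring)) (Subtype.ext (by dsimp only; ring))
    · have h2 : ¬ (p + 1) / 2 < 1 / 2 := by linarith
      simp only [bakerFun, h, dif_neg, not_false_eq_true, bakerInv, h2]
      exact Prod.ext (Subtype.ext (by dsimp only; ring)) (Subtype.ext (by dsimp only; ring))
  right_inv := by
    rintro ⟨⟨q, hq0, hq1⟩, ⟨p, hp0, hp1⟩⟩
    by_cases h : p < 1 / 2
    · have h2 : q / 2 < 1 / 2 := by linarith
      simp only [bakerFun, h, dif_pos, bakerInv, h2]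
      exact Prod.ext (Subtype.ext (by dsimp only; ring)) (Subtype.ext (by dsimp only; ring))
    · have h2 : ¬ (q + 1) / 2 < 1 / 2 := by linarith
      simp only [bakerFun, h, dif_neg, not_false_eq_true, bakerInv, h2]
      exact Prod.ext (Subtype.ext (by dsimp only; ring)) (Subtype.ext (by dsimp only; ring))

/-- The representative in `[0,1) × [0,1)` of the class of `x ∈ ℝ²` modulo `ℤ²`. -/
def toSquare (x : ℝ × ℝ) : Square :=
  (⟨Int.fract x.1, Int.fract_nonneg _, Int.fract_lt_one _⟩,
   ⟨Int.fract x.2, Int.fract_nonneg _, Int.fract_lt_one _⟩)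

/-- The function `f ∘ B^m` on the torus, as a `ℤ²`-periodic function on `ℝ²`. -/
def compBaker (f : ℝ × ℝ → ℂ) (m : ℤ) (x : ℝ × ℝ) : ℂ :=
  let y : Square := (baker ^ m) (toSquare x)
  f ((y.1 : ℝ), (y.2 : ℝ))

/-! ### Observables -/

/-- `f ∈ C^∞(𝕋²)`: smooth functions on the torus are smooth `ℤ²`-periodic functions on `ℝ²`. -/
structure IsObservable (f : ℝ × ℝ → ℂ) : Prop where
  smooth : ContDiff ℝ ∞ f
  periodic_q : ∀ q p : ℝ, f (q + 1, p) = f (q, p)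
  periodic_p : ∀ q p : ℝ, f (q, p + 1) = f (q, p)

/-- `∂f/∂q`. -/
def dq (f : ℝ × ℝ → ℂ) (x : ℝ × ℝ) : ℂ := deriv (fun t : ℝ => f (t, x.2)) x.1

/-- `∂f/∂p`. -/
def dp (f : ℝ × ℝ → ℂ) (x : ℝ × ℝ) : ℂ := deriv (fun t : ℝ => f (x.1, t)) x.2

/-- The sup-norm `‖f‖_{C^0}`. -/
def supNorm (f : ℝ × ℝ → ℂ) : ℝ := ⨆ x : ℝ × ℝ, ‖f x‖

/-- `‖f‖_{C^j} = ∑_{γ₁ + γ₂ ≤ j} ‖∂_q^{γ₁} ∂_p^{γ₂} f‖_{C^0}`. -/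
def cNorm (j : ℕ) (f : ℝ × ℝ → ℂ) : ℝ :=
  ∑ m ∈ Finset.range (j + 1), ∑ γ ∈ Finset.HasAntidiagonal.antidiagonal m, supNorm (dq^[γ.1] (dp^[γ.2] f))

/-! ### Cutoffs and the good part of an observable -/

/-- `χ` is a cutoff of width `δ`: smooth, `ℤ`-periodic, equal to `0` on `[-δ, δ]` and to `1` on
`[2δ, 1 - 2δ]` (modulo `ℤ`), varying on the scale `δ`: `|χ^{(j)}| ≤ K δ^{-j}` for `j ≤ 4`. -/
structure IsCutoff (K δ : ℝ) (χ : ℝ → ℝ) : Prop where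
  smooth : ContDiff ℝ ∞ χ
  periodic : Function.Periodic χ 1
  eq_zero : ∀ x ∈ Set.Icc (-δ) δ, χ x = 0
  eq_one : ∀ x ∈ Set.Icc (2 * δ) (1 - 2 * δ), χ x = 1
  deriv_le : ∀ j ≤ 4, ∀ x, |iteratedDeriv j χ x| ≤ K / δ ^ j

/-- `χ_{δ,n}(q,p) = χ(2^n q) χ(p)` and `χ_{δ,-n}(q,p) = χ(2^n p) χ(q)` for `n ≥ 0`. -/
def torusCutoff (χ : ℝ → ℝ) (n : ℤ) (x : ℝ × ℝ) : ℝ :=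
  if 0 ≤ n then χ (2 ^ n.natAbs * x.1) * χ x.2 else χ (2 ^ n.natAbs * x.2) * χ x.1

/-- The good part `a_n = a χ_{δ,n}`. -/
def goodPart (χ : ℝ → ℝ) (a : ℝ × ℝ → ℂ) (n : ℤ) (x : ℝ × ℝ) : ℂ := a x * (torusCutoff χ n x : ℂ)

/-! ### Quantum mechanics on the torus

The Hilbert space is `ℂ^N` with its orthonormal position basis `q_0, …, q_{N-1}`; operators are
given by their matrices in that basis. -/

/-- The Fourier coefficient `f̃(k) = ∫_{[0,1)²} f(q,p) e^{-2πi(q k₂ - p k₁)} dq dp`. -/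
def fourierCoeff₂ (f : ℝ × ℝ → ℂ) (k : ℤ × ℤ) : ℂ :=
  ∫ x in Set.Ico (0 : ℝ) 1 ×ˢ Set.Ico (0 : ℝ) 1,
    f x * Complex.exp (-(2 * Real.pi * Complex.I * (x.1 * k.2 - x.2 * k.1)))

/-- The translation `T(k) = exp(2πi(k₂ q̂ - k₁ p̂))`, i.e. the phase-space translation by `k / N`
(with `2πħ = 1 / N`). It acts on functions or distributions of `q` by
`(T(k)ψ)(q) = e^{-iπ k₁k₂/N} e^{2πi k₂ q} ψ(q - k₁/N)`, hence, on the position basis (periodised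
delta functions at `j / N`), by `T(k) q_j = e^{iπ k₁k₂/N} e^{2πi k₂ j/N} q_{j + k₁ mod N}`. -/
def translation (N : ℕ) (k : ℤ × ℤ) : Matrix (Fin N) (Fin N) ℂ :=
  Matrix.of fun m j =>
    if (m : ℤ) ≡ (j : ℤ) + k.1 [ZMOD N] then
      Complex.exp (Real.pi * Complex.I * (k.1 * k.2) / N)
        * Complex.exp (2 * Real.pi * Complex.I * (k.2 * (j : ℕ)) / N)
    else 0

/-- The Weyl quantisation `Op^W_N(f) = ∑_{k ∈ ℤ²} f̃(k) T(k)`. -/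
def weyl (N : ℕ) (f : ℝ × ℝ → ℂ) : Matrix (Fin N) (Fin N) ℂ :=
  ∑' k : ℤ × ℤ, fourierCoeff₂ f k • translation N k

/-- `N^{-1/2} e^{-2πi kj/N}`. -/
def dftEntry (N k j : ℕ) : ℂ :=
  ((1 / Real.sqrt N : ℝ) : ℂ) * Complex.exp (-(2 * Real.pi * Complex.I * (k * j) / N))

/-- The discrete Fourier transform `F_N`. -/
def dft (N : ℕ) : Matrix (Fin N) (Fin N) ℂ := Matrix.of fun k j => dftEntry N k j

/-- The block-diagonal matrix `diag(F_{N/2}, F_{N/2})` (for even `N`). -/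
def bakerMix (N : ℕ) : Matrix (Fin N) (Fin N) ℂ :=
  Matrix.of fun k j =>
    if (k : ℕ) < N / 2 ∧ (j : ℕ) < N / 2 then dftEntry (N / 2) k j
    else if N / 2 ≤ (k : ℕ) ∧ N / 2 ≤ (j : ℕ) then dftEntry (N / 2) (k - N / 2) (j - N / 2)
    else 0

/-- The Balazs–Voros quantised baker's map `B_N = F_N⁻¹ diag(F_{N/2}, F_{N/2})` (for even `N`). -/
def quantumBaker (N : ℕ) : Matrix (Fin N) (Fin N) ℂ := (dft N)⁻¹ * bakerMix N

/-- The operator norm on `ℂ^N` with its Hermitian norm. -/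
def opNorm {N : ℕ} (A : Matrix (Fin N) (Fin N) ℂ) : ℝ :=
  ‖Matrix.toEuclideanCLM (n := Fin N) (𝕜 := ℂ) A‖

/-- The Ehrenfest time `T_E(N) = log N / log 2`. -/
def ehrenfestTime (N : ℕ) : ℝ := Real.log N / Real.log 2

end QBaker

end

/-!
Averaging the projectors onto coherent states of squeezing `s` against a symbol gives its anti-Wick
quantisation, whose Fourier coefficients are those of the Weyl quantisation damped by a Gaussian.
Correcting the symbol by the heat term of second order undoes the damping up to a remainder which
is of fourth order in the derivatives of the symbol.

A coherent state of squeezing `s` centred far from the discontinuities of the baker's map is sent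
by the quantised map, up to a Gaussian tail, to a coherent state of squeezing `s / 4` centred at the
image point. So `n` steps lead from squeezing `2 ^ n` to squeezing `1 / 2 ^ n`, and as the baker's
map preserves area, the conjugated anti-Wick quantisation of a symbol that vanishes near the
discontinuities is close to the anti-Wick quantisation of the transported symbol. The two squeezings
are adapted to the derivatives of the cut off observable before and after the evolution, which makes
both Weyl remainders `O(N ^ (-ε / 2))` up to the time `(1 - ε) T_E`. Negative times reduce to
positive ones by exchanging position and momentum, which inverts the baker's map.
-/

noncomputable section

namespace QBaker

open Filter MeasureTheory
open scoped Topology ComplexConjugate Matrix.Norms.L2Operator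

/-- The character `e^{2πix}` of the real line, with values in `ℂ` instead of `Circle`. -/
def expi (x : ℝ) : ℂ := Complex.exp (2 * Real.pi * Complex.I * x)

lemma expi_eq_fourierChar (x : ℝ) : expi x = Real.fourierChar x := by
  rw [expi, Real.fourierChar_apply]
  push_cast
  ring_nf

lemma expi_add (x y : ℝ) : expi (x + y) = expi x * expi y := by
  simp only [expi_eq_fourierChar, AddChar.map_add_eq_mul, Circle.coe_mul]

lemma norm_expi (x : ℝ) : ‖expi x‖ = 1 := by
  rw [expi_eq_fourierChar, Circle.norm_coe]

lemma expi_zero : expi 0 = 1 := by simp [expi]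

lemma expi_eq_one_iff (x : ℝ) : expi x = 1 ↔ ∃ n : ℤ, x = n := by
  have h2π : 2 * (Real.pi : ℂ) * Complex.I ≠ 0 := Complex.two_pi_I_ne_zero
  simp only [expi, Complex.exp_eq_one_iff, mul_comm _ (2 * (Real.pi : ℂ) * Complex.I),
    mul_right_inj' h2π]
  norm_cast

lemma expi_int (n : ℤ) : expi n = 1 := (expi_eq_one_iff n).mpr ⟨n, rfl⟩

lemma expi_add_int (x : ℝ) (n : ℤ) : expi (x + n) = expi x := by
  rw [expi_add, expi_int, mul_one]

lemma expi_eq_of_eq_add_int {x y : ℝ} (n : ℤ) (h : x = y + n) : expi x = expi y := by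
  rw [h, expi_add_int]

lemma conj_expi (x : ℝ) : conj (expi x) = expi (-x) := by
  rw [expi_eq_fourierChar, expi_eq_fourierChar, AddChar.map_neg_eq_inv, Circle.coe_inv_eq_conj]

lemma expi_pow (x : ℝ) (n : ℕ) : expi x ^ n = expi (n * x) := by
  rw [expi_eq_fourierChar, expi_eq_fourierChar, ← nsmul_eq_mul, AddChar.map_nsmul_eq_pow,
    Circle.coe_pow]

lemma continuous_expi : Continuous expi := by unfold expi; fun_prop

/-! ### Sums of translations -/

lemma exists_fin_modEq {N : ℕ} (hN : 0 < N) (x : ℤ) : ∃ m : Fin N, (m : ℤ) ≡ x [ZMOD N] := by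
  obtain ⟨z, hz, hzx⟩ := Int.existsUnique_equiv_nat x (Int.natCast_pos.mpr hN)
  exact ⟨⟨z, Int.ofNat_lt.mp hz⟩, hzx⟩

lemma fin_eq_of_modEq {N : ℕ} {i j : Fin N} (h : (i : ℤ) ≡ j [ZMOD N]) : i = j :=
  Fin.ext ((Int.natCast_modEq_iff.mp h).eq_of_lt_of_lt i.2 j.2)

/-- The matrix sending `e_j` to `d_j e_{j + k}`, with indices modulo `N`. Every translation, and
every sum of translations with a common first index, has this form. -/
def weightedShift {N : ℕ} (k : ℤ) (d : Fin N → ℂ) : Matrix (Fin N) (Fin N) ℂ :=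
  Matrix.of fun m j => if (m : ℤ) ≡ (j : ℤ) + k [ZMOD N] then d j else 0

lemma weightedShift_apply {N : ℕ} (k : ℤ) (d : Fin N → ℂ) (m j : Fin N) :
    weightedShift k d m j = if (m : ℤ) ≡ (j : ℤ) + k [ZMOD N] then d j else 0 := rfl

lemma conjTranspose_weightedShift_mul_self {N : ℕ} (k : ℤ) (d : Fin N → ℂ) :
    (weightedShift k d).conjTranspose * weightedShift k d
      = Matrix.diagonal fun j => ((‖d j‖ ^ 2 : ℝ) : ℂ) := by
  ext i j
  obtain ⟨m, hm⟩ := exists_fin_modEq i.pos ((j : ℤ) + k)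
  rw [Matrix.mul_apply, Matrix.diagonal_apply, Finset.sum_eq_single_of_mem m (Finset.mem_univ m)]
  · simp only [Matrix.conjTranspose_apply, weightedShift_apply, if_pos hm]
    rcases eq_or_ne i j with rfl | hij
    · rw [if_pos hm, if_pos rfl, Complex.ofReal_pow]
      exact Complex.conj_mul' (d i)
    · have hmi : ¬ (m : ℤ) ≡ (i : ℤ) + k [ZMOD N] := fun h =>
        hij (fin_eq_of_modEq (Int.ModEq.add_right_cancel' k (h.symm.trans hm)))
      rw [if_neg hmi, if_neg hij, star_zero, zero_mul]
  · intro l _ hl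
    have hlj : ¬ (l : ℤ) ≡ (j : ℤ) + k [ZMOD N] := fun h =>
      hl (fin_eq_of_modEq (h.trans hm.symm))
    rw [weightedShift_apply k d l j, if_neg hlj, mul_zero]

lemma norm_weightedShift_le {N : ℕ} (k : ℤ) {d : Fin N → ℂ} {b : ℝ} (hb : 0 ≤ b)
    (hd : ∀ j, ‖d j‖ ≤ b) : ‖weightedShift k d‖ ≤ b := by
  refine le_of_sq_le_sq ?_ hb
  rw [sq, ← Matrix.l2_opNorm_conjTranspose_mul_self, conjTranspose_weightedShift_mul_self,
    Matrix.l2_opNorm_diagonal, pi_norm_le_iff_of_nonneg (by positivity)]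
  intro j
  rw [Complex.norm_real, norm_pow, norm_norm]
  exact pow_le_pow_left₀ (norm_nonneg _) (hd j) 2

lemma translation_eq_weightedShift (N : ℕ) (k : ℤ × ℤ) :
    translation N k = weightedShift k.1 fun j => expi (k.2 * (((j : ℕ) + k.1 / 2) / N)) := by
  ext m j
  rw [weightedShift_apply, translation, Matrix.of_apply, expi, ← Complex.exp_add]
  push_cast
  ring_nf

lemma norm_translation_le (N : ℕ) (k : ℤ × ℤ) : ‖translation N k‖ ≤ 1 := by
  rw [translation_eq_weightedShift]
  exact norm_weightedShift_le _ zero_le_one fun j => (norm_expi _).le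

/-- The operator `∑ c(k) T(k)` with coefficients `c`, so that `Op^W_N(f)` is the case `c = f̃`. -/
def transSum (N : ℕ) (c : ℤ × ℤ → ℂ) : Matrix (Fin N) (Fin N) ℂ := ∑' k, c k • translation N k

section TransSum

variable (N : ℕ) {c : ℤ × ℤ → ℂ} (hc : Summable fun k => ‖c k‖)

include hc

lemma summable_smul_translation : Summable fun k => c k • translation N k := by
  refine Summable.of_norm_bounded hc fun k => ?_
  rw [norm_smul]
  exact mul_le_of_le_one_right (norm_nonneg _) (norm_translation_le N k)

lemma tsum_smul_translation_eq_weightedShift (k₁ : ℤ) :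
    (∑' k₂ : ℤ, c (k₁, k₂) • translation N (k₁, k₂)) = weightedShift k₁ fun j : Fin N =>
      ∑' k₂ : ℤ, c (k₁, k₂) * expi (k₂ * (((j : ℕ) + k₁ / 2) / N)) := by
  have hsum := ((summable_smul_translation N hc).prod_factor k₁).hasSum
  ext m j
  rw [← (Pi.hasSum.mp (Pi.hasSum.mp hsum m) j).tsum_eq]
  simp only [Matrix.smul_apply, translation_eq_weightedShift, weightedShift_apply, smul_eq_mul]
  split_ifs <;> simp

lemma transSum_apply (m j : Fin N) :
    transSum N c m j = ∑' k₁ : ℤ, if (m : ℤ) ≡ (j : ℤ) + k₁ [ZMOD N] then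
      ∑' k₂ : ℤ, c (k₁, k₂) * expi (k₂ * (((j : ℕ) + k₁ / 2) / N)) else 0 := by
  have hs := summable_smul_translation N hc
  rw [transSum, hs.tsum_prod, ← (Pi.hasSum.mp (Pi.hasSum.mp hs.prod.hasSum m) j).tsum_eq]
  simp only [tsum_smul_translation_eq_weightedShift N hc, weightedShift_apply]

lemma norm_transSum_le {b : ℤ → ℝ} (hb : Summable b)
    (hcb : ∀ k₁ : ℤ, ∀ q : ℝ, ‖∑' k₂ : ℤ, c (k₁, k₂) * expi (k₂ * q)‖ ≤ b k₁) :
    ‖transSum N c‖ ≤ ∑' k, b k := by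
  rw [transSum, (summable_smul_translation N hc).tsum_prod]
  refine tsum_of_norm_bounded hb.hasSum fun k₁ => ?_
  rw [tsum_smul_translation_eq_weightedShift N hc]
  exact norm_weightedShift_le _ ((norm_nonneg _).trans (hcb k₁ 0)) fun j => hcb _ _

end TransSum

/-! ### Calculus of observables -/

lemma iterate_dq_comp_swap (f : ℝ × ℝ → ℂ) (i : ℕ) :
    dq^[i] (f ∘ Prod.swap) = dp^[i] f ∘ Prod.swap :=
  (Function.Semiconj.iterate_right (f := fun g : ℝ × ℝ → ℂ => g ∘ Prod.swap) (ga := dp) (gb := dq)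
    (fun _ => rfl) i f).symm

lemma iterate_dp_comp_swap (f : ℝ × ℝ → ℂ) (i : ℕ) :
    dp^[i] (f ∘ Prod.swap) = dq^[i] f ∘ Prod.swap :=
  (Function.Semiconj.iterate_right (f := fun g : ℝ × ℝ → ℂ => g ∘ Prod.swap) (ga := dq) (gb := dp)
    (fun _ => rfl) i f).symm

lemma dq_const_mul (c : ℂ) (f : ℝ × ℝ → ℂ) : dq (fun x => c * f x) = fun x => c * dq f x := by
  ext x
  simp only [dq, deriv_const_mul_field]

lemma dp_const_mul (c : ℂ) (f : ℝ × ℝ → ℂ) : dp (fun x => c * f x) = fun x => c * dp f x := by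
  ext x
  simp only [dp, deriv_const_mul_field]

lemma dq_zero : dq (fun _ => 0) = fun _ => 0 := by
  ext x
  exact deriv_const _ _

lemma dp_zero : dp (fun _ => 0) = fun _ => 0 := by
  ext x
  exact deriv_const _ _

lemma dq_congr {f g : ℝ × ℝ → ℂ} {x : ℝ × ℝ} (h : f =ᶠ[𝓝 x] g) : dq f x = dq g x := by
  have hslice : Tendsto (fun t : ℝ => (t, x.2)) (𝓝 x.1) (𝓝 x) :=
    Continuous.tendsto (by fun_prop) x.1
  exact EventuallyEq.deriv_eq (hslice.eventually h)

lemma dp_congr {f g : ℝ × ℝ → ℂ} {x : ℝ × ℝ} (h : f =ᶠ[𝓝 x] g) : dp f x = dp g x := by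
  have hslice : Tendsto (fun t : ℝ => (x.1, t)) (𝓝 x.2) (𝓝 x) :=
    Continuous.tendsto (by fun_prop) x.2
  exact EventuallyEq.deriv_eq (hslice.eventually h)

lemma hasDerivAt_dq {f : ℝ × ℝ → ℂ} (hf : Differentiable ℝ f) (q p : ℝ) :
    HasDerivAt (fun t => f (t, p)) (dq f (q, p)) q :=
  (hf.comp (by fun_prop : Differentiable ℝ fun t : ℝ => (t, p)) q).hasDerivAt

lemma hasDerivAt_dp {f : ℝ × ℝ → ℂ} (hf : Differentiable ℝ f) (q p : ℝ) :
    HasDerivAt (fun t => f (q, t)) (dp f (q, p)) p :=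
  (hf.comp (by fun_prop : Differentiable ℝ fun t : ℝ => (q, t)) p).hasDerivAt

lemma dq_eq_fderiv {f : ℝ × ℝ → ℂ} (hf : Differentiable ℝ f) :
    dq f = fun x => fderiv ℝ f x (1, 0) := by
  ext ⟨q, p⟩
  exact ((hf (q, p)).hasFDerivAt.comp_hasDerivAt q
    ((hasDerivAt_id q).prodMk (hasDerivAt_const q p))).deriv

lemma dp_eq_fderiv {f : ℝ × ℝ → ℂ} (hf : Differentiable ℝ f) :
    dp f = fun x => fderiv ℝ f x (0, 1) := by
  ext ⟨q, p⟩
  exact ((hf (q, p)).hasFDerivAt.comp_hasDerivAt p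
    ((hasDerivAt_const p q).prodMk (hasDerivAt_id p))).deriv

lemma dq_dp_comm {f : ℝ × ℝ → ℂ} (hf : ContDiff ℝ 2 f) : dq (dp f) = dp (dq f) := by
  have hdiff : Differentiable ℝ f := hf.differentiable two_ne_zero
  have hfderiv : Differentiable ℝ (fderiv ℝ f) :=
    (hf.fderiv_right (m := 1) one_add_one_eq_two.le).differentiable one_ne_zero
  have hfderiv_apply (v : ℝ × ℝ) : Differentiable ℝ fun x => fderiv ℝ f x v := by fun_prop
  have hsecond (v w x : ℝ × ℝ) :
      fderiv ℝ (fun y => fderiv ℝ f y v) x w = fderiv ℝ (fderiv ℝ f) x w v := by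
    rw [fderiv_clm_apply (hfderiv x) (by fun_prop)]
    simp
  rw [dp_eq_fderiv hdiff, dq_eq_fderiv hdiff, dq_eq_fderiv (hfderiv_apply _),
    dp_eq_fderiv (hfderiv_apply _)]
  ext x
  rw [hsecond, hsecond]
  exact hf.contDiffAt.isSymmSndFDerivAt (by simp) _ _

namespace IsObservable

variable {f : ℝ × ℝ → ℂ}

lemma differentiable (hf : IsObservable f) : Differentiable ℝ f :=
  hf.smooth.differentiable (by simp)

lemma comp_swap (hf : IsObservable f) : IsObservable (f ∘ Prod.swap) where
  smooth := hf.smooth.comp (contDiff_snd.prodMk contDiff_fst)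
  periodic_q q p := hf.periodic_p p q
  periodic_p q p := hf.periodic_q p q

lemma dq (hf : IsObservable f) : IsObservable (QBaker.dq f) where
  smooth := by
    rw [dq_eq_fderiv hf.differentiable]
    exact (hf.smooth.fderiv_right (m := ∞) (by simp)).clm_apply contDiff_const
  periodic_q q p := by
    change deriv (fun t => f (t, p)) (q + 1) = deriv (fun t => f (t, p)) q
    rw [← deriv_comp_add_const]
    exact congrArg (deriv · q) (funext fun t => hf.periodic_q t p)
  periodic_p q p := congrArg (deriv · q) (funext fun t => hf.periodic_p t p)

lemma dp (hf : IsObservable f) : IsObservable (QBaker.dp f) := hf.comp_swap.dq.comp_swap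

lemma iterate_dq (hf : IsObservable f) (i : ℕ) : IsObservable (QBaker.dq^[i] f) :=
  Function.Iterate.rec IsObservable hf (fun _ hg => hg.dq) i

lemma iterate_dp (hf : IsObservable f) (i : ℕ) : IsObservable (QBaker.dp^[i] f) :=
  Function.Iterate.rec IsObservable hf (fun _ hg => hg.dp) i

lemma dq_iterate_dp (hf : IsObservable f) (j : ℕ) :
    QBaker.dq (QBaker.dp^[j] f) = QBaker.dp^[j] (QBaker.dq f) := by
  induction j with
  | zero => rfl
  | succ j ih =>
    rw [Function.iterate_succ_apply', Function.iterate_succ_apply',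
      dq_dp_comm (contDiff_infty.mp (hf.iterate_dp j).smooth 2), ih]

lemma iterate_dq_iterate_dp (hf : IsObservable f) (i j : ℕ) :
    QBaker.dq^[i] (QBaker.dp^[j] f) = QBaker.dp^[j] (QBaker.dq^[i] f) := by
  induction i with
  | zero => rfl
  | succ i ih =>
    rw [Function.iterate_succ_apply', Function.iterate_succ_apply', ih,
      (hf.iterate_dq i).dq_iterate_dp]

lemma apply_fract (hf : IsObservable f) (q p : ℝ) : f (Int.fract q, Int.fract p) = f (q, p) := by
  have hq : Function.Periodic (fun t => f (t, Int.fract p)) 1 := fun t => hf.periodic_q _ _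
  have hp : Function.Periodic (fun t => f (q, t)) 1 := fun t => hf.periodic_p _ _
  have hq_fract := hq.sub_int_mul_eq (x := q) ⌊q⌋
  have hp_fract := hp.sub_int_mul_eq (x := p) ⌊p⌋
  rw [mul_one] at hq_fract hp_fract
  exact hq_fract.trans hp_fract

lemma apply_add_int (hf : IsObservable f) (q p : ℝ) (k l : ℤ) : f (q + k, p + l) = f (q, p) := by
  rw [← hf.apply_fract, Int.fract_add_intCast, Int.fract_add_intCast, hf.apply_fract]

lemma bddAbove_norm (hf : IsObservable f) : BddAbove (Set.range fun x => ‖f x‖) := by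
  have hcompact : IsCompact (Set.Icc (0 : ℝ) 1 ×ˢ Set.Icc (0 : ℝ) 1) :=
    isCompact_Icc.prod isCompact_Icc
  obtain ⟨M, hM⟩ := hcompact.exists_bound_of_continuousOn hf.smooth.continuous.continuousOn
  refine ⟨M, Set.forall_mem_range.mpr fun x => ?_⟩
  rw [← hf.apply_fract x.1 x.2]
  exact hM _ ⟨⟨Int.fract_nonneg _, (Int.fract_lt_one _).le⟩,
    ⟨Int.fract_nonneg _, (Int.fract_lt_one _).le⟩⟩

lemma norm_le_supNorm (hf : IsObservable f) (x : ℝ × ℝ) : ‖f x‖ ≤ supNorm f :=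
  le_ciSup hf.bddAbove_norm x

end IsObservable

lemma supNorm_nonneg (f : ℝ × ℝ → ℂ) : 0 ≤ supNorm f := Real.iSup_nonneg fun _ => norm_nonneg _

lemma cNorm_nonneg (n : ℕ) (f : ℝ × ℝ → ℂ) : 0 ≤ cNorm n f :=
  Finset.sum_nonneg fun _ _ => Finset.sum_nonneg fun _ _ => supNorm_nonneg _

lemma supNorm_iterate_le_cNorm (f : ℝ × ℝ → ℂ) {n i j : ℕ} (hij : i + j ≤ n) :
    supNorm (dq^[i] (dp^[j] f)) ≤ cNorm n f :=
  calc supNorm (dq^[i] (dp^[j] f))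
      ≤ ∑ γ ∈ Finset.HasAntidiagonal.antidiagonal (i + j), supNorm (dq^[γ.1] (dp^[γ.2] f)) :=
        Finset.single_le_sum (f := fun γ : ℕ × ℕ => supNorm (dq^[γ.1] (dp^[γ.2] f)))
          (fun _ _ => supNorm_nonneg _) (a := (i, j))
          (Finset.HasAntidiagonal.mem_antidiagonal.mpr rfl)
    _ ≤ cNorm n f :=
        Finset.single_le_sum (f := fun m => ∑ γ ∈ Finset.HasAntidiagonal.antidiagonal m,
          supNorm (dq^[γ.1] (dp^[γ.2] f)))
          (fun _ _ => Finset.sum_nonneg fun _ _ => supNorm_nonneg _)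
          (Finset.mem_range.mpr (Nat.lt_succ_of_le hij))

lemma IsObservable.norm_iterate_le_cNorm {f : ℝ × ℝ → ℂ} (hf : IsObservable f) {n i j : ℕ}
    (hij : i + j ≤ n) (x : ℝ × ℝ) : ‖QBaker.dq^[i] (QBaker.dp^[j] f) x‖ ≤ cNorm n f :=
  (((hf.iterate_dp j).iterate_dq i).norm_le_supNorm x).trans (supNorm_iterate_le_cNorm f hij)

/-! ### Fourier coefficients -/

lemma integral_square_eq_intervalIntegral {E : Type*} [NormedAddCommGroup E] [NormedSpace ℝ E]
    {g : ℝ × ℝ → E} (hg : Continuous g) :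
    ∫ x in Set.Ico (0 : ℝ) 1 ×ˢ Set.Ico (0 : ℝ) 1, g x
      = ∫ q in (0 : ℝ)..1, ∫ p in (0 : ℝ)..1, g (q, p) := by
  have hint : IntegrableOn g (Set.Ico (0 : ℝ) 1 ×ˢ Set.Ico (0 : ℝ) 1) (volume.prod volume) :=
    (hg.continuousOn.integrableOn_compact (isCompact_Icc.prod isCompact_Icc)).mono_set
      (Set.prod_mono Set.Ico_subset_Icc_self Set.Ico_subset_Icc_self)
  rw [Measure.volume_eq_prod, setIntegral_prod _ hint]
  simp only [intervalIntegral.integral_of_le (zero_le_one (α := ℝ)), integral_Ico_eq_integral_Ioc]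

/-- The partial Fourier coefficient of `f` in the momentum variable, as a function of position.
The character is `e^{2πikp}`, with the sign that the symplectic form in `fourierCoeff₂` gives to
`k.1`. -/
def rowCoeff (f : ℝ × ℝ → ℂ) (k : ℤ) (q : ℝ) : ℂ := ∫ p in (0 : ℝ)..1, f (q, p) * expi (k * p)

lemma fourierCoeff₂_eq_integral_rowCoeff {f : ℝ × ℝ → ℂ} (hf : Continuous f) (k : ℤ × ℤ) :
    fourierCoeff₂ f k = ∫ q in (0 : ℝ)..1, rowCoeff f k.1 q * expi (-(k.2 * q)) := by
  have hcharacter (x : ℝ × ℝ) :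
      f x * Complex.exp (-(2 * Real.pi * Complex.I * (x.1 * k.2 - x.2 * k.1)))
        = f x * expi (k.1 * x.2) * expi (-(k.2 * x.1)) := by
    rw [mul_assoc (f x), ← expi_add, expi]
    push_cast
    ring_nf
  have hexpi := continuous_expi
  simp_rw [fourierCoeff₂, hcharacter]
  rw [integral_square_eq_intervalIntegral (by fun_prop)]
  simp only [rowCoeff, intervalIntegral.integral_mul_const]

lemma continuous_rowCoeff {f : ℝ × ℝ → ℂ} (hf : Continuous f) (k : ℤ) :
    Continuous (rowCoeff f k) := by
  have hexpi := continuous_expi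
  exact intervalIntegral.continuous_parametric_intervalIntegral_of_continuous' (by fun_prop) 0 1

lemma norm_integral_mul_expi_le {h : ℝ → ℂ} {M : ℝ} (hM : ∀ t, ‖h t‖ ≤ M) (φ : ℝ → ℝ) :
    ‖∫ t in (0 : ℝ)..1, h t * expi (φ t)‖ ≤ M := by
  have hbound : ∀ t ∈ Set.uIoc (0 : ℝ) 1, ‖h t * expi (φ t)‖ ≤ M := fun t _ => by
    rw [norm_mul, norm_expi, mul_one]
    exact hM t
  simpa only [sub_zero, abs_one, mul_one] using
    intervalIntegral.norm_integral_le_of_norm_le_const hbound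

lemma norm_rowCoeff_le {f : ℝ × ℝ → ℂ} {M : ℝ} (hM : ∀ x, ‖f x‖ ≤ M) (k : ℤ) (q : ℝ) :
    ‖rowCoeff f k q‖ ≤ M :=
  norm_integral_mul_expi_le (fun _ => hM _) _

lemma norm_fourierCoeff₂_le {f : ℝ × ℝ → ℂ} (hf : Continuous f) {M : ℝ} (hM : ∀ x, ‖f x‖ ≤ M)
    (k : ℤ × ℤ) : ‖fourierCoeff₂ f k‖ ≤ M := by
  rw [fourierCoeff₂_eq_integral_rowCoeff hf]
  exact norm_integral_mul_expi_le (norm_rowCoeff_le hM _) _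

lemma fourierCoeff₂_comp_swap (f : ℝ × ℝ → ℂ) (k : ℤ × ℤ) :
    fourierCoeff₂ (f ∘ Prod.swap) k = fourierCoeff₂ f (-k.2, -k.1) := by
  rw [fourierCoeff₂, fourierCoeff₂, Measure.volume_eq_prod, ← setIntegral_prod_swap]
  congr with x
  simp only [Function.comp_apply, Prod.swap_swap, Prod.fst_swap, Prod.snd_swap, Int.cast_neg]
  congr 2
  ring

lemma hasDerivAt_expi (c x : ℝ) : HasDerivAt (fun t : ℝ => expi (c * t))
    (2 * Real.pi * Complex.I * c * expi (c * x)) x := by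
  have hexponent : HasDerivAt (fun t : ℝ => 2 * (Real.pi : ℂ) * Complex.I * ((c * t : ℝ) : ℂ))
      (2 * Real.pi * Complex.I * c) x := by
    simpa only [mul_one] using
      ((hasDerivAt_id' x).const_mul c).ofReal_comp.const_mul (2 * (Real.pi : ℂ) * Complex.I)
  rw [mul_comm]
  exact hexponent.cexp

lemma integral_deriv_mul_expi {h h' : ℝ → ℂ} (hderiv : ∀ x, HasDerivAt h (h' x) x)
    (hcont : Continuous h') (hper : h 1 = h 0) (k : ℤ) :
    ∫ t in (0 : ℝ)..1, h' t * expi (k * t)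
      = -(2 * Real.pi * Complex.I * k) * ∫ t in (0 : ℝ)..1, h t * expi (k * t) := by
  have hexpi := continuous_expi
  have hparts := intervalIntegral.integral_mul_deriv_eq_deriv_mul (a := 0) (b := 1)
    (u := fun t : ℝ => expi (k * t)) (v := h)
    (u' := fun t : ℝ => 2 * Real.pi * Complex.I * (k : ℝ) * expi (k * t)) (v' := h')
    (fun x _ => hasDerivAt_expi k x) (fun x _ => hderiv x)
    (Continuous.intervalIntegrable (by fun_prop) _ _) (hcont.intervalIntegrable _ _)
  simp only [mul_one, mul_zero, expi_int, expi_zero, hper, sub_self, zero_sub] at hparts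
  simp_rw [mul_comm (h' _), hparts, ← intervalIntegral.integral_neg,
    ← intervalIntegral.integral_const_mul]
  congr with t
  push_cast
  ring

lemma IsObservable.rowCoeff_dp {f : ℝ × ℝ → ℂ} (hf : IsObservable f) (k : ℤ) (q : ℝ) :
    rowCoeff (QBaker.dp f) k q = -(2 * Real.pi * Complex.I * k) * rowCoeff f k q :=
  integral_deriv_mul_expi (h := fun p => f (q, p)) (hasDerivAt_dp hf.differentiable q)
    (hf.dp.smooth.continuous.comp (by fun_prop))
    (by simpa only [zero_add] using hf.periodic_p q 0) k

lemma IsObservable.fourierCoeff₂_dp {f : ℝ × ℝ → ℂ} (hf : IsObservable f) (k : ℤ × ℤ) :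
    fourierCoeff₂ (QBaker.dp f) k = -(2 * Real.pi * Complex.I * k.1) * fourierCoeff₂ f k := by
  rw [fourierCoeff₂_eq_integral_rowCoeff hf.smooth.continuous,
    fourierCoeff₂_eq_integral_rowCoeff hf.dp.smooth.continuous,
    ← intervalIntegral.integral_const_mul]
  simp_rw [hf.rowCoeff_dp, mul_assoc]

lemma IsObservable.fourierCoeff₂_dq {f : ℝ × ℝ → ℂ} (hf : IsObservable f) (k : ℤ × ℤ) :
    fourierCoeff₂ (QBaker.dq f) k = 2 * Real.pi * Complex.I * k.2 * fourierCoeff₂ f k :=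
  calc fourierCoeff₂ (QBaker.dq f) k
      = fourierCoeff₂ (QBaker.dp (f ∘ Prod.swap)) (-k.2, -k.1) :=
        fourierCoeff₂_comp_swap (QBaker.dp (f ∘ Prod.swap)) k
    _ = 2 * Real.pi * Complex.I * k.2 * fourierCoeff₂ f k := by
        rw [hf.comp_swap.fourierCoeff₂_dp, fourierCoeff₂_comp_swap]
        simp only [neg_neg, Int.cast_neg, mul_neg]

lemma IsObservable.fourierCoeff₂_iterate {f : ℝ × ℝ → ℂ} (hf : IsObservable f) (i j : ℕ)
    (k : ℤ × ℤ) :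
    fourierCoeff₂ (QBaker.dq^[i] (QBaker.dp^[j] f)) k
      = (2 * Real.pi * Complex.I * k.2) ^ i * (-(2 * Real.pi * Complex.I * k.1)) ^ j
        * fourierCoeff₂ f k := by
  have hiterate_dp : fourierCoeff₂ (QBaker.dp^[j] f) k
      = (-(2 * Real.pi * Complex.I * k.1)) ^ j * fourierCoeff₂ f k := by
    induction j with
    | zero => rw [Function.iterate_zero_apply, pow_zero, one_mul]
    | succ j ih =>
      rw [Function.iterate_succ_apply', (hf.iterate_dp j).fourierCoeff₂_dp, ih, pow_succ']
      ring
  induction i with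
  | zero => rw [Function.iterate_zero_apply, pow_zero, one_mul, hiterate_dp]
  | succ i ih =>
    rw [Function.iterate_succ_apply', ((hf.iterate_dp j).iterate_dq i).fourierCoeff₂_dq, ih,
      pow_succ' _ i]
    ring

lemma IsObservable.pow_mul_norm_fourierCoeff₂_le {f : ℝ × ℝ → ℂ} (hf : IsObservable f)
    (i j : ℕ) (k : ℤ × ℤ) :
    |(k.2 : ℝ)| ^ i * |(k.1 : ℝ)| ^ j * ‖fourierCoeff₂ f k‖
      ≤ supNorm (QBaker.dq^[i] (QBaker.dp^[j] f)) := by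
  have habs_le (n : ℤ) : |(n : ℝ)| ≤ ‖2 * (Real.pi : ℂ) * Complex.I * n‖ := by
    simp only [norm_mul, Complex.norm_I, Complex.norm_real, Complex.norm_intCast,
      Real.norm_eq_abs, abs_of_pos Real.pi_pos, Complex.norm_ofNat, mul_one]
    exact le_mul_of_one_le_left (abs_nonneg _) (by linarith [Real.pi_gt_three])
  have hderiv := (hf.iterate_dp j).iterate_dq i
  calc |(k.2 : ℝ)| ^ i * |(k.1 : ℝ)| ^ j * ‖fourierCoeff₂ f k‖
      ≤ ‖2 * (Real.pi : ℂ) * Complex.I * k.2‖ ^ i * ‖2 * (Real.pi : ℂ) * Complex.I * k.1‖ ^ j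
          * ‖fourierCoeff₂ f k‖ := by
        gcongr <;> exact habs_le _
    _ = ‖fourierCoeff₂ (QBaker.dq^[i] (QBaker.dp^[j] f)) k‖ := by
        simp only [hf.fourierCoeff₂_iterate, norm_mul, norm_pow, norm_neg]
    _ ≤ supNorm (QBaker.dq^[i] (QBaker.dp^[j] f)) :=
        norm_fourierCoeff₂_le hderiv.smooth.continuous hderiv.norm_le_supNorm k

lemma summable_one_div_one_add_sq : Summable fun k : ℤ => 1 / (1 + (k : ℝ) ^ 2) := by
  have hsq : Summable fun k : ℤ => 1 / (k : ℝ) ^ 2 :=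
    Real.summable_one_div_int_pow.mpr one_lt_two
  refine Summable.of_norm_bounded_eventually hsq ?_
  filter_upwards [(Set.finite_singleton (0 : ℤ)).eventually_cofinite_notMem] with k hk
  have hk_ne : k ≠ 0 := hk
  have hk_sq : (0 : ℝ) < (k : ℝ) ^ 2 := by positivity
  rw [Real.norm_of_nonneg (by positivity)]
  exact one_div_le_one_div_of_le hk_sq (by linarith)

lemma IsObservable.summable_norm_fourierCoeff₂ {f : ℝ × ℝ → ℂ} (hf : IsObservable f) :
    Summable fun k => ‖fourierCoeff₂ f k‖ := by
  have hdecay := summable_one_div_one_add_sq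
  refine Summable.of_nonneg_of_le (fun _ => norm_nonneg _) (fun k => ?_)
    ((hdecay.mul_of_nonneg hdecay (fun k => by positivity) fun k => by positivity).mul_left
      (supNorm f + supNorm (QBaker.dq^[2] f) + supNorm (QBaker.dp^[2] f)
        + supNorm (QBaker.dq^[2] (QBaker.dp^[2] f))))
  have h₀₀ := hf.pow_mul_norm_fourierCoeff₂_le 0 0 k
  have h₂₀ := hf.pow_mul_norm_fourierCoeff₂_le 2 0 k
  have h₀₂ := hf.pow_mul_norm_fourierCoeff₂_le 0 2 k
  have h₂₂ := hf.pow_mul_norm_fourierCoeff₂_le 2 2 k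
  simp only [sq_abs, pow_zero, one_mul, mul_one, Function.iterate_zero, id_eq] at h₀₀ h₂₀ h₀₂ h₂₂
  rw [one_div_mul_one_div, mul_one_div, le_div_iff₀ (by positivity)]
  linarith

lemma hasSum_fourier_of_periodic {h : ℝ → ℂ} (hcont : Continuous h)
    (hper : Function.Periodic h 1) {c : ℤ → ℂ}
    (hcoeff : ∀ k, c k = ∫ x in (0 : ℝ)..1, h x * expi (-(k * x))) (hsum : Summable c) (x : ℝ) :
    HasSum (fun k => c k * expi (k * x)) (h x) := by
  have hlift : Continuous (hper.lift : UnitAddCircle → ℂ) := continuous_coinduced_dom.mpr hcont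
  let F : C(UnitAddCircle, ℂ) := ⟨hper.lift, hlift⟩
  have hfourier (k : ℤ) (x : ℝ) : fourier k (x : UnitAddCircle) = expi (k * x) := by
    rw [fourier_coe_apply, expi]
    push_cast
    ring_nf
  have hF : fourierCoeff F = c := by
    ext k
    rw [fourierCoeff_eq_intervalIntegral _ _ 0, hcoeff, zero_add, div_one, one_smul]
    congr with x
    rw [hfourier, smul_eq_mul, mul_comm, Int.cast_neg, neg_mul]
    rfl
  have hseries := has_pointwise_sum_fourier_series_of_summable (f := F) (hF ▸ hsum) x
  simp only [hF, hfourier, smul_eq_mul] at hseries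
  exact hseries

lemma IsObservable.hasSum_rowCoeff {f : ℝ × ℝ → ℂ} (hf : IsObservable f) (k : ℤ) (q : ℝ) :
    HasSum (fun l : ℤ => fourierCoeff₂ f (k, l) * expi (l * q)) (rowCoeff f k q) :=
  hasSum_fourier_of_periodic (continuous_rowCoeff hf.smooth.continuous k)
    (fun q => by simp only [rowCoeff, hf.periodic_q])
    (fun l => fourierCoeff₂_eq_integral_rowCoeff hf.smooth.continuous (k, l))
    (hf.summable_norm_fourierCoeff₂.of_norm.prod_factor k) q

/-! ### Gaussian multipliers -/

/-- The Fourier series with coefficients `c` converges absolutely and its sum is bounded by `S`.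
Estimates of Fourier multipliers in the sup norm are phrased through this predicate. -/
structure FourierBound (c : ℤ → ℂ) (S : ℝ) : Prop where
  summable : Summable fun k => ‖c k‖
  norm_tsum_le : ∀ q : ℝ, ‖∑' k : ℤ, c k * expi (k * q)‖ ≤ S

lemma integral_expi_mul_gaussian {α : ℝ} (hα : 0 < α) (k : ℤ) :
    ∫ x : ℝ, expi (k * x) * (Real.exp (-(Real.pi ^ 2 / α) * x ^ 2) : ℂ)
      = ((∫ x : ℝ, Real.exp (-(Real.pi ^ 2 / α) * x ^ 2) : ℝ) : ℂ)
        * (Real.exp (-(α * k ^ 2)) : ℂ) := by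
  set b : ℝ := Real.pi ^ 2 / α with hb
  have hfourier (k : ℤ) : ∫ x : ℝ, expi (k * x) * (Real.exp (-b * x ^ 2) : ℂ)
      = (Real.pi / (b : ℂ)) ^ (1 / 2 : ℂ) * (Real.exp (-(α * k ^ 2)) : ℂ) := by
    have hb_re : 0 < (b : ℂ).re := by
      rw [Complex.ofReal_re]
      positivity
    convert fourierIntegral_gaussian hb_re (2 * Real.pi * k) using 2
    · ext x
      simp only [expi]
      push_cast
      ring_nf
    · have hα_ne : (α : ℂ) ≠ 0 := mod_cast hα.ne'
      have hπ_ne : (Real.pi : ℂ) ≠ 0 := mod_cast Real.pi_ne_zero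
      rw [hb]
      push_cast
      congr 1
      field_simp
      ring
  have hmass := hfourier 0
  simp only [Int.cast_zero, zero_mul, expi_zero, one_mul, ne_eq, OfNat.ofNat_ne_zero,
    not_false_eq_true, zero_pow, mul_zero, neg_zero, Real.exp_zero, Complex.ofReal_one,
    mul_one, integral_complex_ofReal] at hmass
  rw [hfourier, hmass]

namespace FourierBound

variable {c d : ℤ → ℂ} {S R : ℝ}

lemma nonneg (hc : FourierBound c S) : 0 ≤ S := (norm_nonneg _).trans (hc.norm_tsum_le 0)

lemma summable_mul_expi (hc : FourierBound c S) (q : ℝ) :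
    Summable fun k : ℤ => c k * expi (k * q) :=
  Summable.of_norm (by simpa only [norm_mul, norm_expi, mul_one] using hc.summable)

lemma mono (hc : FourierBound c S) (hSR : S ≤ R) : FourierBound c R :=
  ⟨hc.summable, fun q => (hc.norm_tsum_le q).trans hSR⟩

lemma add (hc : FourierBound c S) (hd : FourierBound d R) :
    FourierBound (fun k => c k + d k) (S + R) where
  summable := .of_nonneg_of_le (fun _ => norm_nonneg _) (fun _ => norm_add_le _ _)
    (hc.summable.add hd.summable)
  norm_tsum_le q := by
    simp_rw [add_mul]
    rw [(hc.summable_mul_expi q).tsum_add (hd.summable_mul_expi q)]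
    exact norm_add_le_of_le (hc.norm_tsum_le q) (hd.norm_tsum_le q)

lemma const_mul (hc : FourierBound c S) (a : ℂ) : FourierBound (fun k => a * c k) (‖a‖ * S) where
  summable := by simpa only [norm_mul] using hc.summable.mul_left ‖a‖
  norm_tsum_le q := by
    simp_rw [mul_assoc]
    rw [tsum_mul_left, norm_mul]
    exact mul_le_mul_of_nonneg_left (hc.norm_tsum_le q) (norm_nonneg a)

lemma integral_mul {T : Type*} [MeasurableSpace T] {μ : Measure T}
    (hc : Summable fun k => ‖c k‖) {w : ℤ → T → ℂ} {φ : T → ℝ}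
    (hw : ∀ k, AEStronglyMeasurable (w k) μ) (hφ : Integrable φ μ)
    (hle : ∀ k, ∀ᵐ t ∂μ, ‖w k t‖ ≤ φ t)
    (hS : ∀ᵐ t ∂μ, FourierBound (fun k => w k t * c k) (φ t * S)) :
    FourierBound (fun k => (∫ t, w k t ∂μ) * c k) ((∫ t, φ t ∂μ) * S) where
  summable := .of_nonneg_of_le (fun _ => norm_nonneg _)
    (fun k => (norm_mul_le _ _).trans (mul_le_mul_of_nonneg_right
      (norm_integral_le_of_norm_le hφ (hle k)) (norm_nonneg _))) (hc.mul_left (∫ t, φ t ∂μ))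
  norm_tsum_le q := by
    have hint (k : ℤ) : Integrable (fun t => w k t * c k * expi (k * q)) μ :=
      ((hφ.mono' (hw k) (hle k)).mul_const _).mul_const _
    have hsummable : Summable fun k => ∫ t, ‖w k t * c k * expi (k * q)‖ ∂μ := by
      simp_rw [norm_mul, norm_expi, mul_one, integral_mul_const]
      exact .of_nonneg_of_le (fun _ => by positivity) (fun k => mul_le_mul_of_nonneg_right
        (integral_mono_ae (hφ.mono' (hw k) (hle k)).norm hφ (hle k)) (norm_nonneg _))
        (hc.mul_left _)
    have hsum := (hasSum_integral_of_summable_integral_norm hint hsummable).tsum_eq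
    simp_rw [integral_mul_const] at hsum
    rw [hsum, ← integral_mul_const]
    exact norm_integral_le_of_norm_le (hφ.mul_const S) (hS.mono fun t ht => ht.norm_tsum_le q)

lemma translate (hc : FourierBound c S) (t : ℝ) :
    FourierBound (fun k => expi (k * t) * c k) S where
  summable := by simpa only [norm_mul, norm_expi, one_mul] using hc.summable
  norm_tsum_le q := by
    convert hc.norm_tsum_le (t + q) using 4 with k
    rw [mul_add, expi_add]
    ring

/-- Damping by the heat kernel averages translates of the sum against a Gaussian. -/
lemma exp_neg_mul_sq (hc : FourierBound c S) {α : ℝ} (hα : 0 ≤ α) :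
    FourierBound (fun k => (Real.exp (-(α * k ^ 2)) : ℂ) * c k) S := by
  rcases hα.eq_or_lt with rfl | hα
  · simpa only [zero_mul, neg_zero, Real.exp_zero, Complex.ofReal_one, one_mul] using hc
  set b : ℝ := Real.pi ^ 2 / α with hb
  have hb_pos : 0 < b := by positivity
  set mass : ℝ := ∫ x : ℝ, Real.exp (-b * x ^ 2) with hmass
  have hmass_pos : 0 < mass := by
    rw [hmass, integral_gaussian]
    positivity
  have hexpi := continuous_expi
  have hnorm (k : ℤ) (t : ℝ) :
      ‖expi (k * t) * (Real.exp (-b * t ^ 2) : ℂ)‖ = Real.exp (-b * t ^ 2) := by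
    rw [norm_mul, norm_expi, one_mul, Complex.norm_real, Real.norm_of_nonneg (Real.exp_pos _).le]
  have haverage := (integral_mul (μ := volume) (S := S) hc.summable
    (w := fun k t => expi (k * t) * (Real.exp (-b * t ^ 2) : ℂ))
    (fun k => Continuous.aestronglyMeasurable (by fun_prop)) (integrable_exp_neg_mul_sq hb_pos)
    (fun k => .of_forall fun t => (hnorm k t).le) (.of_forall fun t => ?_)).const_mul
    ((mass⁻¹ : ℝ) : ℂ)
  · simp only [hb, integral_expi_mul_gaussian hα] at haverage
    simp only [← hb, ← hmass, Complex.norm_real, Real.norm_of_nonneg (inv_pos.mpr hmass_pos).le,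
      inv_mul_cancel_left₀ hmass_pos.ne'] at haverage
    convert haverage using 2 with k
    rw [mul_assoc, Complex.ofReal_inv, inv_mul_cancel_left₀ (mod_cast hmass_pos.ne')]
  · have hdamped := (hc.translate t).const_mul (Real.exp (-b * t ^ 2) : ℂ)
    rw [Complex.norm_real, Real.norm_of_nonneg (Real.exp_pos _).le] at hdamped
    convert hdamped using 2 with k
    ring

variable {A B : ℝ}

lemma exp_neg_mul_quadratic (hc : FourierBound c S) (hA : 0 ≤ A) (hB : 0 ≤ B) {t : ℝ}
    (ht : 0 ≤ t) : FourierBound (fun k => (Real.exp (-(t * (A + B * k ^ 2))) : ℂ) * c k) S := by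
  have hdamped := (hc.exp_neg_mul_sq (mul_nonneg ht hB)).const_mul (Real.exp (-(t * A)) : ℂ)
  have hexp_le : Real.exp (-(t * A)) ≤ 1 := Real.exp_le_one_iff.mpr (by nlinarith)
  rw [Complex.norm_real, Real.norm_of_nonneg (Real.exp_pos _).le] at hdamped
  convert hdamped.mono (mul_le_of_le_one_left hc.nonneg hexp_le) using 2 with k
  rw [← mul_assoc, ← Complex.ofReal_mul, ← Real.exp_add]
  ring_nf

end FourierBound

/-- The multiplier `1 - e^{-x} (1 + x)`: what is left of the identity after Gaussian smoothing
with its second-order correction. It vanishes to second order at `x = 0`. -/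
def smoothingDefect (x : ℝ) : ℝ := 1 - Real.exp (-x) * (1 + x)

lemma smoothingDefect_nonneg (x : ℝ) : 0 ≤ smoothingDefect x := by
  have hexp : Real.exp (-x) * (1 + x) ≤ Real.exp (-x) * Real.exp x :=
    mul_le_mul_of_nonneg_left (by linarith [Real.add_one_le_exp x]) (Real.exp_pos _).le
  rw [← Real.exp_add, neg_add_cancel, Real.exp_zero] at hexp
  exact sub_nonneg.mpr hexp

lemma smoothingDefect_le_one {x : ℝ} (hx : 0 ≤ x) : smoothingDefect x ≤ 1 :=
  sub_le_self _ (by positivity)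

lemma integral_mul_exp_neg_mul (x : ℝ) :
    (∫ t in Set.Ioc (0 : ℝ) 1, t * Real.exp (-(t * x))) * x ^ 2 = smoothingDefect x := by
  have hantideriv (t : ℝ) : HasDerivAt (fun t : ℝ => -(1 + t * x) * Real.exp (-(t * x)))
      (t * Real.exp (-(t * x)) * x ^ 2) t := by
    have hlin : HasDerivAt (fun t : ℝ => t * x) x t := by
      simpa only [one_mul] using (hasDerivAt_id' t).mul_const x
    refine ((hlin.const_add 1).neg.mul hlin.neg.exp).congr_deriv ?_
    simp only [Pi.neg_apply]
    ring
  rw [← integral_mul_const, ← intervalIntegral.integral_of_le zero_le_one,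
    intervalIntegral.integral_eq_sub_of_hasDerivAt (fun t _ => hantideriv t)
      (Continuous.intervalIntegrable (by fun_prop) _ _), smoothingDefect]
  simp only [one_mul, zero_mul, neg_zero, Real.exp_zero]
  ring

namespace FourierBound

variable {c : ℤ → ℂ} {A B S R : ℝ}

/-- Taylor's formula `1 - e^{-x} (1 + x) = ∫₀¹ t x² e^{-tx} dt` reduces this to damping. -/
lemma smoothingDefect_of_sq (hA : 0 ≤ A) (hB : 0 ≤ B)
    (hc : FourierBound (fun k => ((A + B * k ^ 2 : ℝ) : ℂ) ^ 2 * c k) S) :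
    FourierBound (fun k => (smoothingDefect (A + B * k ^ 2) : ℂ) * c k) S := by
  have hunit : ∀ᵐ t : ℝ ∂volume.restrict (Set.Ioc 0 1), t ∈ Set.Ioc (0 : ℝ) 1 :=
    ae_restrict_mem measurableSet_Ioc
  have hnorm {t : ℝ} (ht : t ∈ Set.Ioc (0 : ℝ) 1) : ‖(t : ℂ)‖ ≤ 1 := by
    rw [Complex.norm_real, Real.norm_of_nonneg ht.1.le]
    exact ht.2
  have haverage := integral_mul (S := S) (φ := fun _ => 1) hc.summable
    (w := fun k t => ((t * Real.exp (-(t * (A + B * k ^ 2))) : ℝ) : ℂ))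
    (fun k => Continuous.aestronglyMeasurable (by fun_prop)) (integrable_const 1)
    (fun k => hunit.mono fun t ht => ?_) (hunit.mono fun t ht => ?_)
  · simp only [integral_complex_ofReal, integral_const, measureReal_restrict_apply_univ,
      Real.volume_real_Ioc, sub_zero, max_eq_left (zero_le_one (α := ℝ)), one_smul,
      one_mul] at haverage
    convert haverage using 2 with k
    rw [← integral_mul_exp_neg_mul, Complex.ofReal_mul, Complex.ofReal_pow, mul_assoc]
  · have hexp_le : Real.exp (-(t * (A + B * k ^ 2))) ≤ 1 :=
      Real.exp_le_one_iff.mpr (neg_nonpos.mpr (mul_nonneg ht.1.le (by positivity)))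
    rw [Complex.norm_real, Real.norm_of_nonneg (mul_nonneg ht.1.le (Real.exp_pos _).le)]
    exact mul_le_one₀ ht.2 (Real.exp_pos _).le hexp_le
  · have hdamped := (hc.exp_neg_mul_quadratic hA hB ht.1.le).const_mul (t : ℂ)
    refine FourierBound.mono ?_ (mul_le_mul_of_nonneg_right (hnorm ht) hc.nonneg)
    simpa only [Complex.ofReal_mul, mul_assoc] using hdamped

lemma smoothingDefect_of_quadratic (hA : 0 ≤ A) (hB : 0 ≤ B) (hc : FourierBound c S)
    (hquad : FourierBound (fun k => ((A + B * k ^ 2 : ℝ) : ℂ) * c k) R) :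
    FourierBound (fun k => (smoothingDefect (A + B * k ^ 2) : ℂ) * c k) (2 * S + R) := by
  have hdamped := (hc.exp_neg_mul_quadratic hA hB zero_le_one).add
    (hquad.exp_neg_mul_quadratic hA hB zero_le_one)
  convert hc.add (hdamped.const_mul (-1)) using 1
  · ext k
    rw [smoothingDefect, one_mul]
    push_cast
    ring
  · rw [norm_neg, norm_one]
    ring

end FourierBound

lemma lorentz_succ_le {h : ℝ} (hh : 0 < h) (n : ℕ) :
    h ^ 2 / (1 + h ^ 2 * ((n + 1 : ℕ) : ℝ) ^ 2)
      ≤ 2 * h * (1 / (1 + h * n) - 1 / (1 + h * (n + 1 : ℕ))) := by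
  have hn : 0 ≤ h * n := by positivity
  push_cast
  rw [div_sub_div _ _ (by positivity) (by positivity), mul_div_assoc',
    div_le_div_iff₀ (by positivity) (by positivity)]
  nlinarith [mul_nonneg (sq_nonneg h) (sq_nonneg (1 - h * (n + 1))),
    mul_nonneg (sq_nonneg h) hn, mul_nonneg (sq_nonneg h) hh.le, mul_nonneg (sq_nonneg h)
    (sq_nonneg (h * n))]

lemma sum_lorentz_succ_le {h : ℝ} (hh : 0 < h) (n : ℕ) :
    ∑ i ∈ Finset.range n, h ^ 2 / (1 + h ^ 2 * ((i + 1 : ℕ) : ℝ) ^ 2) ≤ 2 * h := by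
  have hlast : 0 ≤ 1 / (1 + h * (n : ℝ)) := by positivity
  refine (Finset.sum_le_sum fun i _ => lorentz_succ_le hh i).trans ?_
  rw [← Finset.mul_sum, Finset.sum_range_sub' (fun i : ℕ => 1 / (1 + h * (i : ℝ))),
    Nat.cast_zero, mul_zero, add_zero, div_one]
  nlinarith

lemma summable_lorentz_and_tsum_le {h : ℝ} (hh : 0 < h) (hh_le : h ≤ 1) :
    (Summable fun k : ℤ => h ^ 2 / (1 + h ^ 2 * (k : ℝ) ^ 2)) ∧
      ∑' k : ℤ, h ^ 2 / (1 + h ^ 2 * (k : ℝ) ^ 2) ≤ 5 * h := by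
  set f : ℤ → ℝ := fun k => h ^ 2 / (1 + h ^ 2 * (k : ℝ) ^ 2) with hf
  have hf_succ (n : ℕ) : f ((n : ℤ) + 1) = h ^ 2 / (1 + h ^ 2 * ((n + 1 : ℕ) : ℝ) ^ 2) := by
    simp only [hf, Int.cast_add, Int.cast_natCast, Int.cast_one, Nat.cast_add, Nat.cast_one]
  have hf_neg (n : ℕ) : f (-((n : ℤ) + 1)) = f ((n : ℤ) + 1) := by
    simp only [hf, Int.cast_neg, neg_sq]
  have hf_nonneg (n : ℕ) : 0 ≤ f ((n : ℤ) + 1) := by positivity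
  have hpartial (n : ℕ) : ∑ i ∈ Finset.range n, f ((i : ℤ) + 1) ≤ 2 * h := by
    simpa only [hf_succ] using sum_lorentz_succ_le hh n
  have hsucc : Summable fun n : ℕ => f ((n : ℤ) + 1) := summable_of_sum_range_le hf_nonneg hpartial
  have hnat : Summable fun n : ℕ => f n := (summable_nat_add_iff 1).mp (mod_cast hsucc)
  have hneg : Summable fun n : ℕ => f (-((n : ℤ) + 1)) := by simpa only [hf_neg] using hsucc
  refine ⟨Summable.of_nat_of_neg_add_one hnat hneg, ?_⟩
  have hsucc_le : ∑' n : ℕ, f ((n : ℤ) + 1) ≤ 2 * h :=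
    Real.tsum_le_of_sum_range_le hf_nonneg hpartial
  have hf_zero : f 0 = h ^ 2 := by
    simp only [hf, Int.cast_zero, ne_eq, OfNat.ofNat_ne_zero, not_false_eq_true, zero_pow,
      mul_zero, add_zero, div_one]
  rw [tsum_of_nat_of_neg_add_one hnat hneg, hnat.tsum_eq_zero_add]
  simp only [hf_neg, Nat.cast_zero, hf_zero, Nat.cast_add, Nat.cast_one]
  nlinarith

/-! ### The remainder of the corrected Gaussian smoothing -/

/-- The quadratic form `(π/2N)(k₂²/s + s k₁²)` for which `e^{-qform N s k}` is the expectation of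
the translation by `k` in a coherent state of squeezing `s`, up to a phase. -/
def qform (N : ℕ) (s : ℝ) (k : ℤ × ℤ) : ℝ :=
  Real.pi / (2 * N) * ((k.2 : ℝ) ^ 2 / s + s * (k.1 : ℝ) ^ 2)

lemma qform_nonneg (N : ℕ) {s : ℝ} (hs : 0 < s) (k : ℤ × ℤ) : 0 ≤ qform N s k := by
  unfold qform
  positivity

lemma qform_mk (N : ℕ) (s : ℝ) (k l : ℤ) :
    qform N s (k, l) = Real.pi / (2 * N) * (s * k ^ 2) + Real.pi / (2 * N * s) * l ^ 2 := by
  simp only [qform]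
  ring

/-- The Fourier coefficients of what is left of `f` after Gaussian smoothing of squeezing `s` with
its second-order correction. -/
def remCoeff (N : ℕ) (s : ℝ) (f : ℝ × ℝ → ℂ) (k : ℤ × ℤ) : ℂ :=
  (smoothingDefect (qform N s k) : ℂ) * fourierCoeff₂ f k

/-- Bounds on the fourth derivatives of `f` of even order in each variable, for an `f` of size `M`
varying on the scale `1 / μ` in position and `1 / ν` in momentum. -/
structure FourthDerivBound (μ ν M : ℝ) (f : ℝ × ℝ → ℂ) : Prop where
  dq_four : ∀ x, ‖dq^[4] f x‖ ≤ M * μ ^ 4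
  dq_two_dp_two : ∀ x, ‖dq^[2] (dp^[2] f) x‖ ≤ M * μ ^ 2 * ν ^ 2
  dp_four : ∀ x, ‖dp^[4] f x‖ ≤ M * ν ^ 4

namespace IsObservable

variable {f : ℝ × ℝ → ℂ} (hf : IsObservable f)

include hf

lemma summable_norm_remCoeff (N : ℕ) {s : ℝ} (hs : 0 < s) :
    Summable fun k => ‖remCoeff N s f k‖ := by
  refine .of_nonneg_of_le (fun _ => norm_nonneg _) (fun k => ?_) hf.summable_norm_fourierCoeff₂
  rw [remCoeff, norm_mul, Complex.norm_real, Real.norm_of_nonneg (smoothingDefect_nonneg _)]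
  exact mul_le_of_le_one_left (norm_nonneg _) (smoothingDefect_le_one (qform_nonneg N hs k))

lemma fourierBound {M : ℝ} (hM : ∀ x, ‖f x‖ ≤ M) (k : ℤ) :
    FourierBound (fun l => fourierCoeff₂ f (k, l)) M where
  summable := hf.summable_norm_fourierCoeff₂.prod_factor k
  norm_tsum_le q := by
    rw [(hf.hasSum_rowCoeff k q).tsum_eq]
    exact norm_rowCoeff_le hM k q

lemma fourierBound_pow_mul {i j : ℕ} {M : ℝ}
    (hM : ∀ x, ‖QBaker.dq^[i] (QBaker.dp^[j] f) x‖ ≤ M) (k : ℤ) :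
    FourierBound (fun l => (l : ℂ) ^ i * k ^ j * fourierCoeff₂ f (k, l))
      (M / (2 * Real.pi) ^ (i + j)) := by
  have hderiv := (((hf.iterate_dp j).iterate_dq i).fourierBound hM k).const_mul
    ((2 * Real.pi * Complex.I) ^ i * (-(2 * Real.pi * Complex.I)) ^ j)⁻¹
  convert hderiv using 1
  · ext l
    rw [hf.fourierCoeff₂_iterate, eq_inv_mul_iff_mul_eq₀ (mul_ne_zero
      (pow_ne_zero _ Complex.two_pi_I_ne_zero)
      (pow_ne_zero _ (neg_ne_zero.mpr Complex.two_pi_I_ne_zero))), ← neg_mul, mul_pow, mul_pow]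
    ring
  · simp only [norm_inv, norm_mul, norm_pow, norm_neg, Complex.norm_I, Complex.norm_real,
      Complex.norm_ofNat, mul_one, Real.norm_of_nonneg Real.pi_pos.le, ← pow_add]
    rw [div_eq_inv_mul]

end IsObservable

section Remainder

variable {f : ℝ × ℝ → ℂ} (hf : IsObservable f) {N : ℕ} (hN : 0 < N) {s ρ h M : ℝ} (hs : 0 < s)
  (hh : 0 < h) (hM : 0 ≤ M) (hsρ : s * ρ ^ 2 ≤ h * N) (hD : FourthDerivBound (s * ρ) ρ M f)
  (hρ : ρ ^ 2 ≤ 1 / h) (k : ℤ)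

include hf hN hs hM hsρ hD in
lemma fourierBound_qform_sq_mul :
    FourierBound (fun l => (qform N s (k, l) : ℂ) ^ 2 * fourierCoeff₂ f (k, l)) (M * h ^ 2) := by
  have : (0 : ℝ) < N := mod_cast hN
  have hs_ne : (s : ℂ) ≠ 0 := mod_cast hs.ne'
  have hseries := ((((hf.fourierBound_pow_mul (j := 0) hD.dq_four k).const_mul
    ((1 / s ^ 2 : ℝ) : ℂ)).add
    ((hf.fourierBound_pow_mul hD.dq_two_dp_two k).const_mul (2 : ℝ))).add
    ((hf.fourierBound_pow_mul (i := 0) (j := 4) hD.dp_four k).const_mul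
    ((s ^ 2 : ℝ) : ℂ))).const_mul (((Real.pi / (2 * N)) ^ 2 : ℝ) : ℂ)
  have hπN : 1 ≤ 16 * Real.pi ^ 2 := by nlinarith [Real.pi_gt_three]
  convert hseries.mono ?_ using 2 with l
  · rw [qform]
    push_cast
    field_simp
    ring
  · simp only [Complex.norm_real]
    rw [Real.norm_of_nonneg (by positivity), Real.norm_of_nonneg (by positivity),
      Real.norm_of_nonneg (by positivity), Real.norm_of_nonneg (by positivity)]
    calc _ = M * (s * ρ ^ 2) ^ 2 / (16 * Real.pi ^ 2 * N ^ 2) := by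
          field_simp
          ring
      _ ≤ M * (h * N) ^ 2 / (1 * N ^ 2) := by gcongr
      _ = M * h ^ 2 := by field_simp

include hf hN hs hh hM hsρ hD hρ in
lemma fourierBound_qform_mul_sq :
    FourierBound (fun l => (qform N s (k, l) : ℂ) * (k ^ 2 * fourierCoeff₂ f (k, l))) M := by
  have : (0 : ℝ) < N := mod_cast hN
  have hs_ne : (s : ℂ) ≠ 0 := mod_cast hs.ne'
  have hseries := (((hf.fourierBound_pow_mul hD.dq_two_dp_two k).const_mul ((1 / s : ℝ) : ℂ)).add
    ((hf.fourierBound_pow_mul (i := 0) (j := 4) hD.dp_four k).const_mul (s : ℂ))).const_mul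
    ((Real.pi / (2 * N) : ℝ) : ℂ)
  have hπN : 1 ≤ 16 * Real.pi ^ 3 := by nlinarith [Real.pi_gt_three, pow_pos Real.pi_pos 2]
  convert hseries.mono ?_ using 2 with l
  · rw [qform]
    push_cast
    field_simp
  · simp only [Complex.norm_real]
    rw [Real.norm_of_nonneg (by positivity), Real.norm_of_nonneg (by positivity),
      Real.norm_of_nonneg hs.le]
    calc _ = M * (s * ρ ^ 2 * ρ ^ 2) / (16 * Real.pi ^ 3 * N) := by
          field_simp
          ring
      _ ≤ M * (h * N * (1 / h)) / (1 * N) := by gcongr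
      _ = M := by field_simp

include hf hM hD hρ in
lemma fourierBound_pow_four_mul :
    FourierBound (fun l => (k : ℂ) ^ 4 * fourierCoeff₂ f (k, l)) (M / h ^ 2) := by
  have hπ : 1 ≤ (2 * Real.pi) ^ (0 + 4) := one_le_pow₀ (by linarith [Real.pi_gt_three])
  convert (hf.fourierBound_pow_mul (i := 0) (j := 4) hD.dp_four k).mono ?_ using 2 with l
  · rw [pow_zero, one_mul]
  · calc M * ρ ^ 4 / (2 * Real.pi) ^ (0 + 4) ≤ M * ρ ^ 4 := div_le_self (by positivity) hπ
      _ = M * (ρ ^ 2) ^ 2 := by ring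
      _ ≤ M * (1 / h) ^ 2 := by gcongr
      _ = M / h ^ 2 := by ring

include hf hN hs hh hM hsρ hD hρ in
/-- For `|k| ≤ 1/h` the quadratic form is small on the spectrum of `f` and the defect vanishes to
second order; for `|k| > 1/h` the decay comes from four derivatives in momentum. -/
lemma fourierBound_remCoeff :
    FourierBound (fun l => remCoeff N s f (k, l)) (6 * M * (h ^ 2 / (1 + h ^ 2 * k ^ 2))) := by
  have hA : 0 ≤ Real.pi / (2 * N) * (s * k ^ 2) := by positivity
  have hB : 0 ≤ Real.pi / (2 * N * s) := by positivity
  have hsq := fourierBound_qform_sq_mul hf hN hs hM hsρ hD k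
  have hquad := fourierBound_qform_mul_sq hf hN hs hh hM hsρ hD hρ k
  simp only [qform_mk] at hsq hquad
  simp only [remCoeff, qform_mk]
  by_cases hk : h ^ 2 * (k : ℝ) ^ 2 ≤ 1
  · refine (FourierBound.smoothingDefect_of_sq hA hB hsq).mono ?_
    rw [mul_div_assoc', le_div_iff₀ (by positivity)]
    nlinarith [mul_nonneg hM (sq_nonneg h)]
  · push Not at hk
    have hk_ne : (k : ℝ) ≠ 0 := fun hk_zero => by norm_num [hk_zero] at hk
    have hk_ne' : (k : ℂ) ≠ 0 := mod_cast hk_ne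
    have hk_sq : 0 < (k : ℝ) ^ 2 := by positivity
    have hlow : FourierBound (fun l => fourierCoeff₂ f (k, l)) (M / (k : ℝ) ^ 2) := by
      convert ((fourierBound_pow_four_mul hf hM hD hρ k).const_mul
        ((1 / k ^ 4 : ℝ) : ℂ)).mono ?_ using 2 with l
      · push_cast
        field_simp
      · rw [Complex.norm_real, Real.norm_of_nonneg (by positivity), div_mul_div_comm, one_mul,
          div_le_div_iff₀ (by positivity) hk_sq]
        nlinarith [mul_nonneg hM hk_sq.le]
    convert (hlow.smoothingDefect_of_quadratic (R := M / (k : ℝ) ^ 2) hA hB ?_).mono ?_ using 1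
    · convert hquad.const_mul ((1 / k ^ 2 : ℝ) : ℂ) using 2 with l
      · push_cast
        field_simp
      · rw [Complex.norm_real, Real.norm_of_nonneg (by positivity)]
        ring
    · have hM_div : M / (k : ℝ) ^ 2 ≤ 2 * M * (h ^ 2 / (1 + h ^ 2 * k ^ 2)) := by
        rw [mul_div_assoc', div_le_div_iff₀ hk_sq (by positivity)]
        nlinarith
      linarith

end Remainder

lemma norm_transSum_remCoeff_le {f : ℝ × ℝ → ℂ} (hf : IsObservable f) {N : ℕ} (hN : 0 < N)
    {s ρ h M : ℝ} (hs : 0 < s) (hh : 0 < h) (hh_le : h ≤ 1) (hM : 0 ≤ M) (hρ : ρ ^ 2 ≤ 1 / h)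
    (hsρ : s * ρ ^ 2 ≤ h * N) (hD : FourthDerivBound (s * ρ) ρ M f) :
    ‖transSum N (remCoeff N s f)‖ ≤ 30 * M * h := by
  obtain ⟨hsummable, htsum_le⟩ := summable_lorentz_and_tsum_le hh hh_le
  calc ‖transSum N (remCoeff N s f)‖
      ≤ ∑' k : ℤ, 6 * M * (h ^ 2 / (1 + h ^ 2 * k ^ 2)) :=
        norm_transSum_le N (hf.summable_norm_remCoeff N hs) (hsummable.mul_left _)
          fun k => (fourierBound_remCoeff hf hN hs hh hM hsρ hD hρ k).norm_tsum_le
    _ ≤ 6 * M * (5 * h) := by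
        rw [tsum_mul_left]
        gcongr
    _ = 30 * M * h := by ring

/-! ### The discrete Fourier transform and the quarter turn -/

lemma dftEntry_eq (N k j : ℕ) :
    dftEntry N k j = ((1 / Real.sqrt N : ℝ) : ℂ) * expi (-(k * j / N)) := by
  rw [dftEntry, expi]
  push_cast
  ring_nf

lemma dft_apply (N : ℕ) (k j : Fin N) :
    dft N k j = ((1 / Real.sqrt N : ℝ) : ℂ) * expi (-((k : ℕ) * (j : ℕ) / N)) := by
  rw [dft, Matrix.of_apply, dftEntry_eq]

lemma sum_expi {N : ℕ} (hN : 0 < N) (x : ℤ) :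
    ∑ l : Fin N, expi ((l : ℕ) * (x / N)) = if (N : ℤ) ∣ x then (N : ℂ) else 0 := by
  have hN_ne : (N : ℝ) ≠ 0 := mod_cast hN.ne'
  rw [Fin.sum_univ_eq_sum_range (fun l => expi ((l : ℕ) * (x / N))) N]
  simp_rw [← expi_pow]
  split_ifs with hdvd
  · obtain ⟨t, rfl⟩ := hdvd
    have hroot : expi (((N * t : ℤ) : ℝ) / N) = 1 := by
      rw [expi_eq_one_iff]
      exact ⟨t, by push_cast; field_simp⟩
    simp only [hroot, one_pow, Finset.sum_const, Finset.card_range, nsmul_eq_mul, mul_one]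
  · have hroot_ne : expi (x / N) ≠ 1 := by
      rw [Ne, expi_eq_one_iff]
      rintro ⟨t, ht⟩
      rw [div_eq_iff hN_ne] at ht
      exact hdvd ⟨t, by rw [mul_comm]; exact_mod_cast ht⟩
    rw [geom_sum_eq hroot_ne, expi_pow, mul_div_cancel₀ _ hN_ne, expi_int, sub_self, zero_div]

lemma sum_conj_dftEntry_mul {N : ℕ} (hN : 0 < N) (i j : Fin N) :
    ∑ k : Fin N, conj (dftEntry N k i) * dftEntry N k j = if i = j then 1 else 0 := by
  have hN_ne : (N : ℂ) ≠ 0 := mod_cast hN.ne'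
  have hproduct (k : Fin N) : conj (dftEntry N k i) * dftEntry N k j
      = (1 / N : ℂ) * expi ((k : ℕ) * (((i : ℤ) - (j : ℤ) : ℤ) / N)) := by
    rw [dftEntry_eq, dftEntry_eq, map_mul, Complex.conj_ofReal, conj_expi, mul_mul_mul_comm,
      ← expi_add, ← Complex.ofReal_mul, div_mul_div_comm, one_mul,
      Real.mul_self_sqrt (Nat.cast_nonneg N)]
    push_cast
    congr 2
    ring
  simp_rw [hproduct]
  rw [← Finset.mul_sum, sum_expi hN]
  by_cases hij : i = j
  · rw [if_pos hij, hij, sub_self, if_pos (dvd_zero _), one_div_mul_cancel hN_ne]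
  · rw [if_neg hij, if_neg, mul_zero]
    exact fun hdvd => hij (fin_eq_of_modEq (Int.modEq_iff_dvd.mpr hdvd).symm)

lemma dft_mem_unitary {N : ℕ} (hN : 0 < N) : dft N ∈ unitary (Matrix (Fin N) (Fin N) ℂ) := by
  rw [Matrix.mem_unitaryGroup_iff']
  ext i j
  rw [Matrix.mul_apply, Matrix.one_apply, ← sum_conj_dftEntry_mul hN]
  rfl

lemma mul_translation_apply {N : ℕ} (A : Matrix (Fin N) (Fin N) ℂ) (k : ℤ × ℤ) {l j m : Fin N}
    (hm : (m : ℤ) ≡ (j : ℤ) + k.1 [ZMOD N]) :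
    (A * translation N k) l j = A l m * expi (k.2 * (((j : ℕ) + k.1 / 2) / N)) := by
  rw [Matrix.mul_apply, translation_eq_weightedShift,
    Finset.sum_eq_single_of_mem m (Finset.mem_univ m), weightedShift_apply, if_pos hm]
  intro b _ hb
  rw [weightedShift_apply, if_neg fun h => hb (fin_eq_of_modEq (h.trans hm.symm)), mul_zero]

lemma translation_mul_apply {N : ℕ} (A : Matrix (Fin N) (Fin N) ℂ) (k : ℤ × ℤ) {l j n : Fin N}
    (hn : (l : ℤ) ≡ (n : ℤ) + k.1 [ZMOD N]) :
    (translation N k * A) l j = expi (k.2 * (((n : ℕ) + k.1 / 2) / N)) * A n j := by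
  rw [Matrix.mul_apply, translation_eq_weightedShift,
    Finset.sum_eq_single_of_mem n (Finset.mem_univ n), weightedShift_apply, if_pos hn]
  intro b _ hb
  rw [weightedShift_apply, if_neg, zero_mul]
  exact fun h => hb (fin_eq_of_modEq (Int.ModEq.add_right_cancel' k.1 (h.symm.trans hn)))

lemma exists_eq_add_mul_of_modEq {N : ℕ} {m x : ℤ} (hm : m ≡ x [ZMOD N]) :
    ∃ t : ℤ, (m : ℝ) = x + N * t := by
  obtain ⟨t, ht⟩ := hm.symm.dvd
  exact ⟨t, mod_cast sub_eq_iff_eq_add'.mp ht⟩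

lemma dft_mul_translation {N : ℕ} (hN : 0 < N) (k : ℤ × ℤ) :
    dft N * translation N k = translation N (k.2, -k.1) * dft N := by
  have hN_ne : (N : ℝ) ≠ 0 := mod_cast hN.ne'
  ext l j
  obtain ⟨m, hm⟩ := exists_fin_modEq hN ((j : ℤ) + k.1)
  obtain ⟨n, hn⟩ := exists_fin_modEq hN ((l : ℤ) - k.2)
  have hn_add : (l : ℤ) ≡ (n : ℤ) + k.2 [ZMOD N] := by
    simpa only [sub_add_cancel] using (hn.add_right k.2).symm
  rw [mul_translation_apply _ _ hm, translation_mul_apply _ _ hn_add, dft_apply, dft_apply,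
    mul_assoc, ← expi_add, mul_left_comm, ← expi_add]
  congr 1
  obtain ⟨t, ht⟩ := exists_eq_add_mul_of_modEq hm
  obtain ⟨u, hu⟩ := exists_eq_add_mul_of_modEq hn
  refine expi_eq_of_eq_add_int (-(l : ℕ) * t + k.1 * u + (j : ℕ) * u) ?_
  push_cast at ht hu ⊢
  rw [ht, hu]
  field_simp
  ring

/-- The quarter turn of the lattice of translations implemented by the discrete Fourier
transform. -/
def latticeRot : ℤ × ℤ ≃ ℤ × ℤ where
  toFun k := (k.2, -k.1)
  invFun k := (-k.2, k.1)
  left_inv k := by simp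
  right_inv k := by simp

section

variable {N : ℕ} (hN : 0 < N) {c c' : ℤ × ℤ → ℂ} (hc : Summable fun k => ‖c k‖)
  (hcc' : ∀ k, c' (latticeRot k) = c k)

include hN hc hcc'

lemma dft_mul_transSum : dft N * transSum N c = transSum N c' * dft N := by
  have hc' : Summable fun k => ‖c' k‖ := by
    rw [← latticeRot.summable_iff]
    simpa only [Function.comp_def, hcc'] using hc
  have hsum := summable_smul_translation N hc'
  calc dft N * transSum N c
      = ∑' k, dft N * (c k • translation N k) :=
        ((summable_smul_translation N hc).tsum_mul_left _).symm
    _ = ∑' k, c' (latticeRot k) • translation N (latticeRot k) * dft N := by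
        congr 1 with k : 1
        rw [hcc', Matrix.mul_smul, Matrix.smul_mul, dft_mul_translation hN]
        rfl
    _ = transSum N c' * dft N := by
        rw [(latticeRot.tsum_eq fun k => c' k • translation N k * dft N), hsum.tsum_mul_right]
        rfl

lemma norm_transSum_latticeRot : ‖transSum N c‖ = ‖transSum N c'‖ := by
  have hdft := dft_mem_unitary hN
  rw [← CStarRing.norm_mem_unitary_mul (transSum N c) hdft, dft_mul_transSum hN hc hcc',
    CStarRing.norm_mul_mem_unitary _ hdft]

end

/-- The observable `f` composed with a quarter turn of phase space. -/
def rot (f : ℝ × ℝ → ℂ) (x : ℝ × ℝ) : ℂ := f (-x.2, x.1)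

lemma dp_rot (f : ℝ × ℝ → ℂ) : dp (rot f) = -rot (dq f) := by
  ext x
  simp only [dp, rot, dq, Pi.neg_apply]
  rw [deriv_comp_neg (f := fun t => f (t, x.1))]

lemma dp_dp_rot (f : ℝ × ℝ → ℂ) : dp (dp (rot f)) = rot (dq (dq f)) := by
  have hdp_neg (g : ℝ × ℝ → ℂ) : dp (-g) = -dp g := by
    ext x
    simp only [dp, Pi.neg_apply, deriv.fun_neg]
  rw [dp_rot, hdp_neg, dp_rot, neg_neg]

namespace IsObservable

variable {f : ℝ × ℝ → ℂ} (hf : IsObservable f)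

include hf

lemma rot : IsObservable (rot f) where
  smooth := hf.smooth.comp (by fun_prop : ContDiff ℝ ∞ fun x : ℝ × ℝ => (-x.2, x.1))
  periodic_q q p := hf.periodic_p _ _
  periodic_p q p := by
    simp only [QBaker.rot]
    rw [← hf.periodic_q (-(p + 1)) q, neg_add_rev, neg_add_cancel_comm]

lemma fourierCoeff₂_rot (k : ℤ × ℤ) :
    fourierCoeff₂ (QBaker.rot f) (latticeRot k) = fourierCoeff₂ f k := by
  have hperiodic : Function.Periodic (fun q => rowCoeff f k.1 q * expi (-(k.2 * q))) 1 := by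
    intro q
    simp only [rowCoeff, hf.periodic_q]
    congr 1
    exact expi_eq_of_eq_add_int (-k.2) (by push_cast; ring)
  have hreflect := intervalIntegral.integral_comp_neg (a := 0) (b := 1)
    fun q => rowCoeff f k.1 q * expi (-(k.2 * q))
  have htranslate := hperiodic.intervalIntegral_add_eq (-1) 0
  rw [neg_zero] at hreflect
  rw [neg_add_cancel, zero_add] at htranslate
  have hswap := fourierCoeff₂_comp_swap (QBaker.rot f) (k.1, -k.2)
  rw [neg_neg] at hswap
  rw [fourierCoeff₂_eq_integral_rowCoeff hf.smooth.continuous, ← htranslate, ← hreflect,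
    latticeRot, Equiv.coe_fn_mk, ← hswap,
    fourierCoeff₂_eq_integral_rowCoeff hf.rot.comp_swap.smooth.continuous]
  simp only [Int.cast_neg, neg_mul, mul_neg]
  rfl

end IsObservable

lemma FourthDerivBound.rot {f : ℝ × ℝ → ℂ} {μ ν M : ℝ} (hf : IsObservable f)
    (hD : FourthDerivBound ν μ M f) : FourthDerivBound μ ν M (rot f) where
  dq_four x := hD.dp_four (-x.2, x.1)
  dq_two_dp_two x := by
    have hrot : dq^[2] (dp^[2] (QBaker.rot f)) = QBaker.rot (dq^[2] (dp^[2] f)) := by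
      rw [hf.iterate_dq_iterate_dp]
      simp only [Function.iterate_succ, Function.iterate_zero, Function.comp, id, dp_dp_rot]
      rfl
    rw [hrot]
    exact (hD.dq_two_dp_two _).trans_eq (by ring)
  dp_four x := by
    have hrot : dp^[4] (QBaker.rot f) = QBaker.rot (dq^[4] f) := by
      simp only [Function.iterate_succ, Function.iterate_zero, Function.comp, id, dp_dp_rot]
    rw [hrot]
    exact hD.dq_four _

lemma norm_transSum_remCoeff_one_div_le {f : ℝ × ℝ → ℂ} (hf : IsObservable f) {N : ℕ} (hN : 0 < N)
    {s ρ h M : ℝ} (hs : 0 < s) (hh : 0 < h) (hh_le : h ≤ 1) (hM : 0 ≤ M) (hρ : ρ ^ 2 ≤ 1 / h)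
    (hsρ : s * ρ ^ 2 ≤ h * N) (hD : FourthDerivBound ρ (s * ρ) M f) :
    ‖transSum N (remCoeff N (1 / s) f)‖ ≤ 30 * M * h := by
  rw [norm_transSum_latticeRot hN (hf.summable_norm_remCoeff N (by positivity))
    (c' := remCoeff N s (rot f))]
  · exact norm_transSum_remCoeff_le hf.rot hN hs hh hh_le hM hρ hsρ (hD.rot hf)
  · intro k
    have hqform : qform N s (latticeRot k) = qform N (1 / s) k := by
      simp only [qform, latticeRot, Equiv.coe_fn_mk, Int.cast_neg]
      field_simp
      ring
    rw [remCoeff, remCoeff, hf.fourierCoeff₂_rot, hqform]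

/-! ### The quantised baker's map -/

lemma bakerMix_mem_unitary {N : ℕ} (hN : 0 < N) (hN_even : Even N) :
    bakerMix N ∈ unitary (Matrix (Fin N) (Fin N) ℂ) := by
  obtain ⟨m, rfl⟩ := hN_even
  have hm : 0 < m := by lia
  have hhalf : (m + m) / 2 = m := by lia
  rw [Matrix.mem_unitaryGroup_iff']
  ext i j
  rw [Matrix.mul_apply, Matrix.one_apply, Fin.sum_univ_add]
  simp only [Matrix.star_apply, bakerMix, Matrix.of_apply, hhalf, Fin.val_castAdd, Fin.val_natAdd,
    RCLike.star_def, Fin.is_lt, Nat.not_le.mpr (Fin.is_lt _), Nat.not_lt.mpr,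
    Nat.le_add_right, true_and, false_and, if_false, Nat.add_sub_cancel_left]
  by_cases hi : (i : ℕ) < m <;> by_cases hj : (j : ℕ) < m
  · have hupper := sum_conj_dftEntry_mul hm ⟨i, hi⟩ ⟨j, hj⟩
    simp only [Fin.mk.injEq] at hupper
    simpa [hi, hj, not_le.mpr hi, not_le.mpr hj, Fin.ext_iff] using hupper
  · have hij : i ≠ j := fun hij => hj (hij ▸ hi)
    simp [hi, hj, hij, not_le.mpr hi]
  · have hij : i ≠ j := fun hij => hi (hij ▸ hj)
    simp [hi, hj, hij, not_le.mpr hj]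
  · have hlower := sum_conj_dftEntry_mul hm ⟨i - m, by lia⟩ ⟨j - m, by lia⟩
    have hsub_eq : ((i : ℕ) - m = j - m) ↔ i = j := by lia
    simp only [Fin.mk.injEq, hsub_eq] at hlower
    simpa [hi, hj, not_lt.mp hi, not_lt.mp hj] using hlower

lemma dft_inv {N : ℕ} (hN : 0 < N) : (dft N)⁻¹ = star (dft N) :=
  Matrix.inv_eq_left_inv (Unitary.star_mul_self_of_mem (dft_mem_unitary hN))

lemma quantumBaker_mem_unitary {N : ℕ} (hN : 0 < N) (hN_even : Even N) :
    quantumBaker N ∈ unitary (Matrix (Fin N) (Fin N) ℂ) := by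
  rw [quantumBaker, dft_inv hN]
  exact mul_mem (Unitary.star_mem (dft_mem_unitary hN)) (bakerMix_mem_unitary hN hN_even)

lemma dft_mul_quantumBaker {N : ℕ} (hN : 0 < N) : dft N * quantumBaker N = bakerMix N := by
  rw [quantumBaker, dft_inv hN, ← mul_assoc, Unitary.mul_star_self_of_mem (dft_mem_unitary hN),
    one_mul]

/-! ### Gaussian sums -/

lemma summable_gaussian {β : ℝ} (hβ : 0 < β) (y : ℝ) :
    Summable fun n : ℤ => Real.exp (-(β * (n + y) ^ 2)) := by
  convert (HurwitzZeta.hasSum_int_evenKernel y (div_pos hβ Real.pi_pos)).summable using 3 with n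
  field_simp

lemma tsum_gaussian_le {β : ℝ} (hβ : 1 ≤ β) (y : ℝ) :
    ∑' n : ℤ, Real.exp (-(β * (n + y) ^ 2)) ≤ 30 := by
  set t := Int.fract y with ht
  have ht_nonneg : 0 ≤ t := Int.fract_nonneg y
  have ht_lt : t < 1 := Int.fract_lt_one y
  have hterm_le (n : ℤ) : Real.exp (-(β * (n + t) ^ 2))
      ≤ 6 * (1 ^ 2 / (1 + 1 ^ 2 * (n : ℝ) ^ 2)) := by
    have hsq : -(β * ((n : ℝ) + t) ^ 2) ≤ 1 + -((n : ℝ) ^ 2 / 2) := by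
      nlinarith [sq_nonneg ((n : ℝ) + 2 * t), sq_nonneg ((n : ℝ) + t)]
    have hexp : Real.exp (-((n : ℝ) ^ 2 / 2)) ≤ 2 / (1 + (n : ℝ) ^ 2) := by
      rw [Real.exp_neg, ← one_div, div_le_div_iff₀ (Real.exp_pos _) (by positivity)]
      linarith [Real.add_one_le_exp ((n : ℝ) ^ 2 / 2)]
    calc Real.exp (-(β * ((n : ℝ) + t) ^ 2)) ≤ Real.exp (1 + -((n : ℝ) ^ 2 / 2)) :=
          Real.exp_le_exp.mpr hsq
      _ = Real.exp 1 * Real.exp (-((n : ℝ) ^ 2 / 2)) := Real.exp_add _ _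
      _ ≤ 3 * (2 / (1 + (n : ℝ) ^ 2)) := by
          gcongr
          exact Real.exp_one_lt_three.le
      _ = 6 * (1 ^ 2 / (1 + 1 ^ 2 * (n : ℝ) ^ 2)) := by ring
  obtain ⟨hsummable, htsum_le⟩ := summable_lorentz_and_tsum_le one_pos le_rfl
  calc ∑' n : ℤ, Real.exp (-(β * (n + y) ^ 2))
      = ∑' n : ℤ, Real.exp (-(β * (n + t) ^ 2)) := by
        rw [← (Equiv.addRight ⌊y⌋).tsum_eq fun n : ℤ => Real.exp (-(β * (n + t) ^ 2))]
        simp only [Equiv.coe_addRight, Int.cast_add, ht, Int.fract, add_add_sub_cancel]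
    _ ≤ ∑' n : ℤ, 6 * (1 ^ 2 / (1 + 1 ^ 2 * (n : ℝ) ^ 2)) :=
        (summable_gaussian (by linarith) _).tsum_le_tsum hterm_le (hsummable.mul_left 6)
    _ ≤ 30 := by
        rw [tsum_mul_left]
        linarith

lemma tsum_gaussian_tail_le {β d : ℝ} (hβ : 2 ≤ β) (hd : 0 ≤ d) {y : ℝ}
    (hy : ∀ n : ℤ, d ≤ |(n : ℝ) + y|) :
    ∑' n : ℤ, Real.exp (-(β * (n + y) ^ 2)) ≤ 30 * Real.exp (-(β / 2 * d ^ 2)) := by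
  have hterm_le (n : ℤ) : Real.exp (-(β * (n + y) ^ 2))
      ≤ Real.exp (-(β / 2 * (n + y) ^ 2)) * Real.exp (-(β / 2 * d ^ 2)) := by
    have hsq : d ^ 2 ≤ ((n : ℝ) + y) ^ 2 := sq_le_sq.mpr (by rw [abs_of_nonneg hd]; exact hy n)
    rw [← Real.exp_add, Real.exp_le_exp]
    nlinarith
  have hhalf := summable_gaussian (show 0 < β / 2 by linarith) y
  calc ∑' n : ℤ, Real.exp (-(β * (n + y) ^ 2))
      ≤ ∑' n : ℤ, Real.exp (-(β / 2 * (n + y) ^ 2)) * Real.exp (-(β / 2 * d ^ 2)) :=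
        (summable_gaussian (by linarith) y).tsum_le_tsum hterm_le (hhalf.mul_right _)
    _ ≤ 30 * Real.exp (-(β / 2 * d ^ 2)) := by
        rw [tsum_mul_right]
        gcongr
        exact tsum_gaussian_le (by linarith) y

lemma tsum_gaussian_mul_expi {α : ℝ} (hα : 0 < α) (c θ : ℝ) :
    ∑' n : ℤ, (Real.exp (-(Real.pi * α * (n - c) ^ 2)) : ℂ) * expi (θ * n)
      = ((1 / Real.sqrt α : ℝ) : ℂ) * ∑' n : ℤ, (Real.exp (-(Real.pi / α * (n - θ) ^ 2)) : ℂ)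
        * expi (-(c * (n - θ))) := by
  have hpoisson :=
    Complex.tsum_exp_neg_quadratic (a := (α : ℂ)) (by simpa) (α * c + Complex.I * θ)
  have hα_ne : (α : ℂ) ≠ 0 := mod_cast hα.ne'
  have hsqrt : (α : ℂ) ^ (1 / 2 : ℂ) = ((Real.sqrt α : ℝ) : ℂ) := by
    rw [Real.sqrt_eq_rpow, Complex.ofReal_cpow hα.le, Complex.ofReal_div, Complex.ofReal_one,
      Complex.ofReal_ofNat]
  have hleft (n : ℤ) : (Real.exp (-(Real.pi * α * (n - c) ^ 2)) : ℂ) * expi (θ * n)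
      = Complex.exp (-(Real.pi * α * c ^ 2)) * Complex.exp (-Real.pi * α * n ^ 2
        + 2 * Real.pi * (α * c + Complex.I * θ) * n) := by
    rw [expi, Complex.ofReal_exp, ← Complex.exp_add, ← Complex.exp_add]
    push_cast
    ring_nf
  have hright (n : ℤ) : (Real.exp (-(Real.pi / α * (n - θ) ^ 2)) : ℂ) * expi (-(c * (n - θ)))
      = Complex.exp (-(Real.pi * α * c ^ 2)) * Complex.exp (-Real.pi / α
        * (n + Complex.I * (α * c + Complex.I * θ)) ^ 2) := by
    have hsq : ((n : ℂ) + Complex.I * (α * c + Complex.I * θ)) ^ 2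
        = ((n : ℂ) - θ) ^ 2 + 2 * Complex.I * α * c * (n - θ) - α ^ 2 * c ^ 2 := by
      linear_combination (α ^ 2 * c ^ 2 + 2 * n * θ + θ ^ 2 * (Complex.I ^ 2 - 1)
        + 2 * α * c * Complex.I * θ) * Complex.I_sq
    rw [expi, Complex.ofReal_exp, ← Complex.exp_add, ← Complex.exp_add, hsq]
    push_cast
    congr 1
    field_simp
    ring
  simp_rw [hleft, hright, tsum_mul_left, hpoisson, hsqrt]
  push_cast
  ring

/-! ### Coherent states on the torus -/

/-- The Gaussian wave packet centred at `x = (q, p)` with squeezing `s`, sampled on the lattice of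
step `1 / N`. -/
def wave (N : ℕ) (s : ℝ) (x : ℝ × ℝ) (n : ℤ) : ℂ :=
  (Real.exp (-(Real.pi * (s / N) * (n - N * x.1) ^ 2)) : ℂ) * expi (x.2 * n)

/-- The torus coherent state centred at `x = (q, p)` with squeezing `s`: the periodisation of a
Gaussian wave packet, normalised up to an exponentially small error. -/
def coherent (N : ℕ) (s : ℝ) (x : ℝ × ℝ) (j : Fin N) : ℂ :=
  ((Real.sqrt (Real.sqrt (2 * s / N)) : ℝ) : ℂ) * ∑' n : ℤ, wave N s x ((j : ℕ) + N * n)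

lemma norm_wave (N : ℕ) (s : ℝ) (x : ℝ × ℝ) (n : ℤ) :
    ‖wave N s x n‖ = Real.exp (-(Real.pi * (s / N) * (n - N * x.1) ^ 2)) := by
  rw [wave, norm_mul, norm_expi, mul_one, Complex.norm_real,
    Real.norm_of_nonneg (Real.exp_pos _).le]

lemma summable_wave {N : ℕ} (hN : 0 < N) {s : ℝ} (hs : 0 < s) (x : ℝ × ℝ) :
    Summable fun n : ℤ => ‖wave N s x n‖ := by
  simp_rw [norm_wave, sub_eq_add_neg]
  exact summable_gaussian (by positivity) _

lemma norm_wave_add_mul {N : ℕ} (hN : 0 < N) (s : ℝ) (x : ℝ × ℝ) (j n : ℤ) :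
    ‖wave N s x (j + N * n)‖ = Real.exp (-(Real.pi * s * N * (n + (j / N - x.1)) ^ 2)) := by
  rw [norm_wave]
  push_cast
  field_simp
  ring_nf

lemma summable_wave_add_mul {N : ℕ} (hN : 0 < N) {s : ℝ} (hs : 0 < s) (x : ℝ × ℝ) (j : ℤ) :
    Summable fun n : ℤ => ‖wave N s x (j + N * n)‖ := by
  simp_rw [norm_wave_add_mul hN]
  exact summable_gaussian (by positivity) _

lemma wave_mul_conj_wave (N : ℕ) (s : ℝ) (x : ℝ × ℝ) (m j : ℤ) :
    wave N s x m * conj (wave N s x j)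
      = (Real.exp (-(Real.pi * s / (2 * N) * (m - j) ^ 2)) : ℂ) * expi (x.2 * (m - j))
        * (Real.exp (-(2 * Real.pi * s / N * ((m + j) / 2 - N * x.1) ^ 2)) : ℂ) := by
  have hgauss : Real.exp (-(Real.pi * (s / N) * (m - N * x.1) ^ 2))
      * Real.exp (-(Real.pi * (s / N) * (j - N * x.1) ^ 2))
      = Real.exp (-(Real.pi * s / (2 * N) * (m - j) ^ 2))
        * Real.exp (-(2 * Real.pi * s / N * ((m + j) / 2 - N * x.1) ^ 2)) := by
    rw [← Real.exp_add, ← Real.exp_add]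
    ring_nf
  have hphase : expi (x.2 * (m - j)) = expi (x.2 * m) * expi (-(x.2 * j)) := by
    rw [← expi_add]
    ring_nf
  have hgauss' := congrArg ((↑) : ℝ → ℂ) hgauss
  rw [Complex.ofReal_mul, Complex.ofReal_mul] at hgauss'
  rw [wave, wave, map_mul, Complex.conj_ofReal, conj_expi, hphase]
  linear_combination expi (x.2 * m) * expi (-(x.2 * j)) * hgauss'

/-! ### The projector onto a coherent state -/

/-- The coefficients of the projector onto a coherent state in the basis of translations. -/
def projCoeff (N : ℕ) (s : ℝ) (x : ℝ × ℝ) (k : ℤ × ℤ) : ℂ :=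
  ((1 / N * Real.exp (-qform N s k) : ℝ) : ℂ) * expi (-(x.1 * k.2 - x.2 * k.1))

lemma norm_projCoeff (N : ℕ) (s : ℝ) (x : ℝ × ℝ) (k : ℤ × ℤ) :
    ‖projCoeff N s x k‖ = 1 / N * Real.exp (-qform N s k) := by
  rw [projCoeff, norm_mul, norm_expi, mul_one, Complex.norm_real,
    Real.norm_of_nonneg (by positivity)]

lemma exp_neg_qform (N : ℕ) (s : ℝ) (k : ℤ × ℤ) :
    Real.exp (-qform N s k) = Real.exp (-(Real.pi * s / (2 * N) * k.1 ^ 2))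
      * Real.exp (-(Real.pi * (1 / (2 * N * s)) * k.2 ^ 2)) := by
  rw [← Real.exp_add, qform]
  ring_nf

lemma summable_exp_neg_qform {N : ℕ} (hN : 0 < N) {s : ℝ} (hs : 0 < s) :
    Summable fun k => Real.exp (-qform N s k) := by
  have hsum₁ := summable_gaussian (β := Real.pi * s / (2 * N)) (by positivity) 0
  have hsum₂ := summable_gaussian (β := Real.pi * (1 / (2 * N * s))) (by positivity) 0
  simp_rw [add_zero] at hsum₁ hsum₂
  simp_rw [exp_neg_qform]
  exact hsum₁.mul_of_nonneg hsum₂ (fun _ => (Real.exp_pos _).le) fun _ => (Real.exp_pos _).le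

lemma summable_projCoeff {N : ℕ} (hN : 0 < N) {s : ℝ} (hs : 0 < s) (x : ℝ × ℝ) :
    Summable fun k => ‖projCoeff N s x k‖ := by
  simp_rw [norm_projCoeff]
  exact (summable_exp_neg_qform hN hs).mul_left _

lemma wave_add_mul_conj_wave_add {N : ℕ} (hN : 0 < N) (s : ℝ) (x : ℝ × ℝ) (m j n : ℤ) :
    wave N s x (m + N * n) * conj (wave N s x (j + N * n))
      = (Real.exp (-(Real.pi * s / (2 * N) * (m - j) ^ 2)) : ℂ) * expi (x.2 * (m - j))
        * (Real.exp (-(Real.pi / (1 / (2 * N * s))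
          * ((-n : ℤ) - ((j + ((m - j : ℤ) : ℝ) / 2) / N - x.1)) ^ 2)) : ℂ) := by
  rw [wave_mul_conj_wave]
  congr 3
  · push_cast
    ring_nf
  · push_cast
    ring_nf
  · push_cast
    field_simp
    ring_nf

lemma tsum_projCoeff_mul_expi {N : ℕ} (hN : 0 < N) {s : ℝ} (hs : 0 < s) (x : ℝ × ℝ) (m j : ℤ) :
    ∑' k₂ : ℤ, projCoeff N s x (m - j, k₂) * expi (k₂ * ((j + ((m - j : ℤ) : ℝ) / 2) / N))
      = ((Real.sqrt (2 * s / N) : ℝ) : ℂ)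
        * ∑' n : ℤ, wave N s x (m + N * n) * conj (wave N s x (j + N * n)) := by
  have hconst : 1 / N * (1 / Real.sqrt (1 / (2 * N * s))) = Real.sqrt (2 * s / N) := by
    rw [show 2 * s / N = (2 * N * s) / N ^ 2 by field_simp, Real.sqrt_div zero_le_one,
      Real.sqrt_one, one_div_one_div, Real.sqrt_div (by positivity), Real.sqrt_sq N.cast_nonneg]
    ring
  set θ : ℝ := (j + ((m - j : ℤ) : ℝ) / 2) / N - x.1 with hθ
  have hterm (k₂ : ℤ) :
      projCoeff N s x (m - j, k₂) * expi (k₂ * ((j + ((m - j : ℤ) : ℝ) / 2) / N))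
      = (1 / N * Real.exp (-(Real.pi * s / (2 * N) * (m - j) ^ 2)) * expi (x.2 * (m - j)))
        * ((Real.exp (-(Real.pi * (1 / (2 * N * s)) * (k₂ - (0 : ℝ)) ^ 2)) : ℂ)
          * expi (θ * k₂)) := by
    have hphase : expi (-(x.1 * k₂ - x.2 * ((m - j : ℤ) : ℝ)))
        * expi (k₂ * ((j + ((m - j : ℤ) : ℝ) / 2) / N)) = expi (x.2 * (m - j)) * expi (θ * k₂) := by
      rw [← expi_add, ← expi_add, hθ]
      push_cast
      ring_nf
    rw [projCoeff, exp_neg_qform, mul_assoc, hphase, sub_zero]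
    push_cast
    ring
  simp_rw [hterm, wave_add_mul_conj_wave_add hN, ← hθ]
  rw [tsum_mul_left, tsum_mul_left, tsum_gaussian_mul_expi (by positivity), ← hconst,
    ← (Equiv.neg ℤ).tsum_eq]
  simp only [Equiv.neg_apply, zero_mul, neg_zero, expi_zero, mul_one]
  push_cast
  ring

lemma tsum_modEq_add {N : ℕ} (hN : 0 < N) (m j : ℤ) (F : ℤ → ℂ) :
    ∑' k : ℤ, (if m ≡ j + k [ZMOD N] then F k else 0) = ∑' l : ℤ, F (m + N * l - j) := by
  have hinj : Function.Injective fun l : ℤ => m + N * l - j := fun a b hab => by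
    have hmul : (N : ℤ) * a = N * b := add_left_cancel (sub_left_injective hab)
    exact mul_left_cancel₀ (mod_cast hN.ne') hmul
  rw [← hinj.tsum_eq]
  · refine tsum_congr fun l => if_pos ?_
    rw [Int.modEq_iff_dvd]
    exact ⟨l, by ring⟩
  · intro k hk
    have hmod : m ≡ j + k [ZMOD N] := of_not_not fun hk_mod => hk (if_neg hk_mod)
    obtain ⟨l, hl⟩ := hmod.dvd
    exact ⟨l, by linarith⟩

lemma tsum_tsum_add_mul {a b : ℤ → ℂ} (ha : Summable fun n => ‖a n‖)
    (hb : Summable fun n => ‖b n‖) :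
    ∑' l : ℤ, ∑' n : ℤ, a (l + n) * b n = (∑' l, a l) * ∑' n, b n := by
  let shear : ℤ × ℤ ≃ ℤ × ℤ :=
    { toFun := fun z => (z.1 + z.2, z.2), invFun := fun z => (z.1 - z.2, z.2),
      left_inv := fun z => by simp, right_inv := fun z => by simp }
  have hab : Summable fun z : ℤ × ℤ => a (z.1 + z.2) * b z.2 :=
    (shear.summable_iff (f := fun z : ℤ × ℤ => a z.1 * b z.2)).mpr
      (summable_mul_of_summable_norm ha hb)
  have htranslate (n : ℤ) : ∑' l : ℤ, a (l + n) = ∑' l, a l := (Equiv.addRight n).tsum_eq a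
  rw [← Summable.tsum_comm (f := fun l n => a (l + n) * b n) hab]
  simp_rw [tsum_mul_right, htranslate, tsum_mul_left]

lemma transSum_projCoeff {N : ℕ} (hN : 0 < N) {s : ℝ} (hs : 0 < s) (x : ℝ × ℝ) :
    transSum N (projCoeff N s x)
      = Matrix.vecMulVec (coherent N s x) (star (coherent N s x)) := by
  ext m j
  rw [transSum_apply N (summable_projCoeff hN hs x), tsum_modEq_add hN, Matrix.vecMulVec_apply,
    Pi.star_apply, RCLike.star_def]
  have hrow (l : ℤ) := tsum_projCoeff_mul_expi hN hs x ((m : ℕ) + N * l) (j : ℕ)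
  have hshift (l n : ℤ) : ((m : ℕ) : ℤ) + N * l + N * n = (m : ℕ) + N * (l + n) := by ring
  simp_rw [hshift, Int.cast_natCast] at hrow
  simp_rw [hrow]
  have hconj : Summable fun n : ℤ => ‖conj (wave N s x ((j : ℕ) + N * n))‖ := by
    simpa only [RCLike.norm_conj] using summable_wave_add_mul hN hs x ((j : ℕ) : ℤ)
  rw [tsum_mul_left, tsum_tsum_add_mul (summable_wave_add_mul hN hs x (m : ℕ)) hconj,
    coherent, coherent, map_mul, Complex.conj_ofReal, Complex.conj_tsum]
  nth_rw 1 [← Real.mul_self_sqrt (Real.sqrt_nonneg (2 * s / N))]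
  push_cast
  ring

/-! ### Coherent states in momentum representation -/

/-- The momentum representation of the wave packet centred at `x = (q, p)` with squeezing `s`, as a
function of the momentum `y`. -/
def momWave (N : ℕ) (s : ℝ) (x : ℝ × ℝ) (y : ℝ) : ℂ :=
  (Real.exp (-(Real.pi * (N / s) * (y - x.2) ^ 2)) : ℂ) * expi (-(N * x.1 * (y - x.2)))

lemma sum_tsum_add_mul {N : ℕ} (hN : 0 < N) {F : ℤ → ℂ} (hF : Summable F) :
    ∑ j : Fin N, ∑' n : ℤ, F ((j : ℕ) + N * n) = ∑' n : ℤ, F n := by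
  have : NeZero N := ⟨hN.ne'⟩
  have hdivMod (n : ℤ) (j : Fin N) : (Int.divModEquiv N).symm (n, j) = (j : ℕ) + N * n := by
    rw [add_comm, mul_comm]
    rfl
  have hF_divMod : Summable fun z : ℤ × Fin N => F ((Int.divModEquiv N).symm z) :=
    (Int.divModEquiv N).symm.summable_iff.mpr hF
  rw [← (Int.divModEquiv N).symm.tsum_eq, hF_divMod.tsum_prod]
  simp_rw [tsum_fintype, hdivMod]
  refine (Summable.tsum_finsetSum fun j _ => ?_).symm
  simpa only [Function.comp_def, hdivMod] using hF_divMod.comp_injective (Prod.mk_left_injective j)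

lemma tsum_expi_mul_wave {N : ℕ} (hN : 0 < N) {s : ℝ} (hs : 0 < s) (x : ℝ × ℝ) (l : ℤ) :
    ∑' n : ℤ, expi (-(l * n / N)) * wave N s x n
      = ((1 / Real.sqrt (s / N) : ℝ) : ℂ) * ∑' n : ℤ, momWave N s x (l / N + n) := by
  have hterm (n : ℤ) : expi (-(l * n / N)) * wave N s x n
      = (Real.exp (-(Real.pi * (s / N) * (n - N * x.1) ^ 2)) : ℂ)
        * expi ((x.2 - l / N) * n) := by
    rw [wave, mul_left_comm, ← expi_add]
    ring_nf
  have hmom (n : ℤ) : momWave N s x (l / N + n)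
      = (Real.exp (-(Real.pi / (s / N) * (n - (x.2 - l / N)) ^ 2)) : ℂ)
        * expi (-(N * x.1 * (n - (x.2 - l / N)))) := by
    rw [momWave, div_div_eq_mul_div, mul_div_assoc]
    ring_nf
  simp_rw [hterm, hmom]
  exact tsum_gaussian_mul_expi (by positivity) _ _

lemma sum_expi_mul_coherent {N : ℕ} (hN : 0 < N) {s : ℝ} (hs : 0 < s) (x : ℝ × ℝ) (l : ℤ) :
    ((1 / Real.sqrt N : ℝ) : ℂ) * ∑ j : Fin N, expi (-(l * (j : ℕ) / N)) * coherent N s x j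
      = ((Real.sqrt (Real.sqrt (2 / (N * s))) : ℝ) : ℂ) * ∑' n : ℤ, momWave N s x (l / N + n) := by
  have hconst : 1 / Real.sqrt N * Real.sqrt (Real.sqrt (2 * s / N)) * (1 / Real.sqrt (s / N))
      = Real.sqrt (Real.sqrt (2 / (N * s))) := by
    have hfactor : Real.sqrt (2 * s / N) = Real.sqrt (2 / (N * s)) * s := by
      rw [show 2 * s / N = 2 / (N * s) * s ^ 2 by field_simp, Real.sqrt_mul (by positivity),
        Real.sqrt_sq hs.le]
    rw [hfactor, Real.sqrt_mul (Real.sqrt_nonneg _), Real.sqrt_div hs.le]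
    field_simp
  have hperiodic (j : Fin N) (n : ℤ) : expi (-(l * (j : ℕ) / N)) * wave N s x ((j : ℕ) + N * n)
      = expi (-(l * (((j : ℕ) + N * n : ℤ) : ℝ) / N)) * wave N s x ((j : ℕ) + N * n) := by
    congr 1
    refine expi_eq_of_eq_add_int (l * n) ?_
    push_cast
    field_simp
    ring
  have hsummable : Summable fun n : ℤ => expi (-(l * n / N)) * wave N s x n := by
    refine Summable.of_norm ?_
    simpa only [norm_mul, norm_expi, one_mul] using summable_wave hN hs x
  simp_rw [coherent, mul_left_comm (expi _), ← Finset.mul_sum, ← tsum_mul_left (a := expi _),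
    hperiodic]
  rw [sum_tsum_add_mul hN hsummable, tsum_expi_mul_wave hN hs, ← hconst]
  simp only [Complex.ofReal_mul, mul_assoc]

/-! ### One step of the quantised baker's map on coherent states -/

/-- `x` is at distance at least `d` from the integers. -/
def FarFromInt (d x : ℝ) : Prop := ∀ k : ℤ, d ≤ |x - k|

lemma FarFromInt.of_mul_add {d x : ℝ} {m : ℕ} (hm : 0 < m) {a : ℤ}
    (h : FarFromInt d (m * x + a)) : FarFromInt (d / m) x := by
  intro k
  have hmr : (0 : ℝ) < m := mod_cast hm
  have hscaled := h (m * k + a)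
  rw [show (m * x + a - ((m * k + a : ℤ) : ℝ)) = m * (x - k) by push_cast; ring, abs_mul,
    abs_of_pos hmr] at hscaled
  rwa [div_le_iff₀' hmr]

lemma FarFromInt.le_abs_sub {d u v : ℝ} (h : FarFromInt d v) (hfloor : ⌊u⌋ ≠ ⌊v⌋) :
    d ≤ |u - v| := by
  have hv := Int.floor_le v
  have hv_lt := Int.lt_floor_add_one v
  rcases hfloor.lt_or_gt with hlt | hlt
  · have hu : u < ⌊v⌋ := Int.floor_lt.mp hlt
    have hd := h ⌊v⌋
    rw [abs_of_nonneg (by linarith)] at hd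
    rw [abs_of_neg (by linarith)]
    linarith
  · have hu : ((⌊v⌋ + 1 : ℤ) : ℝ) ≤ u := Int.le_floor.mp hlt
    have hd := h (⌊v⌋ + 1)
    push_cast at hu hd
    rw [abs_of_neg (by linarith)] at hd
    rw [abs_of_pos (by linarith)]
    linarith

/-- The half of the axis, `0` for `[0, 1/2)` and `1` for `[1/2, 1)`, that contains `j / N`. -/
def half {N : ℕ} (j : Fin N) : ℤ := ⌊2 * ((j : ℕ) : ℝ) / N⌋

lemma half_eq_ite {m : ℕ} (j : Fin (m + m)) : half j = if (j : ℕ) < m then 0 else 1 := by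
  have hpos : (0 : ℝ) < (m + m : ℕ) := mod_cast j.pos
  have hlt : ((j : ℕ) : ℝ) < (m + m : ℕ) := mod_cast j.2
  rw [half]
  split_ifs with hj
  · have hjm : ((j : ℕ) : ℝ) < m := mod_cast hj
    rw [Int.floor_eq_zero_iff]
    refine ⟨by positivity, ?_⟩
    rw [div_lt_one hpos]
    push_cast
    linarith
  · have hjm : (m : ℝ) ≤ (j : ℕ) := mod_cast not_lt.mp hj
    rw [Int.floor_eq_iff, le_div_iff₀ hpos, div_lt_iff₀ hpos]
    push_cast at hlt ⊢
    constructor <;> linarith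

lemma half_eq_zero_or_one {N : ℕ} (hN_even : Even N) (j : Fin N) : half j = 0 ∨ half j = 1 := by
  obtain ⟨m, rfl⟩ := hN_even
  rw [half_eq_ite]
  split_ifs <;> simp only [true_or, or_true]

/-- The contribution of the half `b` of the position axis to the discrete Fourier transform of `v`
at momentum `k`. -/
def halfDft {N : ℕ} (b : ℤ) (v : Fin N → ℂ) (k : ℤ) : ℂ :=
  ((1 / Real.sqrt N : ℝ) : ℂ)
    * ∑ j : Fin N, if half j = b then expi (-(k * (j : ℕ) / N)) * v j else 0

lemma halfDft_add_halfDft {N : ℕ} (hN_even : Even N) {b : ℤ} (hb : b = 0 ∨ b = 1)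
    (v : Fin N → ℂ) (k : ℤ) : halfDft b v k + halfDft (1 - b) v k
      = ((1 / Real.sqrt N : ℝ) : ℂ) * ∑ j : Fin N, expi (-(k * (j : ℕ) / N)) * v j := by
  rw [halfDft, halfDft, ← mul_add, ← Finset.sum_add_distrib]
  congr 1
  refine Finset.sum_congr rfl fun j _ => ?_
  by_cases hj : half j = b
  · rw [if_pos hj, if_neg (by lia), add_zero]
  · have := half_eq_zero_or_one hN_even j
    rw [if_neg hj, if_pos (by lia), zero_add]

lemma bakerMix_apply {N : ℕ} (hN : 0 < N) (hN_even : Even N) (l j : Fin N) :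
    bakerMix N l j = if half j = half l then
      ((Real.sqrt 2 : ℝ) : ℂ) * (((1 / Real.sqrt N : ℝ) : ℂ)
        * expi (-(((2 * (l : ℕ) : ℤ) : ℝ) * (j : ℕ) / N))) else 0 := by
  obtain ⟨m, rfl⟩ := hN_even
  have hm : 0 < m := by lia
  have hhalf : (m + m) / 2 = m := by lia
  have hconst : 1 / Real.sqrt m = Real.sqrt 2 * (1 / Real.sqrt ((m + m : ℕ) : ℝ)) := by
    rw [Nat.cast_add, ← two_mul, Real.sqrt_mul zero_le_two]
    field_simp
  simp only [bakerMix, Matrix.of_apply, hhalf, dftEntry_eq, hconst, half_eq_ite, Complex.ofReal_mul]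
  by_cases hl : (l : ℕ) < m <;> by_cases hj : (j : ℕ) < m
  · simp only [hl, hj, and_self, if_true, mul_assoc]
    congr 3
    push_cast
    field_simp
    ring_nf
  · simp [hl, hj, not_le.mpr hl]
  · simp [hl, hj, not_le.mpr hj]
  · simp only [hl, hj, not_lt.mp hl, not_lt.mp hj, and_self, if_true, if_false, mul_assoc]
    congr 2
    refine expi_eq_of_eq_add_int (l + j - m) ?_
    rw [Nat.cast_sub (not_lt.mp hl), Nat.cast_sub (not_lt.mp hj)]
    push_cast
    field_simp
    ring

lemma bakerMix_mulVec_apply {N : ℕ} (hN : 0 < N) (hN_even : Even N) (v : Fin N → ℂ) (l : Fin N) :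
    (bakerMix N).mulVec v l
      = ((Real.sqrt 2 : ℝ) : ℂ) * halfDft (half l) v (2 * (l : ℕ)) := by
  rw [Matrix.mulVec, dotProduct, halfDft, Finset.mul_sum, Finset.mul_sum]
  refine Finset.sum_congr rfl fun j _ => ?_
  rw [bakerMix_apply hN hN_even]
  split_ifs <;> ring

lemma sqrt_sqrt_le {t : ℝ} (ht : t ≤ 2) : Real.sqrt (Real.sqrt t) ≤ 3 / 2 := by
  rw [Real.sqrt_le_left (by norm_num), Real.sqrt_le_left (by norm_num)]
  linarith

section SqueezingRange

variable {N : ℕ} (hN : 0 < N) {s : ℝ} (hs : 0 < s) (hsN : s ≤ N) (hNs : 1 ≤ N * s) {x : ℝ × ℝ}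

include hN hs hsN hNs

lemma norm_coherent_le (j : Fin N) : ‖coherent N s x j‖ ≤ 45 := by
  have hconst : Real.sqrt (Real.sqrt (2 * s / N)) ≤ 3 / 2 :=
    sqrt_sqrt_le ((div_le_iff₀ (mod_cast hN)).mpr (by linarith))
  have htsum : ‖∑' n : ℤ, wave N s x ((j : ℕ) + N * n)‖ ≤ 30 := by
    refine (norm_tsum_le_tsum_norm (summable_wave_add_mul hN hs x _)).trans ?_
    simp_rw [norm_wave_add_mul hN]
    exact tsum_gaussian_le (by nlinarith [Real.pi_gt_three]) _
  rw [coherent, norm_mul, Complex.norm_real, Real.norm_of_nonneg (Real.sqrt_nonneg _)]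
  calc _ ≤ 3 / 2 * (30 : ℝ) := by gcongr
    _ = 45 := by norm_num

lemma norm_coherent_tail_le {j : Fin N} {d : ℝ} (hd : 0 ≤ d)
    (hdist : ∀ n : ℤ, d ≤ |(n : ℝ) + ((j : ℕ) / N - x.1)|) :
    ‖coherent N s x j‖ ≤ 45 * Real.exp (-(Real.pi / 2 * (N * s) * d ^ 2)) := by
  have hconst : Real.sqrt (Real.sqrt (2 * s / N)) ≤ 3 / 2 :=
    sqrt_sqrt_le ((div_le_iff₀ (mod_cast hN)).mpr (by linarith))
  have htsum : ‖∑' n : ℤ, wave N s x ((j : ℕ) + N * n)‖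
      ≤ 30 * Real.exp (-(Real.pi / 2 * (N * s) * d ^ 2)) := by
    refine (norm_tsum_le_tsum_norm (summable_wave_add_mul hN hs x _)).trans ?_
    simp_rw [norm_wave_add_mul hN, Int.cast_natCast]
    refine (tsum_gaussian_tail_le (by nlinarith [Real.pi_gt_three]) hd hdist).trans_eq ?_
    ring_nf
  rw [coherent, norm_mul, Complex.norm_real, Real.norm_of_nonneg (Real.sqrt_nonneg _)]
  calc _ ≤ 3 / 2 * (30 * Real.exp (-(Real.pi / 2 * (N * s) * d ^ 2))) := by gcongr
    _ = 45 * Real.exp (-(Real.pi / 2 * (N * s) * d ^ 2)) := by ring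

lemma norm_halfDft_coherent_le {d : ℝ} (hd : 0 ≤ d) (hfar : FarFromInt d (2 * x.1)) {b : ℤ}
    (hb : Odd (b - ⌊2 * x.1⌋)) (k : ℤ) :
    ‖halfDft b (coherent N s x) k‖
      ≤ 45 * Real.sqrt N * Real.exp (-(Real.pi / 8 * (N * s) * d ^ 2)) := by
  have hdist (j : Fin N) (hj : half j = b) (n : ℤ) :
      d / 2 ≤ |(n : ℝ) + ((j : ℕ) / N - x.1)| := by
    have hfloor : ⌊2 * ((j : ℕ) : ℝ) / N + (2 * n : ℤ)⌋ ≠ ⌊2 * x.1⌋ := by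
      obtain ⟨m, hm⟩ := hb
      rw [Int.floor_add_intCast, ← half, hj]
      lia
    have hle := hfar.le_abs_sub hfloor
    rw [show 2 * ((j : ℕ) : ℝ) / N + (2 * n : ℤ) - 2 * x.1
      = 2 * (n + ((j : ℕ) / N - x.1)) by push_cast; ring, abs_mul, abs_two] at hle
    linarith
  have hterm (j : Fin N) :
      ‖if half j = b then expi (-(k * (j : ℕ) / N)) * coherent N s x j else 0‖
        ≤ 45 * Real.exp (-(Real.pi / 8 * (N * s) * d ^ 2)) := by
    split_ifs with hj
    · rw [norm_mul, norm_expi, one_mul]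
      refine (norm_coherent_tail_le hN hs hsN hNs (by positivity) (hdist j hj)).trans_eq ?_
      ring_nf
    · rw [norm_zero]
      positivity
  rw [halfDft, norm_mul, Complex.norm_real, Real.norm_of_nonneg (by positivity)]
  calc 1 / Real.sqrt N * _
      ≤ 1 / Real.sqrt N * (N * (45 * Real.exp (-(Real.pi / 8 * (N * s) * d ^ 2)))) := by
        gcongr
        simpa using norm_sum_le_of_le Finset.univ fun j _ => hterm j
    _ = N / Real.sqrt N * (45 * Real.exp (-(Real.pi / 8 * (N * s) * d ^ 2))) := by ring
    _ = 45 * Real.sqrt N * Real.exp (-(Real.pi / 8 * (N * s) * d ^ 2)) := by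
        rw [Real.div_sqrt]
        ring

end SqueezingRange

lemma norm_momWave (N : ℕ) (s : ℝ) (x : ℝ × ℝ) (y : ℝ) :
    ‖momWave N s x y‖ = Real.exp (-(Real.pi * (N / s) * (y - x.2) ^ 2)) := by
  rw [momWave, norm_mul, norm_expi, mul_one, Complex.norm_real,
    Real.norm_of_nonneg (Real.exp_pos _).le]

lemma summable_momWave {N : ℕ} (hN : 0 < N) {s : ℝ} (hs : 0 < s) (x : ℝ × ℝ) (y : ℝ) :
    Summable fun n : ℤ => ‖momWave N s x (y + n)‖ := by
  simp_rw [norm_momWave, add_comm y, add_sub_assoc]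
  exact summable_gaussian (by positivity) _

lemma tsum_even_add_tsum_odd {f : ℤ → ℂ} (hf : Summable f) :
    (∑' n : ℤ, f (2 * n)) + ∑' n : ℤ, f (2 * n + 1) = ∑' n, f n := by
  have heven : Function.Injective fun n : ℤ => 2 * n := fun m n h => by simpa using h
  have hodd : Function.Injective fun n : ℤ => 2 * n + 1 := fun m n h => by simpa using h
  have hrange_even : (Set.range fun n : ℤ => 2 * n) = {n | Even n} := by
    ext n
    simp only [Set.mem_range, Set.mem_ofPred_eq, even_iff_exists_two_mul, eq_comm]
  have hrange_odd : (Set.range fun n : ℤ => 2 * n + 1) = {n | Odd n} := by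
    ext n
    simp only [Set.mem_range, Set.mem_ofPred_eq, Odd, eq_comm]
  refine (HasSum.tsum_eq ?_).symm
  refine (heven.hasSum_range_iff.mpr (hf.comp_injective heven).hasSum).add_isCompl ?_
    (hodd.hasSum_range_iff.mpr (hf.comp_injective hodd).hasSum)
  rw [hrange_even, hrange_odd]
  exact Int.isCompl_even_odd

lemma tsum_momWave_parity {N : ℕ} (hN : 0 < N) {s : ℝ} (hs : 0 < s) (x : ℝ × ℝ) (y : ℝ) (b : ℤ) :
    ∑' n : ℤ, momWave N s x (y + n) = (∑' n : ℤ, momWave N s x (y - b + 2 * n))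
      + ∑' n : ℤ, momWave N s x (y - b + 1 + 2 * n) := by
  have hsplit := tsum_even_add_tsum_odd (summable_momWave hN hs x (y - b)).of_norm
  rw [← (Equiv.addRight b).tsum_eq fun n : ℤ => momWave N s x (y - b + n)] at hsplit
  push_cast [Equiv.coe_addRight] at hsplit
  convert hsplit.symm using 4 <;> ring_nf

lemma norm_tsum_momWave_le {N : ℕ} (hN : 0 < N) {s : ℝ} (hs : 0 < s) (hsN : s ≤ N)
    {x : ℝ × ℝ} {d : ℝ} (hd : 0 ≤ d) (hfar : FarFromInt d x.2) {y : ℝ} (hy : Odd (⌊y⌋ - ⌊x.2⌋)) :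
    ‖∑' n : ℤ, momWave N s x (y + 2 * n)‖ ≤ 30 * Real.exp (-(Real.pi / 2 * (N / s) * d ^ 2)) := by
  have hratio : 1 ≤ N / s := (one_le_div hs).mpr hsN
  have hnorm (n : ℤ) : ‖momWave N s x (y + 2 * n)‖
      = Real.exp (-(4 * Real.pi * (N / s) * (n + (y - x.2) / 2) ^ 2)) := by
    rw [norm_momWave]
    ring_nf
  have hdist (n : ℤ) : d / 2 ≤ |(n : ℝ) + (y - x.2) / 2| := by
    have hfloor : ⌊y + (2 * n : ℤ)⌋ ≠ ⌊x.2⌋ := by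
      obtain ⟨m, hm⟩ := hy
      rw [Int.floor_add_intCast]
      lia
    have hle := hfar.le_abs_sub hfloor
    rw [show y + (2 * n : ℤ) - x.2 = 2 * (n + (y - x.2) / 2) by push_cast; ring, abs_mul,
      abs_two] at hle
    linarith
  have hsummable := summable_gaussian (β := 4 * Real.pi * (N / s)) (by positivity) ((y - x.2) / 2)
  refine (norm_tsum_le_tsum_norm (by simpa only [hnorm] using hsummable)).trans ?_
  simp_rw [hnorm]
  refine (tsum_gaussian_tail_le (by nlinarith [Real.pi_gt_three]) (by positivity) hdist).trans_eq ?_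
  ring_nf

/-- This is the classical baker's map in momentum representation. -/
lemma momWave_div_four {N : ℕ} (hN : 0 < N) {s : ℝ} (hs : 0 < s) (q p : ℝ) (b l n : ℤ) :
    momWave N (s / 4) (2 * q - b, (p + b) / 2) (l / N + n)
      = expi (-(N * b * (p + b) / 2)) * momWave N s (q, p) (2 * l / N - b + 2 * n) := by
  rw [momWave, momWave, mul_left_comm, ← expi_add]
  congr 1
  · congr 2
    field_simp
    ring
  · refine expi_eq_of_eq_add_int (b * l + N * b * n) ?_
    push_cast
    field_simp
    ring

lemma expi_mul_dft_mulVec_coherent {N : ℕ} (hN : 0 < N) {s : ℝ} (hs : 0 < s) (q p : ℝ) (b : ℤ)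
    (l : Fin N) :
    expi (N * b * (p + b) / 2)
        * (dft N).mulVec (coherent N (s / 4) (2 * q - b, (p + b) / 2)) l
      = ((Real.sqrt 2 * Real.sqrt (Real.sqrt (2 / (N * s))) : ℝ) : ℂ)
        * ∑' n : ℤ, momWave N s (q, p) (2 * (l : ℕ) / N - b + 2 * n) := by
  have hconst : Real.sqrt (Real.sqrt (2 / (N * (s / 4))))
      = Real.sqrt 2 * Real.sqrt (Real.sqrt (2 / (N * s))) := by
    rw [show 2 / ((N : ℝ) * (s / 4)) = 2 ^ 2 * (2 / (N * s)) by field_simp; ring,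
      Real.sqrt_mul (by norm_num), Real.sqrt_sq zero_le_two, Real.sqrt_mul zero_le_two]
  have hdft : (dft N).mulVec (coherent N (s / 4) (2 * q - b, (p + b) / 2)) l
      = ((1 / Real.sqrt N : ℝ) : ℂ) * ∑ j : Fin N, expi (-(((l : ℕ) : ℤ) * (j : ℕ) / N))
        * coherent N (s / 4) (2 * q - b, (p + b) / 2) j := by
    rw [Matrix.mulVec, dotProduct, Finset.mul_sum]
    refine Finset.sum_congr rfl fun j _ => ?_
    rw [dft_apply, mul_assoc, Int.cast_natCast]
  rw [hdft, sum_expi_mul_coherent hN (by positivity), hconst]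
  simp_rw [momWave_div_four hN hs, tsum_mul_left, Int.cast_natCast]
  rw [mul_left_comm, ← mul_assoc (expi _), ← expi_add, add_neg_cancel, expi_zero, one_mul]

/-- A point of the square as a point of the plane. -/
def toPlane (y : Square) : ℝ × ℝ := (y.1, y.2)

lemma floor_two_mul_eq_zero_or_one (y : Square) : ⌊2 * (y.1 : ℝ)⌋ = 0 ∨ ⌊2 * (y.1 : ℝ)⌋ = 1 := by
  have hnonneg : 0 ≤ ⌊2 * (y.1 : ℝ)⌋ := Int.floor_nonneg.mpr (by linarith [y.1.2.1])
  have hlt : ⌊2 * (y.1 : ℝ)⌋ < 2 := Int.floor_lt.mpr (by push_cast; linarith [y.1.2.2])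
  lia

lemma toPlane_baker (y : Square) : toPlane (baker y)
    = (2 * (y.1 : ℝ) - ⌊2 * (y.1 : ℝ)⌋, ((y.2 : ℝ) + ⌊2 * (y.1 : ℝ)⌋) / 2) := by
  have hy_nonneg := y.1.2.1
  have hy_lt := y.1.2.2
  have hbaker : baker y = bakerFun y := rfl
  rw [hbaker, bakerFun]
  split_ifs with hy
  · have hfloor : ⌊2 * (y.1 : ℝ)⌋ = 0 := Int.floor_eq_zero_iff.mpr ⟨by linarith, by linarith⟩
    simp [toPlane, hfloor]
  · have hfloor : ⌊2 * (y.1 : ℝ)⌋ = 1 :=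
      Int.floor_eq_iff.mpr ⟨by push_cast; linarith, by push_cast; linarith⟩
    simp [toPlane, hfloor]

/-- The phase acquired by a coherent state centred at `y` under the quantised baker's map. -/
def bakerPhase (N : ℕ) (y : Square) : ℂ :=
  expi (N * ⌊2 * (y.1 : ℝ)⌋ * (y.2 + ⌊2 * (y.1 : ℝ)⌋) / 2)

/-- The transform of the wrong half of the coherent state and the wave packets of the wrong parity
are both far from the centre, so they are exponentially small. -/
lemma exists_norm_bakerMix_mulVec_coherent_sub_eq {N : ℕ} (hN : 0 < N) (hN_even : Even N) {s : ℝ}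
    (hs : 0 < s) (y : Square) (l : Fin N) : ∃ t : ℝ, Odd ⌊t⌋ ∧
      ‖(bakerMix N).mulVec (coherent N s (toPlane y)) l
        - bakerPhase N y * (dft N).mulVec (coherent N (s / 4) (toPlane (baker y))) l‖
      = Real.sqrt 2 * ‖halfDft (1 - ⌊2 * (y.1 : ℝ)⌋) (coherent N s (toPlane y)) (2 * (l : ℕ))
        - (Real.sqrt (Real.sqrt (2 / (N * s))) : ℝ)
          * ∑' n : ℤ, momWave N s (toPlane y) (t + 2 * n)‖ := by
  rw [toPlane_baker, bakerPhase, expi_mul_dft_mulVec_coherent hN hs,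
    bakerMix_mulVec_apply hN hN_even]
  have hb := floor_two_mul_eq_zero_or_one y
  set b : ℤ := ⌊2 * (y.1 : ℝ)⌋
  have hfactor (z : ℂ) : Real.sqrt 2 * ‖z‖ = ‖(Real.sqrt 2 : ℂ) * z‖ := by
    rw [norm_mul, Complex.norm_real, Real.norm_of_nonneg (Real.sqrt_nonneg _)]
  have hl : ⌊2 * ((l : ℕ) : ℝ) / N - b⌋ = half l - b := Int.floor_sub_intCast _ _
  have hhalf := half_eq_zero_or_one hN_even l
  simp_rw [hfactor]
  rcases eq_or_ne (half l) b with hlb | hlb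
  · have hsplit := halfDft_add_halfDft hN_even hb (coherent N s (toPlane y)) (2 * (l : ℕ))
    rw [sum_expi_mul_coherent hN hs, tsum_momWave_parity hN hs _ _ b] at hsplit
    push_cast at hsplit
    refine ⟨2 * (l : ℕ) / N - b + 1, ?_, ?_⟩
    · rw [Int.floor_add_one, hl, hlb, sub_self, zero_add]
      exact odd_one
    · rw [hlb, ← norm_neg, eq_sub_of_add_eq hsplit]
      congr 1
      push_cast [toPlane]
      ring
  · refine ⟨2 * (l : ℕ) / N - b, ?_, ?_⟩
    · rw [hl, show half l = 1 - b by lia]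
      exact ⟨-b, by ring⟩
    · rw [show half l = 1 - b by lia]
      congr 1
      push_cast [toPlane]
      ring

lemma norm_bakerMix_mulVec_coherent_sub_le {N : ℕ} (hN : 0 < N) (hN_even : Even N) {s : ℝ}
    (hs : 0 < s) (hsN : s ≤ N) (hNs : 1 ≤ N * s) {y : Square} {d₁ d₂ Λ : ℝ} (hd₁ : 0 ≤ d₁)
    (hd₂ : 0 ≤ d₂) (hq : FarFromInt d₁ (2 * y.1)) (hp : FarFromInt d₂ y.2)
    (hΛ₁ : Λ ≤ Real.pi / 8 * (N * s) * d₁ ^ 2) (hΛ₂ : Λ ≤ Real.pi / 2 * (N / s) * d₂ ^ 2)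
    (l : Fin N) :
    ‖(bakerMix N).mulVec (coherent N s (toPlane y)) l
      - bakerPhase N y * (dft N).mulVec (coherent N (s / 4) (toPlane (baker y))) l‖
      ≤ 160 * Real.sqrt N * Real.exp (-Λ) := by
  obtain ⟨t, ht, hdiff⟩ := exists_norm_bakerMix_mulVec_coherent_sub_eq hN hN_even hs y l
  have hp_floor : ⌊(y.2 : ℝ)⌋ = 0 := Int.floor_eq_zero_iff.mpr y.2.2
  have hwrongHalf : ‖halfDft (1 - ⌊2 * (y.1 : ℝ)⌋) (coherent N s (toPlane y)) (2 * (l : ℕ))‖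
      ≤ 45 * Real.sqrt N * Real.exp (-Λ) := by
    refine (norm_halfDft_coherent_le hN hs hsN hNs hd₁ hq
      (show Odd (1 - ⌊2 * (y.1 : ℝ)⌋ - ⌊2 * (y.1 : ℝ)⌋) from ⟨-⌊2 * (y.1 : ℝ)⌋, by ring⟩)
      _).trans ?_
    gcongr
  have hwrongParity :
      ‖∑' n : ℤ, momWave N s (toPlane y) (t + 2 * n)‖ ≤ 30 * Real.exp (-Λ) := by
    refine (norm_tsum_momWave_le hN hs hsN hd₂ hp
      (show Odd (⌊t⌋ - ⌊(y.2 : ℝ)⌋) by rwa [hp_floor, sub_zero])).trans ?_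
    gcongr
  have hconst : Real.sqrt (Real.sqrt (2 / (N * s))) ≤ 3 / 2 :=
    sqrt_sqrt_le ((div_le_iff₀ (by positivity)).mpr (by linarith))
  have hsqrtN : 1 ≤ Real.sqrt N := Real.one_le_sqrt.mpr (mod_cast hN)
  have hsqrt2 : Real.sqrt 2 ≤ 3 / 2 := by rw [Real.sqrt_le_left] <;> norm_num
  rw [hdiff]
  calc _ ≤ 3 / 2 * (45 * Real.sqrt N * Real.exp (-Λ)
          + 3 / 2 * (30 * (Real.sqrt N * Real.exp (-Λ)))) := by
        refine mul_le_mul hsqrt2 ((norm_sub_le _ _).trans ?_) (norm_nonneg _) (by norm_num)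
        rw [norm_mul, Complex.norm_real, Real.norm_of_nonneg (Real.sqrt_nonneg _)]
        gcongr
        exact hwrongParity.trans (by gcongr; exact le_mul_of_one_le_left (Real.exp_pos _).le hsqrtN)
    _ ≤ 160 * Real.sqrt N * Real.exp (-Λ) := by nlinarith [Real.sqrt_nonneg N, Real.exp_pos (-Λ)]

/-! ### Iterating the quantised baker's map on coherent states -/

lemma norm_mul_of_mem_unitary {N k : ℕ} {U : Matrix (Fin N) (Fin N) ℂ}
    (hU : U ∈ unitary (Matrix (Fin N) (Fin N) ℂ)) (V : Matrix (Fin N) (Fin k) ℂ) :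
    ‖U * V‖ = ‖V‖ := by
  have hgram : (U * V).conjTranspose * (U * V) = V.conjTranspose * V := by
    rw [Matrix.conjTranspose_mul, Matrix.mul_assoc, ← Matrix.mul_assoc _ U,
      ← Matrix.star_eq_conjTranspose U, Unitary.star_mul_self_of_mem hU, Matrix.one_mul]
  refine (mul_self_inj (norm_nonneg _) (norm_nonneg _)).mp ?_
  rw [← Matrix.l2_opNorm_conjTranspose_mul_self, hgram, Matrix.l2_opNorm_conjTranspose_mul_self]

lemma norm_replicateCol_le {N : ℕ} {v : Fin N → ℂ} {b : ℝ} (hb : 0 ≤ b) (hv : ∀ j, ‖v j‖ ≤ b) :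
    ‖Matrix.replicateCol (Fin 1) v‖ ≤ Real.sqrt N * b := by
  set V := Matrix.replicateCol (Fin 1) v
  have hgram : V.conjTranspose * V = Matrix.diagonal fun _ => ((∑ j, ‖v j‖ ^ 2 : ℝ) : ℂ) := by
    ext i k
    rw [Subsingleton.elim i 0, Subsingleton.elim k 0, Matrix.mul_apply, Matrix.diagonal_apply_eq]
    push_cast
    refine Finset.sum_congr rfl fun j _ => ?_
    exact Complex.conj_mul' (v j)
  refine le_of_sq_le_sq ?_ (by positivity)
  rw [pow_two, ← Matrix.l2_opNorm_conjTranspose_mul_self, hgram, Matrix.l2_opNorm_diagonal,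
    pi_norm_le_iff_of_nonneg (by positivity)]
  intro _
  rw [Complex.norm_real, Real.norm_of_nonneg (by positivity), mul_pow,
    Real.sq_sqrt (Nat.cast_nonneg _)]
  refine (Finset.sum_le_sum fun j _ => pow_le_pow_left₀ (norm_nonneg _) (hv j) 2).trans_eq ?_
  simp

lemma norm_mul_conjTranspose_sub_le {N k : ℕ} {U W : Matrix (Fin N) (Fin k) ℂ} {b ε : ℝ}
    (hU : ‖U‖ ≤ b) (hW : ‖W‖ ≤ b) (hε : ‖U - W‖ ≤ ε) :
    ‖U * U.conjTranspose - W * W.conjTranspose‖ ≤ 2 * b * ε := by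
  have hb : 0 ≤ b := (norm_nonneg U).trans hU
  have hsplit : U * U.conjTranspose - W * W.conjTranspose
      = (U - W) * U.conjTranspose + W * (U - W).conjTranspose := by
    rw [Matrix.conjTranspose_sub, Matrix.sub_mul, Matrix.mul_sub]
    abel
  rw [hsplit]
  calc _ ≤ ‖U - W‖ * ‖U.conjTranspose‖ + ‖W‖ * ‖(U - W).conjTranspose‖ :=
        (norm_add_le _ _).trans
          (add_le_add (Matrix.l2_opNorm_mul _ _) (Matrix.l2_opNorm_mul _ _))
    _ ≤ ε * b + b * ε := by
        rw [Matrix.l2_opNorm_conjTranspose, Matrix.l2_opNorm_conjTranspose]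
        have hε_nonneg : 0 ≤ ε := (norm_nonneg _).trans hε
        gcongr
    _ = 2 * b * ε := by ring

/-- The coherent state as a column matrix, so that its projector is a matrix product. -/
def coherentCol (N : ℕ) (s : ℝ) (x : ℝ × ℝ) : Matrix (Fin N) (Fin 1) ℂ :=
  Matrix.replicateCol (Fin 1) (coherent N s x)

lemma norm_coherentCol_le {N : ℕ} (hN : 0 < N) {s : ℝ} (hs : 0 < s) (hsN : s ≤ N)
    (hNs : 1 ≤ N * s) (x : ℝ × ℝ) : ‖coherentCol N s x‖ ≤ Real.sqrt N * 45 :=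
  norm_replicateCol_le (by norm_num) (norm_coherent_le hN hs hsN hNs)

lemma transSum_projCoeff_eq_coherentCol {N : ℕ} (hN : 0 < N) {s : ℝ} (hs : 0 < s) (x : ℝ × ℝ) :
    transSum N (projCoeff N s x) = coherentCol N s x * (coherentCol N s x).conjTranspose := by
  rw [transSum_projCoeff hN hs, coherentCol, Matrix.vecMulVec_eq (Fin 1),
    Matrix.conjTranspose_replicateCol]
  rfl

lemma norm_quantumBaker_mul_coherentCol_sub_le {N : ℕ} (hN : 0 < N) (hN_even : Even N) {s : ℝ}
    (hs : 0 < s) (hsN : s ≤ N) (hNs : 1 ≤ N * s) {y : Square} {d₁ d₂ Λ : ℝ} (hd₁ : 0 ≤ d₁)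
    (hd₂ : 0 ≤ d₂) (hq : FarFromInt d₁ (2 * y.1)) (hp : FarFromInt d₂ y.2)
    (hΛ₁ : Λ ≤ Real.pi / 8 * (N * s) * d₁ ^ 2) (hΛ₂ : Λ ≤ Real.pi / 2 * (N / s) * d₂ ^ 2) :
    ‖quantumBaker N * coherentCol N s (toPlane y)
      - bakerPhase N y • coherentCol N (s / 4) (toPlane (baker y))‖
      ≤ 160 * N * Real.exp (-Λ) := by
  have hcol : dft N * (quantumBaker N * coherentCol N s (toPlane y)
      - bakerPhase N y • coherentCol N (s / 4) (toPlane (baker y)))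
      = Matrix.replicateCol (Fin 1) fun l => (bakerMix N).mulVec (coherent N s (toPlane y)) l
        - bakerPhase N y * (dft N).mulVec (coherent N (s / 4) (toPlane (baker y))) l := by
    rw [Matrix.mul_sub, ← Matrix.mul_assoc, dft_mul_quantumBaker hN, Matrix.mul_smul, coherentCol,
      coherentCol, ← Matrix.replicateCol_mulVec, ← Matrix.replicateCol_mulVec]
    rfl
  rw [← norm_mul_of_mem_unitary (dft_mem_unitary hN), hcol]
  refine (norm_replicateCol_le (by positivity) fun l => norm_bakerMix_mulVec_coherent_sub_le hN
    hN_even hs hsN hNs hd₁ hd₂ hq hp hΛ₁ hΛ₂ l).trans_eq ?_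
  linear_combination (160 * Real.exp (-Λ)) * Real.mul_self_sqrt (Nat.cast_nonneg (α := ℝ) N)

lemma floor_two_pow_mul_ediv (n : ℕ) (t : ℝ) : ⌊2 ^ n * t⌋ / 2 ^ n = ⌊t⌋ := by
  have hdiv := Int.floor_div_natCast (2 ^ n * t) (2 ^ n)
  push_cast at hdiv
  rw [← hdiv, mul_div_cancel_left₀ t (by positivity)]

lemma exists_toPlane_baker_pow (m : ℕ) (a : ℤ) : ∃ r : ℤ, ∀ x : Square,
    ⌊2 ^ m * (x.1 : ℝ)⌋ = a →
      toPlane ((baker ^ m) x) = (2 ^ m * (x.1 : ℝ) - a, ((x.2 : ℝ) + r) / 2 ^ m) := by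
  induction m generalizing a with
  | zero =>
    refine ⟨0, fun x hx => ?_⟩
    have ha : a = 0 := by
      rw [← hx, pow_zero, one_mul]
      exact Int.floor_eq_zero_iff.mpr x.1.2
    simp [toPlane, ha]
  | succ m ih =>
    obtain ⟨r, hr⟩ := ih (a / 2)
    refine ⟨r + 2 ^ m * (a - 2 * (a / 2)), fun x hx => ?_⟩
    have hdouble : 2 ^ (m + 1) * (x.1 : ℝ) = 2 ^ 1 * (2 ^ m * x.1) := by ring
    have hparent : ⌊2 ^ m * (x.1 : ℝ)⌋ = a / 2 := by
      rw [← hx, hdouble, ← floor_two_pow_mul_ediv 1, pow_one, pow_one]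
    have hq : (((baker ^ m) x).1 : ℝ) = 2 ^ m * x.1 - (a / 2 : ℤ) :=
      congrArg Prod.fst (hr x hparent)
    have hp : (((baker ^ m) x).2 : ℝ) = (x.2 + r) / 2 ^ m := congrArg Prod.snd (hr x hparent)
    have hdigit : ⌊2 * (((baker ^ m) x).1 : ℝ)⌋ = a - 2 * (a / 2) := by
      have htwice : 2 * (((baker ^ m) x).1 : ℝ)
          = 2 ^ (m + 1) * x.1 - (2 * (a / 2) : ℤ) := by
        rw [hq]
        push_cast
        ring
      rw [htwice, Int.floor_sub_intCast, hx]
    rw [pow_succ', Equiv.Perm.mul_apply, toPlane_baker, hdigit, hq, hp]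
    refine Prod.ext ?_ ?_
    · push_cast
      ring
    · push_cast
      field_simp
      ring

/-- `x` is at distance at least `δ`, on the scale of the cutoff `χ_{δ,n}`, from the
discontinuities of the first `n` iterates of the baker's map. -/
def IsGood (n : ℕ) (δ : ℝ) (x : ℝ × ℝ) : Prop := FarFromInt δ (2 ^ n * x.1) ∧ FarFromInt δ x.2

lemma IsGood.farFromInt_baker_pow_fst {m t : ℕ} {δ : ℝ} {x : Square}
    (hx : IsGood (m + 1 + t) δ (toPlane x)) :
    FarFromInt (δ / 2 ^ t) (2 * (((baker ^ m) x).1 : ℝ)) := by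
  obtain ⟨r, hr⟩ := exists_toPlane_baker_pow m ⌊2 ^ m * (x.1 : ℝ)⌋
  have hq : (((baker ^ m) x).1 : ℝ) = 2 ^ m * x.1 - ⌊2 ^ m * (x.1 : ℝ)⌋ :=
    congrArg Prod.fst (hr x rfl)
  have hscaled : FarFromInt δ ((2 ^ t : ℕ) * (2 * (((baker ^ m) x).1 : ℝ))
      + (2 * 2 ^ t * ⌊2 ^ m * (x.1 : ℝ)⌋ : ℤ)) := by
    convert hx.1 using 1
    rw [hq, toPlane]
    push_cast
    ring
  simpa using hscaled.of_mul_add (by positivity)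

lemma IsGood.farFromInt_baker_pow_snd {n : ℕ} {δ : ℝ} {x : Square}
    (hx : IsGood n δ (toPlane x)) (m : ℕ) :
    FarFromInt (δ / 2 ^ m) (((baker ^ m) x).2 : ℝ) := by
  obtain ⟨r, hr⟩ := exists_toPlane_baker_pow m ⌊2 ^ m * (x.1 : ℝ)⌋
  have hp : (((baker ^ m) x).2 : ℝ) = (x.2 + r) / 2 ^ m := congrArg Prod.snd (hr x rfl)
  have hscaled : FarFromInt δ ((2 ^ m : ℕ) * (((baker ^ m) x).2 : ℝ) + (-r : ℤ)) := by
    convert hx.2 using 1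
    rw [hp, toPlane]
    push_cast
    field_simp
    ring
  simpa using hscaled.of_mul_add (by positivity)

lemma IsGood.norm_quantumBaker_mul_coherentCol_sub_le {N : ℕ} (hN : 0 < N) (hN_even : Even N)
    {m t : ℕ} (hn : (2 : ℝ) ^ (m + 1 + t) ≤ N) {δ : ℝ} (hδ : 0 < δ) {x : Square}
    (hx : IsGood (m + 1 + t) δ (toPlane x)) :
    ‖quantumBaker N * coherentCol N (2 ^ (m + 1 + t) / 4 ^ m) (toPlane ((baker ^ m) x))
      - bakerPhase N ((baker ^ m) x) • coherentCol N (2 ^ (m + 1 + t) / 4 ^ (m + 1))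
        (toPlane ((baker ^ (m + 1)) x))‖
      ≤ 160 * N * Real.exp (-(Real.pi / 2 * (N * δ ^ 2 / 2 ^ (m + 1 + t)))) := by
  have hm : (1 : ℝ) ≤ 2 ^ m := one_le_pow₀ one_le_two
  have ht : (1 : ℝ) ≤ 2 ^ t := one_le_pow₀ one_le_two
  have hfour : (4 : ℝ) ^ m = 2 ^ m * 2 ^ m := by
    rw [← mul_pow]
    norm_num
  have hsqueezing : (2 : ℝ) ^ (m + 1 + t) / 4 ^ m = 2 * 2 ^ t / 2 ^ m := by
    rw [hfour, pow_add, pow_succ]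
    field_simp
  have hN_ge : 2 * 2 ^ m * 2 ^ t ≤ (N : ℝ) := by
    rw [pow_add, pow_succ] at hn
    linarith
  have hNr : (0 : ℝ) < N := mod_cast hN
  rw [pow_succ (4 : ℝ), ← div_div, hsqueezing, pow_succ' baker, Equiv.Perm.mul_apply]
  refine QBaker.norm_quantumBaker_mul_coherentCol_sub_le hN hN_even (by positivity) ?_ ?_
    (by positivity) (by positivity) hx.farFromInt_baker_pow_fst (hx.farFromInt_baker_pow_snd m)
    (le_of_eq ?_) (le_of_eq ?_)
  · rw [div_le_iff₀ (by positivity)]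
    nlinarith
  · rw [mul_div_assoc', le_div_iff₀ (by positivity)]
    nlinarith
  all_goals
    rw [pow_add, pow_succ]
    field_simp
    ring

lemma IsGood.exists_norm_quantumBaker_pow_mul_coherentCol_sub_le {N : ℕ} (hN : 0 < N)
    (hN_even : Even N) {n : ℕ} (hn : (2 : ℝ) ^ n ≤ N) {δ : ℝ} (hδ : 0 < δ) {x : Square}
    (hx : IsGood n δ (toPlane x)) {m : ℕ} (hm : m ≤ n) :
    ∃ θ : ℂ, ‖θ‖ = 1 ∧ ‖quantumBaker N ^ m * coherentCol N (2 ^ n) (toPlane x)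
        - θ • coherentCol N (2 ^ n / 4 ^ m) (toPlane ((baker ^ m) x))‖
      ≤ m * (160 * N * Real.exp (-(Real.pi / 2 * (N * δ ^ 2 / 2 ^ n)))) := by
  induction m with
  | zero => exact ⟨1, norm_one, by simp⟩
  | succ m ih =>
    obtain ⟨θ, hθ, hle⟩ := ih (by lia)
    obtain ⟨t, rfl⟩ : ∃ t, n = m + 1 + t := ⟨n - (m + 1), by lia⟩
    set E := 160 * N * Real.exp (-(Real.pi / 2 * (N * δ ^ 2 / 2 ^ (m + 1 + t))))
    set φ := bakerPhase N ((baker ^ m) x) with hφ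
    set V := coherentCol N (2 ^ (m + 1 + t)) (toPlane x)
    set V' := coherentCol N (2 ^ (m + 1 + t) / 4 ^ m) (toPlane ((baker ^ m) x))
    set V'' := coherentCol N (2 ^ (m + 1 + t) / 4 ^ (m + 1)) (toPlane ((baker ^ (m + 1)) x))
    have hstep : ‖quantumBaker N * V' - φ • V''‖ ≤ E :=
      hx.norm_quantumBaker_mul_coherentCol_sub_le hN hN_even hn hδ
    refine ⟨θ * φ, by rw [norm_mul, hθ, hφ, bakerPhase, norm_expi, one_mul], ?_⟩
    have hsplit : quantumBaker N ^ (m + 1) * V - (θ * φ) • V''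
        = quantumBaker N * (quantumBaker N ^ m * V - θ • V')
          + θ • (quantumBaker N * V' - φ • V'') := by
      rw [pow_succ', Matrix.mul_sub, Matrix.mul_smul, smul_sub, smul_smul, Matrix.mul_assoc]
      abel
    calc _ ≤ ‖quantumBaker N ^ m * V - θ • V'‖ + ‖quantumBaker N * V' - φ • V''‖ := by
          rw [hsplit]
          refine (norm_add_le _ _).trans_eq ?_
          rw [norm_mul_of_mem_unitary (quantumBaker_mem_unitary hN hN_even), norm_smul, hθ, one_mul]
      _ ≤ m * E + E := add_le_add hle hstep
      _ = (m + 1 : ℕ) * E := by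
          push_cast
          ring

lemma smul_mul_conjTranspose_smul {m n : Type*} [Fintype n] {θ : ℂ} (hθ : ‖θ‖ = 1)
    (V : Matrix m n ℂ) : (θ • V) * (θ • V).conjTranspose = V * V.conjTranspose := by
  rw [Matrix.conjTranspose_smul, Matrix.smul_mul, Matrix.mul_smul, smul_smul, RCLike.star_def,
    Complex.mul_conj', hθ, Complex.ofReal_one, one_pow, one_smul]

lemma IsGood.norm_conj_transSum_projCoeff_sub_le {N : ℕ} (hN : 0 < N) (hN_even : Even N) {n : ℕ}
    (hn : (2 : ℝ) ^ n ≤ N) {δ : ℝ} (hδ : 0 < δ) {x : Square} (hx : IsGood n δ (toPlane x)) :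
    ‖quantumBaker N ^ n * transSum N (projCoeff N (2 ^ n) (toPlane x))
          * star (quantumBaker N ^ n)
        - transSum N (projCoeff N (1 / 2 ^ n) (toPlane ((baker ^ n) x)))‖
      ≤ 14400 * n * N ^ 2 * Real.exp (-(Real.pi / 2 * (N * δ ^ 2 / 2 ^ n))) := by
  have hN1 : (1 : ℝ) ≤ N := mod_cast hN
  have h2n : (1 : ℝ) ≤ 2 ^ n := one_le_pow₀ one_le_two
  obtain ⟨θ, hθ, hle⟩ :=
    hx.exists_norm_quantumBaker_pow_mul_coherentCol_sub_le hN hN_even hn hδ le_rfl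
  have hfour : (2 : ℝ) ^ n / 4 ^ n = 1 / 2 ^ n := by
    rw [← div_pow, ← one_div_pow]
    norm_num
  rw [hfour] at hle
  set U := quantumBaker N ^ n * coherentCol N (2 ^ n) (toPlane x) with hU
  set W := θ • coherentCol N (1 / 2 ^ n) (toPlane ((baker ^ n) x)) with hW
  have hUU : quantumBaker N ^ n * transSum N (projCoeff N (2 ^ n) (toPlane x))
      * star (quantumBaker N ^ n) = U * U.conjTranspose := by
    rw [transSum_projCoeff_eq_coherentCol hN (by positivity), hU, Matrix.conjTranspose_mul,
      Matrix.star_eq_conjTranspose]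
    simp only [Matrix.mul_assoc]
  have hWW : transSum N (projCoeff N (1 / 2 ^ n) (toPlane ((baker ^ n) x)))
      = W * W.conjTranspose := by
    rw [transSum_projCoeff_eq_coherentCol hN (by positivity), hW, smul_mul_conjTranspose_smul hθ]
  have hsqrt : Real.sqrt N * 45 ≤ N * 45 := by
    gcongr
    exact Real.sqrt_le_iff.mpr ⟨by positivity, by nlinarith⟩
  have hU_le : ‖U‖ ≤ N * 45 := by
    rw [hU, norm_mul_of_mem_unitary (pow_mem (quantumBaker_mem_unitary hN hN_even) n)]
    exact (norm_coherentCol_le hN (by positivity) hn (by nlinarith) _).trans hsqrt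
  have hW_le : ‖W‖ ≤ N * 45 := by
    rw [hW, norm_smul, hθ, one_mul]
    refine (norm_coherentCol_le hN (by positivity) ?_ ?_ _).trans hsqrt
    · rw [div_le_iff₀ (by positivity)]
      nlinarith
    · rw [mul_one_div, le_div_iff₀ (by positivity)]
      linarith
  rw [hUU, hWW]
  refine (norm_mul_conjTranspose_sub_le hU_le hW_le hle).trans_eq ?_
  ring

/-! ### The baker's map preserves area -/

attribute [local instance] Measure.Subtype.measureSpace

instance : IsProbabilityMeasure (volume : Measure (Set.Ico (0 : ℝ) 1)) :=
  ⟨by simp [Measure.Subtype.volume_univ measurableSet_Ico.nullMeasurableSet]⟩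

lemma measurableEmbedding_toPlane : MeasurableEmbedding toPlane :=
  (MeasurableEmbedding.subtype_coe measurableSet_Ico).prodMap
    (MeasurableEmbedding.subtype_coe measurableSet_Ico)

lemma measurePreserving_toPlane : MeasurePreserving toPlane volume
    (volume.restrict (Set.Ico (0 : ℝ) 1 ×ˢ Set.Ico (0 : ℝ) 1)) := by
  have hcoe : MeasurePreserving ((↑) : Set.Ico (0 : ℝ) 1 → ℝ) volume
      (volume.restrict (Set.Ico 0 1)) := measurePreserving_subtype_coe measurableSet_Ico
  rw [Measure.volume_eq_prod ℝ ℝ, ← Measure.prod_restrict]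
  exact hcoe.prod hcoe

lemma volume_image_toPlane (S : Set Square) : volume (toPlane '' S) = volume S := by
  have hsubset : toPlane '' S ⊆ Set.Ico (0 : ℝ) 1 ×ˢ Set.Ico (0 : ℝ) 1 := by
    rintro _ ⟨y, -, rfl⟩
    exact ⟨y.1.2, y.2.2⟩
  rw [← Measure.restrict_eq_self _ hsubset,
    ← measurePreserving_toPlane.measure_preimage_emb measurableEmbedding_toPlane,
    Set.preimage_image_eq _ measurableEmbedding_toPlane.injective]

lemma measurePreserving_mul_prod_inv_mul {c : ℝ} (hc : c ≠ 0) :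
    MeasurePreserving fun x : ℝ × ℝ => (c * x.1, c⁻¹ * x.2) where
  measurable := by fun_prop
  map_eq := by
    have hprod := Measure.map_prod_map (volume : Measure ℝ) (volume : Measure ℝ)
      (f := fun x : ℝ => c * x) (g := fun x : ℝ => c⁻¹ * x) (by fun_prop) (by fun_prop)
    rw [Real.map_volume_mul_left hc, Real.map_volume_mul_left (inv_ne_zero hc),
      Measure.prod_smul_left, Measure.prod_smul_right, smul_smul,
      ← ENNReal.ofReal_mul (abs_nonneg _), ← abs_mul, inv_inv, inv_mul_cancel₀ hc, abs_one,
      ENNReal.ofReal_one, one_smul] at hprod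
    exact hprod.symm

/-- The affine branch of the baker's map on the half `b` of the square. -/
def bakerBranch (b : ℤ) : ℝ × ℝ ≃ᵐ ℝ × ℝ where
  toFun x := (2 * x.1 - b, (x.2 + b) / 2)
  invFun x := (2⁻¹ * (x.1 + b), 2⁻¹⁻¹ * x.2 - b)
  left_inv x := by
    ext
    · simp
    · field_simp
      ring
  right_inv x := by ext <;> simp
  measurable_toFun := by
    simp only [Equiv.coe_fn_mk]
    fun_prop
  measurable_invFun := by
    simp only [Equiv.coe_fn_symm_mk]
    fun_prop

lemma volume_image_bakerBranch (b : ℤ) (S : Set (ℝ × ℝ)) :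
    volume (bakerBranch b '' S) = volume S := by
  have hsymm : MeasurePreserving (bakerBranch b).symm := by
    convert ((measurePreserving_add_right volume (2⁻¹ * b : ℝ)).prod
      (measurePreserving_sub_right volume (b : ℝ))).comp
      (measurePreserving_mul_prod_inv_mul (inv_ne_zero (two_ne_zero (α := ℝ)))) using 1
    · ext x
      · simp [bakerBranch, mul_add]
      · simp [bakerBranch]
    · exact Measure.volume_eq_prod ℝ ℝ
  rw [(bakerBranch b).image_eq_preimage_symm]
  exact hsymm.measure_preimage_emb (bakerBranch b).symm.measurableEmbedding S

lemma measurable_floor_two_mul_fst : Measurable fun y : Square => ⌊2 * (y.1 : ℝ)⌋ := by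
  fun_prop

lemma measurable_baker : Measurable baker := by
  rw [← measurableEmbedding_toPlane.measurable_comp_iff]
  have hfloor : Measurable fun y : Square => (⌊2 * (y.1 : ℝ)⌋ : ℝ) :=
    measurable_from_top.comp measurable_floor_two_mul_fst
  rw [show toPlane ∘ baker = _ from funext toPlane_baker]
  fun_prop

lemma volume_image_baker {S : Set Square} (hS : MeasurableSet S) :
    volume (baker '' S) = volume S := by
  set piece : ℤ → Set Square := fun b => S ∩ {y | ⌊2 * (y.1 : ℝ)⌋ = b}
  have hpiece (b : ℤ) : MeasurableSet (piece b) :=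
    hS.inter (measurable_floor_two_mul_fst (measurableSet_singleton b))
  have hdisjoint : Pairwise (Function.onFun Disjoint piece) := fun b c hbc =>
    Set.disjoint_left.mpr fun y hyb hyc => hbc (hyb.2.symm.trans hyc.2)
  have hcover : S = ⋃ b, piece b := by
    ext y
    simp [piece]
  have himage (b : ℤ) : toPlane '' (baker '' piece b) = bakerBranch b '' (toPlane '' piece b) := by
    rw [Set.image_image, Set.image_image]
    refine Set.image_congr fun y hy => ?_
    rw [toPlane_baker, hy.2]
    rfl
  calc volume (baker '' S)
      = volume (⋃ b, toPlane '' (baker '' piece b)) := by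
        rw [← volume_image_toPlane, ← Set.image_iUnion, ← Set.image_iUnion, ← hcover]
    _ = ∑' b, volume (toPlane '' (baker '' piece b)) := by
        refine measure_iUnion (fun b c hbc => ?_) fun b => ?_
        · exact (Set.disjoint_image_iff measurableEmbedding_toPlane.injective).mpr
            ((Set.disjoint_image_iff baker.injective).mpr (hdisjoint hbc))
        · rw [himage]
          exact (bakerBranch b).measurableEmbedding.measurableSet_image.mpr
            (measurableEmbedding_toPlane.measurableSet_image.mpr (hpiece b))
    _ = ∑' b, volume (piece b) := by
        simp_rw [himage, volume_image_bakerBranch, volume_image_toPlane]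
    _ = volume S := by rw [← measure_iUnion hdisjoint hpiece, ← hcover]

lemma measurePreserving_baker : MeasurePreserving baker where
  measurable := measurable_baker
  map_eq := by
    ext S hS
    rw [Measure.map_apply measurable_baker hS, ← volume_image_baker (measurable_baker hS),
      Set.image_preimage_eq _ baker.surjective]

lemma measurePreserving_baker_pow (n : ℕ) : MeasurePreserving (baker ^ n : Equiv.Perm Square) := by
  rw [← Equiv.Perm.iterate_eq_pow]
  exact measurePreserving_baker.iterate n

/-! ### Anti-Wick quantisation -/

/-- The anti-Wick quantisation of `b` with squeezing `s`, through its Fourier coefficients. -/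
def antiWick (N : ℕ) (s : ℝ) (b : ℝ × ℝ → ℂ) : Matrix (Fin N) (Fin N) ℂ :=
  transSum N fun k => (Real.exp (-qform N s k) : ℂ) * fourierCoeff₂ b k

lemma continuous_toPlane : Continuous toPlane := by
  unfold toPlane
  fun_prop

lemma integrable_comp_toPlane {E : Type*} [NormedAddCommGroup E] {g : ℝ × ℝ → E}
    (hg : Continuous g) : Integrable fun y => g (toPlane y) := by
  have hcompact : IsCompact (Set.Icc (0 : ℝ) 1 ×ˢ Set.Icc (0 : ℝ) 1) :=
    isCompact_Icc.prod isCompact_Icc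
  refine (measurePreserving_toPlane.integrable_comp_emb measurableEmbedding_toPlane).mpr ?_
  exact (hg.continuousOn.integrableOn_compact hcompact).mono_set
    (Set.prod_mono Set.Ico_subset_Icc_self Set.Ico_subset_Icc_self)

lemma fourierCoeff₂_eq_integral_square (f : ℝ × ℝ → ℂ) (k : ℤ × ℤ) :
    fourierCoeff₂ f k = ∫ y : Square, f (toPlane y)
      * Complex.exp (-(2 * Real.pi * Complex.I * ((toPlane y).1 * k.2 - (toPlane y).2 * k.1))) :=
  (measurePreserving_toPlane.integral_comp measurableEmbedding_toPlane _).symm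

lemma continuous_projCoeff (N : ℕ) (s : ℝ) (k : ℤ × ℤ) :
    Continuous fun x => projCoeff N s x k := by
  have := continuous_expi
  unfold projCoeff
  fun_prop

lemma continuous_transSum_projCoeff {N : ℕ} (hN : 0 < N) {s : ℝ} (hs : 0 < s) :
    Continuous fun x => transSum N (projCoeff N s x) := by
  refine continuous_tsum (u := fun k => 1 / N * Real.exp (-qform N s k))
    (fun k => (continuous_projCoeff N s k).smul continuous_const)
    ((summable_exp_neg_qform hN hs).mul_left _) fun k x => ?_
  rw [norm_smul, norm_projCoeff]
  exact mul_le_of_le_one_right (by positivity) (norm_translation_le N k)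

lemma integral_mul_projCoeff (N : ℕ) (s : ℝ) (b : ℝ × ℝ → ℂ) (k : ℤ × ℤ) :
    ∫ y : Square, b (toPlane y) * projCoeff N s (toPlane y) k
      = ((1 / N * Real.exp (-qform N s k) : ℝ) : ℂ) * fourierCoeff₂ b k := by
  rw [fourierCoeff₂_eq_integral_square, ← integral_const_mul]
  congr 1 with y
  rw [projCoeff, expi, mul_left_comm]
  congr 3
  push_cast
  ring

lemma antiWick_eq_integral {N : ℕ} (hN : 0 < N) {s : ℝ} (hs : 0 < s) {b : ℝ × ℝ → ℂ}
    (hb : Continuous b) {M : ℝ} (hM : ∀ x, ‖b x‖ ≤ M) : antiWick N s b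
      = (N : ℂ) • ∫ y : Square, b (toPlane y) • transSum N (projCoeff N s (toPlane y)) := by
  have hNc : (N : ℂ) ≠ 0 := mod_cast hN.ne'
  set F : ℤ × ℤ → Square → Matrix (Fin N) (Fin N) ℂ := fun k y =>
    (b (toPlane y) * projCoeff N s (toPlane y) k) • translation N k with hF
  have hF_int (k : ℤ × ℤ) : Integrable (F k) :=
    integrable_comp_toPlane ((hb.mul (continuous_projCoeff N s k)).smul continuous_const)
  have hF_le (k : ℤ × ℤ) (y : Square) : ‖F k y‖ ≤ M * (1 / N * Real.exp (-qform N s k)) := by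
    rw [hF, norm_smul, norm_mul, norm_projCoeff]
    exact (mul_le_of_le_one_right (by positivity) (norm_translation_le N k)).trans
      (mul_le_mul_of_nonneg_right (hM _) (by positivity))
  have hF_summable : Summable fun k => ∫ y, ‖F k y‖ := by
    refine Summable.of_nonneg_of_le (fun k => integral_nonneg fun y => norm_nonneg _)
      (fun k => ?_) (((summable_exp_neg_qform hN hs).mul_left (1 / (N : ℝ))).mul_left M)
    simpa using integral_mono (hF_int k).norm (integrable_const _) (hF_le k)
  have hsum := hasSum_integral_of_summable_integral_norm hF_int hF_summable
  have hF_tsum (y : Square) :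
      ∑' k, F k y = b (toPlane y) • transSum N (projCoeff N s (toPlane y)) := by
    simp only [hF, transSum, ← smul_smul]
    exact (summable_smul_translation N (summable_projCoeff hN hs _)).tsum_const_smul _
  simp_rw [hF_tsum] at hsum
  rw [← hsum.tsum_eq, ← hsum.summable.tsum_const_smul, antiWick, transSum]
  refine tsum_congr fun k => ?_
  rw [hF, integral_smul_const, smul_smul, integral_mul_projCoeff]
  congr 1
  push_cast
  field_simp

lemma toSquare_toPlane (y : Square) : toSquare (toPlane y) = y :=
  Prod.ext (Subtype.ext (Int.fract_eq_self.mpr y.1.2)) (Subtype.ext (Int.fract_eq_self.mpr y.2.2))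

lemma compBaker_toPlane (f : ℝ × ℝ → ℂ) (m : ℤ) (y : Square) :
    compBaker f m (toPlane y) = f (toPlane ((baker ^ m) y)) := by
  rw [compBaker, toSquare_toPlane]
  rfl

lemma antiWick_eq_integral_comp_baker_pow {N : ℕ} (hN : 0 < N) {s : ℝ} (hs : 0 < s)
    {b : ℝ × ℝ → ℂ} (hb : Continuous b) {M : ℝ} (hM : ∀ x, ‖b x‖ ≤ M) (n : ℕ) : antiWick N s b
      = (N : ℂ) • ∫ y : Square, b (toPlane ((baker ^ n) y))
        • transSum N (projCoeff N s (toPlane ((baker ^ n) y))) := by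
  have hcont : Continuous fun x => b x • transSum N (projCoeff N s x) :=
    hb.smul (continuous_transSum_projCoeff hN hs)
  rw [antiWick_eq_integral hN hs hb hM]
  conv_lhs => rw [← (measurePreserving_baker_pow n).map_eq]
  exact congrArg _ (integral_map (measurePreserving_baker_pow n).measurable.aemeasurable
    (hcont.comp continuous_toPlane).aestronglyMeasurable)

lemma mul_antiWick_mul_eq_integral {N : ℕ} (hN : 0 < N) {s : ℝ} (hs : 0 < s) {b : ℝ × ℝ → ℂ}
    (hb : Continuous b) {M : ℝ} (hM : ∀ x, ‖b x‖ ≤ M) (U V : Matrix (Fin N) (Fin N) ℂ) :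
    U * antiWick N s b * V = (N : ℂ) • ∫ y : Square, b (toPlane y)
      • (U * transSum N (projCoeff N s (toPlane y)) * V) := by
  let L : Matrix (Fin N) (Fin N) ℂ →L[ℂ] Matrix (Fin N) (Fin N) ℂ :=
    LinearMap.toContinuousLinearMap ((LinearMap.mulRight ℂ V).comp (LinearMap.mulLeft ℂ U))
  have hL (A : Matrix (Fin N) (Fin N) ℂ) : L A = U * A * V := rfl
  rw [antiWick_eq_integral hN hs hb hM, ← hL, map_smul, ← L.integral_comp_comm]
  · simp_rw [map_smul, hL]
  · exact integrable_comp_toPlane (hb.smul (continuous_transSum_projCoeff hN hs))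

lemma norm_conj_antiWick_sub_le {N : ℕ} (hN : 0 < N) (hN_even : Even N) {n : ℕ}
    (hn : (2 : ℝ) ^ n ≤ N) {δ : ℝ} (hδ : 0 < δ) {b b' : ℝ × ℝ → ℂ} (hb : Continuous b)
    (hb' : Continuous b') {M : ℝ} (hM : ∀ x, ‖b x‖ ≤ M) (hM' : ∀ x, ‖b' x‖ ≤ M)
    (hsupp : ∀ y : Square, ¬ IsGood n δ (toPlane y) → b (toPlane y) = 0)
    (hbb' : ∀ y : Square, b' (toPlane ((baker ^ n) y)) = b (toPlane y)) :
    ‖quantumBaker N ^ n * antiWick N (2 ^ n) b * star (quantumBaker N ^ n)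
        - antiWick N (1 / 2 ^ n) b'‖
      ≤ 14400 * M * n * N ^ 3 * Real.exp (-(Real.pi / 2 * (N * δ ^ 2 / 2 ^ n))) := by
  have hs : (0 : ℝ) < 2 ^ n := by positivity
  have hs' : (0 : ℝ) < 1 / 2 ^ n := by positivity
  have hM_nonneg : 0 ≤ M := (norm_nonneg _).trans (hM 0)
  set U := quantumBaker N ^ n
  set E := Real.exp (-(Real.pi / 2 * (N * δ ^ 2 / 2 ^ n)))
  have hint : Integrable fun y : Square =>
      b (toPlane y) • (U * transSum N (projCoeff N (2 ^ n) (toPlane y)) * star U) :=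
    integrable_comp_toPlane <| hb.smul <|
      (continuous_const.mul (continuous_transSum_projCoeff hN hs)).mul continuous_const
  have hint' : Integrable fun y : Square => b (toPlane y)
      • transSum N (projCoeff N (1 / 2 ^ n) (toPlane ((baker ^ n) y))) := by
    simp_rw [← hbb']
    exact (measurePreserving_baker_pow n).integrable_comp_of_integrable
      (integrable_comp_toPlane (hb'.smul (continuous_transSum_projCoeff hN hs')))
  have hpointwise (y : Square) :
      ‖b (toPlane y) • (U * transSum N (projCoeff N (2 ^ n) (toPlane y)) * star U)
        - b (toPlane y) • transSum N (projCoeff N (1 / 2 ^ n) (toPlane ((baker ^ n) y)))‖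
      ≤ M * (14400 * n * N ^ 2 * E) := by
    rw [← smul_sub, norm_smul]
    by_cases hy : IsGood n δ (toPlane y)
    · exact mul_le_mul (hM _) (hy.norm_conj_transSum_projCoeff_sub_le hN hN_even hn hδ)
        (norm_nonneg _) hM_nonneg
    · rw [hsupp y hy, norm_zero, zero_mul]
      positivity
  rw [mul_antiWick_mul_eq_integral hN hs hb hM,
    antiWick_eq_integral_comp_baker_pow hN hs' hb' hM' n]
  simp_rw [hbb']
  rw [← smul_sub, ← integral_sub hint hint', norm_smul, Complex.norm_natCast]
  calc _ ≤ N * (M * (14400 * n * N ^ 2 * E)) := by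
        gcongr
        simpa using norm_integral_le_of_norm_le_const (μ := (volume : Measure Square))
          (.of_forall hpointwise)
    _ = _ := by ring

/-! ### Composition of observables with iterates of the baker's map -/

lemma bakerFun_swap (x : Square) : bakerFun x.swap = (bakerInv x).swap := by
  unfold bakerFun bakerInv
  split_ifs <;> first | rfl | contradiction

lemma baker_zpow_swap (m : ℤ) (x : Square) : (baker ^ m) x.swap = ((baker ^ (-m)) x).swap := by
  set swap : Equiv.Perm Square := Equiv.prodComm _ _
  have hconj : swap * baker * swap⁻¹ = baker⁻¹ := Equiv.ext fun y => by
    change (bakerFun y.swap).swap = bakerInv y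
    rw [bakerFun_swap, Prod.swap_swap]
  rw [zpow_neg, ← inv_zpow, ← hconj, conj_zpow]
  rfl

lemma compBaker_comp_swap (f : ℝ × ℝ → ℂ) (m : ℤ) :
    compBaker (f ∘ Prod.swap) (-m) = compBaker f m ∘ Prod.swap := by
  ext y
  change f (toPlane ((baker ^ (-m)) (toSquare y)).swap)
    = f (toPlane ((baker ^ m) (toSquare y).swap))
  rw [baker_zpow_swap]

lemma IsObservable.compBaker_compBaker_neg {f : ℝ × ℝ → ℂ} (hf : IsObservable f) (m : ℤ) :
    compBaker (compBaker f m) (-m) = f := by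
  ext y
  change f (toPlane ((baker ^ m) (toSquare (toPlane ((baker ^ (-m)) (toSquare y)))))) = f y
  rw [toSquare_toPlane, ← Equiv.Perm.mul_apply, ← zpow_add, add_neg_cancel, zpow_zero]
  exact hf.apply_fract y.1 y.2

lemma exists_compBaker_neg_eq (n : ℕ) (l R : ℤ) : ∃ c : ℤ, ∀ f : ℝ × ℝ → ℂ, IsObservable f →
    ∀ y : ℝ × ℝ, ⌊y.1⌋ = l → ⌊2 ^ n * y.2⌋ = R →
      compBaker f (-n) y = f ((y.1 + c) / 2 ^ n, 2 ^ n * y.2) := by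
  obtain ⟨r, hr⟩ := exists_toPlane_baker_pow n (R % 2 ^ n)
  refine ⟨r - l, fun f hf y hl hR => ?_⟩
  have hdivmod : ((2 : ℝ) ^ n) * (R / 2 ^ n : ℤ) + (R % 2 ^ n : ℤ) = R := mod_cast
    Int.mul_ediv_add_emod R (2 ^ n)
  have hq : ((toSquare y).1 : ℝ) = y.1 - l := by rw [← hl]; rfl
  have hp : ((toSquare y).2 : ℝ) = y.2 - (R / 2 ^ n : ℤ) := by
    rw [← hR, floor_two_pow_mul_ediv]
    rfl
  have hdigit : ⌊2 ^ n * ((toSquare y).swap.1 : ℝ)⌋ = R % 2 ^ n := by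
    have hshift : 2 ^ n * ((toSquare y).2 : ℝ) = 2 ^ n * y.2 - (2 ^ n * (R / 2 ^ n) : ℤ) := by
      rw [hp]
      push_cast
      ring
    rw [Prod.fst_swap, hshift, Int.floor_sub_intCast, hR, Int.emod_def]
  calc compBaker f (-n) y
      = f (toPlane ((baker ^ n) (toSquare y).swap)).swap := by
        rw [← zpow_natCast, baker_zpow_swap]
        rfl
    _ = f ((y.1 + (r - l : ℤ)) / 2 ^ n + (0 : ℤ), 2 ^ n * y.2 + (-R : ℤ)) := by
        rw [hr _ hdigit, Prod.fst_swap, Prod.snd_swap, hq, hp, Prod.swap_prod_mk]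
        congr 2
        · push_cast
          ring
        · push_cast
          linear_combination -hdivmod
    _ = f ((y.1 + (r - l : ℤ)) / 2 ^ n, 2 ^ n * y.2) := hf.apply_add_int _ _ _ _

lemma eventually_floor_eq {X : Type*} [TopologicalSpace X] {g : X → ℝ} {y : X}
    (hg : ContinuousAt g y) {δ : ℝ} (hδ : 0 < δ) (hfar : FarFromInt δ (g y)) :
    ∀ᶠ z in 𝓝 y, ⌊g z⌋ = ⌊g y⌋ := by
  have hfloor_lt : (⌊g y⌋ : ℝ) < g y := (Int.floor_le _).lt_of_ne fun heq => by
    have hle := hfar ⌊g y⌋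
    rw [heq, sub_self, abs_zero] at hle
    exact hδ.not_ge hle
  filter_upwards [hg.eventually_const_lt hfloor_lt,
    hg.eventually_lt_const (Int.lt_floor_add_one (g y))] with z hz_gt hz_lt
  exact Int.floor_eq_iff.mpr ⟨hz_gt.le, hz_lt⟩

lemma exists_compBaker_neg_eventuallyEq {n : ℕ} {δ : ℝ} (hδ : 0 < δ) {y : ℝ × ℝ}
    (hy : IsGood n δ y.swap) : ∃ c : ℤ, ∀ f : ℝ × ℝ → ℂ, IsObservable f →
      compBaker f (-n) =ᶠ[𝓝 y] fun z => f ((z.1 + c) / 2 ^ n, 2 ^ n * z.2) := by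
  obtain ⟨c, hc⟩ := exists_compBaker_neg_eq n ⌊y.1⌋ ⌊2 ^ n * y.2⌋
  refine ⟨c, fun f hf => ?_⟩
  filter_upwards [eventually_floor_eq (g := fun z => z.1) (by fun_prop) hδ hy.2,
    eventually_floor_eq (g := fun z => 2 ^ n * z.2) (by fun_prop) hδ hy.1] with z hq hp
  exact hc f hf z hq hp

lemma isClosed_farFromInt (δ : ℝ) : IsClosed {x | FarFromInt δ x} := by
  simp only [FarFromInt, Set.ofPred_forall]
  exact isClosed_iInter fun k => isClosed_le continuous_const (by fun_prop)

lemma isClosed_isGood (n : ℕ) (δ : ℝ) : IsClosed {x | IsGood n δ x} :=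
  ((isClosed_farFromInt δ).preimage (by fun_prop)).inter
    ((isClosed_farFromInt δ).preimage continuous_snd)

/-- The observables that vanish at distance less than `δ` from the discontinuities of `B ^ n`. -/
structure IsGoodObservable (n : ℕ) (δ : ℝ) (f : ℝ × ℝ → ℂ) : Prop extends IsObservable f where
  eq_zero : ∀ x, ¬ IsGood n δ x → f x = 0

namespace IsGoodObservable

variable {n : ℕ} {δ : ℝ} {f : ℝ × ℝ → ℂ}

lemma eventuallyEq_zero (hf : IsGoodObservable n δ f) {x : ℝ × ℝ} (hx : ¬ IsGood n δ x) :
    f =ᶠ[𝓝 x] fun _ => 0 :=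
  mem_of_superset ((isClosed_isGood n δ).isOpen_compl.mem_nhds hx) hf.eq_zero

lemma dq (hf : IsGoodObservable n δ f) : IsGoodObservable n δ (dq f) :=
  ⟨hf.toIsObservable.dq, fun x hx => by rw [dq_congr (hf.eventuallyEq_zero hx), dq_zero]⟩

lemma dp (hf : IsGoodObservable n δ f) : IsGoodObservable n δ (dp f) :=
  ⟨hf.toIsObservable.dp, fun x hx => by rw [dp_congr (hf.eventuallyEq_zero hx), dp_zero]⟩

lemma iterate_dp (hf : IsGoodObservable n δ f) (j : ℕ) : IsGoodObservable n δ (QBaker.dp^[j] f) :=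
  Function.Iterate.rec (IsGoodObservable n δ) hf (fun _ hg => hg.dp) j

lemma iterate (hf : IsGoodObservable n δ f) (i j : ℕ) :
    IsGoodObservable n δ (QBaker.dq^[i] (QBaker.dp^[j] f)) :=
  Function.Iterate.rec (IsGoodObservable n δ) (hf.iterate_dp j) (fun _ hg => hg.dq) i

lemma compBaker_eq_zero (hf : IsGoodObservable n δ f) {y : ℝ × ℝ} (hy : ¬ IsGood n δ y.swap) :
    compBaker f (-n) y = 0 := by
  obtain ⟨c, hc⟩ := exists_compBaker_neg_eq n ⌊y.1⌋ ⌊2 ^ n * y.2⌋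
  rw [hc f hf.toIsObservable y rfl rfl]
  refine hf.eq_zero _ fun hgood => hy ⟨hgood.2, fun k => ?_⟩
  have hfar := hgood.1 (k + c)
  rw [mul_div_cancel₀ _ (by positivity)] at hfar
  simpa [add_sub_add_right_eq_sub] using hfar

lemma compBaker_eventuallyEq_zero (hf : IsGoodObservable n δ f) {y : ℝ × ℝ}
    (hy : ¬ IsGood n δ y.swap) : compBaker f (-n) =ᶠ[𝓝 y] fun _ => 0 :=
  mem_of_superset (((isClosed_isGood n δ).isOpen_compl.preimage continuous_swap).mem_nhds hy)
    fun _ => hf.compBaker_eq_zero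

lemma isObservable_compBaker (hf : IsGoodObservable n δ f) (hδ : 0 < δ) :
    IsObservable (compBaker f (-n)) where
  smooth := by
    rw [contDiff_iff_contDiffAt]
    intro y
    by_cases hy : IsGood n δ y.swap
    · obtain ⟨c, hc⟩ := exists_compBaker_neg_eventuallyEq hδ hy
      refine ContDiffAt.congr_of_eventuallyEq (ContDiff.contDiffAt ?_) (hc f hf.toIsObservable)
      exact hf.smooth.comp (by fun_prop)
    · exact contDiffAt_const.congr_of_eventuallyEq (hf.compBaker_eventuallyEq_zero hy)
  periodic_q q p := by simp only [compBaker, toSquare, Int.fract_add_one]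
  periodic_p q p := by simp only [compBaker, toSquare, Int.fract_add_one]

lemma compBaker (hf : IsGoodObservable n δ (f ∘ Prod.swap)) (hδ : 0 < δ) :
    IsGoodObservable n δ (compBaker f n) := by
  have hswap : QBaker.compBaker f n = QBaker.compBaker (f ∘ Prod.swap) (-n) ∘ Prod.swap := by
    rw [compBaker_comp_swap, Function.comp_assoc, Prod.swap_swap_eq, Function.comp_id]
  rw [hswap]
  exact ⟨(hf.isObservable_compBaker hδ).comp_swap, fun x hx => hf.compBaker_eq_zero hx⟩

lemma dq_compBaker (hf : IsGoodObservable n δ f) (hδ : 0 < δ) (y : ℝ × ℝ) :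
    QBaker.dq (QBaker.compBaker f (-n)) y
      = (1 / 2 ^ n : ℂ) * QBaker.compBaker (QBaker.dq f) (-n) y := by
  by_cases hy : IsGood n δ y.swap
  · obtain ⟨c, hc⟩ := exists_compBaker_neg_eventuallyEq hδ hy
    rw [dq_congr (hc f hf.toIsObservable), (hc _ hf.dq.toIsObservable).self_of_nhds]
    have houter := hasDerivAt_dq hf.differentiable ((y.1 + c) / 2 ^ n) (2 ^ n * y.2)
    have hinner : HasDerivAt (fun t : ℝ => (t + c) / 2 ^ n) (1 / 2 ^ n) y.1 :=
      ((hasDerivAt_id y.1).add_const _).div_const _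
    refine (houter.scomp y.1 hinner).deriv.trans ?_
    rw [Complex.real_smul]
    push_cast
    rfl
  · rw [dq_congr (hf.compBaker_eventuallyEq_zero hy), dq_zero, hf.dq.compBaker_eq_zero hy, mul_zero]

lemma dp_compBaker (hf : IsGoodObservable n δ f) (hδ : 0 < δ) (y : ℝ × ℝ) :
    QBaker.dp (QBaker.compBaker f (-n)) y
      = (2 ^ n : ℂ) * QBaker.compBaker (QBaker.dp f) (-n) y := by
  by_cases hy : IsGood n δ y.swap
  · obtain ⟨c, hc⟩ := exists_compBaker_neg_eventuallyEq hδ hy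
    rw [dp_congr (hc f hf.toIsObservable), (hc _ hf.dp.toIsObservable).self_of_nhds]
    have houter := hasDerivAt_dp hf.differentiable ((y.1 + c) / 2 ^ n) (2 ^ n * y.2)
    have hinner : HasDerivAt (fun t : ℝ => 2 ^ n * t) (2 ^ n) y.2 := by
      simpa using (hasDerivAt_id y.2).const_mul ((2 : ℝ) ^ n)
    refine (houter.scomp y.2 hinner).deriv.trans ?_
    rw [Complex.real_smul]
    push_cast
    rfl
  · rw [dp_congr (hf.compBaker_eventuallyEq_zero hy), dp_zero, hf.dp.compBaker_eq_zero hy, mul_zero]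

lemma iterate_dp_compBaker (hf : IsGoodObservable n δ f) (hδ : 0 < δ) (j : ℕ) :
    QBaker.dp^[j] (QBaker.compBaker f (-n)) = fun y =>
      (2 ^ n : ℂ) ^ j * QBaker.compBaker (QBaker.dp^[j] f) (-n) y := by
  induction j with
  | zero => simp
  | succ j ih =>
    rw [Function.iterate_succ_apply', Function.iterate_succ_apply', ih, dp_const_mul]
    ext y
    rw [(hf.iterate_dp j).dp_compBaker hδ]
    ring

lemma iterate_compBaker (hf : IsGoodObservable n δ f) (hδ : 0 < δ) (i j : ℕ) :
    QBaker.dq^[i] (QBaker.dp^[j] (QBaker.compBaker f (-n))) = fun y =>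
      (1 / 2 ^ n : ℂ) ^ i * (2 ^ n : ℂ) ^ j
        * QBaker.compBaker (QBaker.dq^[i] (QBaker.dp^[j] f)) (-n) y := by
  induction i with
  | zero => simpa using hf.iterate_dp_compBaker hδ j
  | succ i ih =>
    rw [Function.iterate_succ_apply', Function.iterate_succ_apply', ih, dq_const_mul]
    ext y
    rw [(hf.iterate i j).dq_compBaker hδ]
    ring

end IsGoodObservable

/-! ### Cutoff observables -/

lemma iterate_dq_eq_iteratedDeriv (f : ℝ × ℝ → ℂ) (i : ℕ) (x : ℝ × ℝ) :
    dq^[i] f x = iteratedDeriv i (fun t => f (t, x.2)) x.1 := by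
  induction i generalizing x with
  | zero => simp
  | succ i ih =>
    rw [Function.iterate_succ_apply', iteratedDeriv_succ, dq]
    simp_rw [ih]

lemma norm_iteratedDeriv_smul_le {u : ℝ → ℝ} {v : ℝ → ℂ} {i : ℕ} (hu : ContDiff ℝ i u)
    (hv : ContDiff ℝ i v) {K A α : ℝ} (hα : 1 ≤ α) {x : ℝ}
    (hu_le : ∀ k ≤ i, |iteratedDeriv k u x| ≤ K * α ^ k)
    (hv_le : ∀ k ≤ i, ‖iteratedDeriv k v x‖ ≤ A) :
    ‖iteratedDeriv i (fun t => u t • v t) x‖ ≤ 2 ^ i * (K * α ^ i * A) := by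
  have hK : 0 ≤ K := by simpa using (abs_nonneg _).trans (hu_le 0 (Nat.zero_le _))
  have hchoose : (2 : ℝ) ^ i = ∑ k ∈ Finset.range (i + 1), (i.choose k : ℝ) := mod_cast
    (Nat.sum_range_choose i).symm
  rw [← norm_iteratedFDeriv_eq_norm_iteratedDeriv, hchoose, Finset.sum_mul]
  refine (norm_iteratedFDeriv_smul_le hu hv x le_rfl).trans (Finset.sum_le_sum fun k hk => ?_)
  have hki : k ≤ i := Nat.lt_succ_iff.mp (Finset.mem_range.mp hk)
  have huk : |iteratedDeriv k u x| ≤ K * α ^ i :=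
    (hu_le k hki).trans (mul_le_mul_of_nonneg_left (pow_le_pow_right₀ hα hki) hK)
  have hvk := hv_le (i - k) (Nat.sub_le _ _)
  rw [norm_iteratedFDeriv_eq_norm_iteratedDeriv, norm_iteratedFDeriv_eq_norm_iteratedDeriv,
    Real.norm_eq_abs, mul_assoc]
  gcongr

lemma norm_iterate_dq_smul_le {u : ℝ → ℝ} {f : ℝ × ℝ → ℂ} {i : ℕ} (hu : ContDiff ℝ i u)
    (hf : ContDiff ℝ i f) {K A α : ℝ} (hα : 1 ≤ α)
    (hu_le : ∀ k ≤ i, ∀ x, |iteratedDeriv k u x| ≤ K * α ^ k)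
    (hf_le : ∀ k ≤ i, ∀ x, ‖dq^[k] f x‖ ≤ A) (x : ℝ × ℝ) :
    ‖dq^[i] (fun y => u y.1 • f y) x‖ ≤ 2 ^ i * (K * α ^ i * A) := by
  simp only [iterate_dq_eq_iteratedDeriv] at hf_le ⊢
  exact norm_iteratedDeriv_smul_le hu (hf.comp (by fun_prop)) hα (fun k hk => hu_le k hk _)
    fun k hk => hf_le k hk x

lemma norm_iterate_dp_smul_le {u : ℝ → ℝ} {f : ℝ × ℝ → ℂ} {i : ℕ} (hu : ContDiff ℝ i u)
    (hf : ContDiff ℝ i f) {K A α : ℝ} (hα : 1 ≤ α)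
    (hu_le : ∀ k ≤ i, ∀ x, |iteratedDeriv k u x| ≤ K * α ^ k)
    (hf_le : ∀ k ≤ i, ∀ x, ‖dp^[k] f x‖ ≤ A) (x : ℝ × ℝ) :
    ‖dp^[i] (fun y => u y.2 • f y) x‖ ≤ 2 ^ i * (K * α ^ i * A) := by
  have hswap : (fun y : ℝ × ℝ => u y.2 • f y)
      = (fun y => u y.1 • (f ∘ Prod.swap) y) ∘ Prod.swap := rfl
  rw [hswap, iterate_dp_comp_swap]
  refine norm_iterate_dq_smul_le (f := f ∘ Prod.swap) hu
    (hf.comp (contDiff_snd.prodMk contDiff_fst)) hα hu_le (fun k hk y => ?_) _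
  rw [iterate_dq_comp_swap]
  exact hf_le k hk _

lemma iterate_dp_smul (u : ℝ → ℝ) (f : ℝ × ℝ → ℂ) (j : ℕ) :
    dp^[j] (fun y => u y.1 • f y) = fun y => u y.1 • dp^[j] f y := by
  induction j with
  | zero => rfl
  | succ j ih =>
    rw [Function.iterate_succ_apply', ih, Function.iterate_succ_apply']
    ext x
    simp only [dp, Complex.real_smul, deriv_const_mul_field]

lemma iterate_dq_smul (u : ℝ → ℝ) (f : ℝ × ℝ → ℂ) (j : ℕ) :
    dq^[j] (fun y => u y.2 • f y) = fun y => u y.2 • dq^[j] f y := by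
  induction j with
  | zero => rfl
  | succ j ih =>
    rw [Function.iterate_succ_apply', ih, Function.iterate_succ_apply']
    ext x
    simp only [dq, Complex.real_smul, deriv_const_mul_field]

lemma IsObservable.smul_fst {f : ℝ × ℝ → ℂ} (hf : IsObservable f) {u : ℝ → ℝ}
    (hu : ContDiff ℝ ∞ u) (hperiodic : Function.Periodic u 1) :
    IsObservable fun y => u y.1 • f y where
  smooth := (hu.comp contDiff_fst).smul hf.smooth
  periodic_q q p := by simp only [hperiodic q, hf.periodic_q]
  periodic_p q p := by simp only [hf.periodic_p]

lemma IsObservable.smul_snd {f : ℝ × ℝ → ℂ} (hf : IsObservable f) {u : ℝ → ℝ}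
    (hu : ContDiff ℝ ∞ u) (hperiodic : Function.Periodic u 1) :
    IsObservable fun y => u y.2 • f y :=
  (hf.comp_swap.smul_fst hu hperiodic).comp_swap

lemma IsObservable.norm_iterate_smul_smul_le {f : ℝ × ℝ → ℂ} (hf : IsObservable f) {u v : ℝ → ℝ}
    (hu : ContDiff ℝ ∞ u) (hv : ContDiff ℝ ∞ v) (hv_periodic : Function.Periodic v 1) {i j : ℕ}
    {K L A α β : ℝ} (hα : 1 ≤ α) (hβ : 1 ≤ β)
    (hu_le : ∀ k ≤ i, ∀ x, |iteratedDeriv k u x| ≤ K * α ^ k)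
    (hv_le : ∀ l ≤ j, ∀ x, |iteratedDeriv l v x| ≤ L * β ^ l)
    (hf_le : ∀ k ≤ i, ∀ l ≤ j, ∀ x, ‖QBaker.dq^[k] (QBaker.dp^[l] f) x‖ ≤ A) (x : ℝ × ℝ) :
    ‖QBaker.dq^[i] (QBaker.dp^[j] fun y => u y.1 • v y.2 • f y) x‖
      ≤ 2 ^ (i + j) * (K * L * A * α ^ i * β ^ j) := by
  have hvf := hf.smul_snd hv hv_periodic
  have hvf_le (k : ℕ) (hk : k ≤ i) (y : ℝ × ℝ) :
      ‖QBaker.dq^[k] (QBaker.dp^[j] fun y => v y.2 • f y) y‖ ≤ 2 ^ j * (L * β ^ j * A) := by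
    rw [hvf.iterate_dq_iterate_dp, iterate_dq_smul]
    refine norm_iterate_dp_smul_le (contDiff_infty.mp hv j)
      (contDiff_infty.mp (hf.iterate_dq k).smooth j) hβ hv_le (fun l hl z => ?_) y
    rw [← hf.iterate_dq_iterate_dp]
    exact hf_le k hk l hl z
  rw [iterate_dp_smul u fun y => v y.2 • f y]
  refine (norm_iterate_dq_smul_le (contDiff_infty.mp hu i)
    (contDiff_infty.mp (hvf.iterate_dp j).smooth i) hα hu_le hvf_le x).trans_eq ?_
  ring

/-- The derivatives of `f` up to order four are bounded by `M`, where every derivative in `q` costs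
a factor `μ` and every derivative in `p` a factor `ν`. -/
def DerivBound (μ ν M : ℝ) (f : ℝ × ℝ → ℂ) : Prop :=
  ∀ i j, i + j ≤ 4 → ∀ x, ‖dq^[i] (dp^[j] f) x‖ ≤ M * μ ^ i * ν ^ j

namespace DerivBound

variable {μ ν M : ℝ} {f : ℝ × ℝ → ℂ}

lemma norm_le (hf : DerivBound μ ν M f) (x : ℝ × ℝ) : ‖f x‖ ≤ M := by
  simpa using hf 0 0 (by lia) x

lemma norm_dq_two_le (hf : DerivBound μ ν M f) (x : ℝ × ℝ) : ‖dq^[2] f x‖ ≤ M * μ ^ 2 := by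
  simpa using hf 2 0 (by lia) x

lemma norm_dp_two_le (hf : DerivBound μ ν M f) (x : ℝ × ℝ) : ‖dp^[2] f x‖ ≤ M * ν ^ 2 := by
  simpa using hf 0 2 (by lia) x

lemma fourthDerivBound (hf : DerivBound μ ν M f) : FourthDerivBound μ ν M f where
  dq_four x := by simpa using hf 4 0 le_rfl x
  dq_two_dp_two x := hf 2 2 le_rfl x
  dp_four x := by simpa using hf 0 4 le_rfl x

lemma comp_swap (hf : DerivBound μ ν M f) (hf_obs : IsObservable f) :
    DerivBound ν μ M (f ∘ Prod.swap) := fun i j hij x => by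
  rw [iterate_dp_comp_swap, iterate_dq_comp_swap, Function.comp_apply,
    ← hf_obs.iterate_dq_iterate_dp]
  exact (hf j i (by lia) x.swap).trans_eq (by ring)

lemma compBaker {n : ℕ} {δ : ℝ} (hf : DerivBound (2 ^ n * ν) ν M f) (hδ : 0 < δ)
    (hf_good : IsGoodObservable n δ f) : DerivBound ν (2 ^ n * ν) M (compBaker f (-n)) :=
  fun i j hij x => by
  rw [hf_good.iterate_compBaker hδ, norm_mul, norm_mul, norm_pow, norm_pow, norm_div, norm_pow,
    norm_one, Complex.norm_ofNat]
  calc (1 / 2 ^ n : ℝ) ^ i * (2 ^ n) ^ j * ‖QBaker.compBaker (dq^[i] (dp^[j] f)) (-n) x‖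
      ≤ (1 / 2 ^ n) ^ i * (2 ^ n) ^ j * (M * (2 ^ n * ν) ^ i * ν ^ j) := by
        gcongr
        exact hf i j hij _
    _ = M * ν ^ i * (2 ^ n * ν) ^ j := by
        rw [mul_pow, mul_pow, one_div_pow]
        field_simp

end DerivBound

lemma IsObservable.derivBound_cNorm {f : ℝ × ℝ → ℂ} (hf : IsObservable f) :
    DerivBound 1 1 (cNorm 4 f) f := fun i j hij x => by
  simpa only [one_pow, mul_one] using hf.norm_iterate_le_cNorm hij x

/-- The good part of an observable, for the time `n ≥ 0`. -/
def cutoffPart (χ : ℝ → ℝ) (n : ℕ) (a : ℝ × ℝ → ℂ) (x : ℝ × ℝ) : ℂ :=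
  χ (2 ^ n * x.1) • χ x.2 • a x

lemma periodic_comp_two_pow_mul {χ : ℝ → ℝ} (hχ : Function.Periodic χ 1) (n : ℕ) :
    Function.Periodic (fun t => χ (2 ^ n * t)) 1 := fun t => by
  have hshift := hχ.nat_mul (2 ^ n) (2 ^ n * t)
  change χ (2 ^ n * (t + 1)) = χ (2 ^ n * t)
  rw [mul_add]
  exact_mod_cast hshift

namespace IsCutoff

variable {K δ : ℝ} {χ : ℝ → ℝ} {a : ℝ × ℝ → ℂ}

lemma apply_eq_zero (hχ : IsCutoff K δ χ) {t : ℝ} (ht : ¬ FarFromInt δ t) : χ t = 0 := by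
  simp only [FarFromInt, not_forall, not_le] at ht
  obtain ⟨k, hk⟩ := ht
  have hshift := hχ.periodic.sub_int_mul_eq (x := t) k
  rw [mul_one] at hshift
  rw [← hshift]
  exact hχ.eq_zero _ (abs_le.mp hk.le)

lemma isGoodObservable_cutoffPart (hχ : IsCutoff K δ χ) (ha : IsObservable a) (n : ℕ) :
    IsGoodObservable n δ (cutoffPart χ n a) where
  toIsObservable := (ha.smul_snd hχ.smooth hχ.periodic).smul_fst (u := fun t => χ (2 ^ n * t))
    (hχ.smooth.comp (by fun_prop)) (periodic_comp_two_pow_mul hχ.periodic n)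
  eq_zero x hx := by
    rw [cutoffPart]
    rcases not_and_or.mp hx with hq | hp
    · rw [hχ.apply_eq_zero hq, zero_smul]
    · rw [hχ.apply_eq_zero hp, zero_smul, smul_zero]

lemma abs_iteratedDeriv_comp_two_pow_mul_le (hχ : IsCutoff K δ χ) (n : ℕ) {k : ℕ} (hk : k ≤ 4)
    (t : ℝ) : |iteratedDeriv k (fun t => χ (2 ^ n * t)) t| ≤ K * (2 ^ n * (1 / δ)) ^ k := by
  rw [iteratedDeriv_comp_const_mul (contDiff_infty.mp hχ.smooth k), abs_mul,
    abs_of_pos (by positivity)]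
  calc (2 ^ n) ^ k * |iteratedDeriv k χ (2 ^ n * t)| ≤ (2 ^ n) ^ k * (K / δ ^ k) := by
        gcongr
        exact hχ.deriv_le k hk _
    _ = K * (2 ^ n * (1 / δ)) ^ k := by
        rw [mul_pow, one_div_pow]
        ring

lemma derivBound_cutoffPart (hχ : IsCutoff K δ χ) (hδ : 0 < δ) (hδ_le : δ ≤ 1)
    (ha : IsObservable a) {A : ℝ} (hA : DerivBound 1 1 A a) (n : ℕ) :
    DerivBound (2 ^ n * (1 / δ)) (1 / δ) (16 * K ^ 2 * A) (cutoffPart χ n a) := fun i j hij x => by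
  have hA_nonneg : 0 ≤ A := (norm_nonneg _).trans (hA.norm_le 0)
  have hδ_inv : 1 ≤ 1 / δ := one_le_one_div hδ hδ_le
  have hscale : 1 ≤ 2 ^ n * (1 / δ) :=
    one_le_mul_of_one_le_of_one_le (one_le_pow₀ one_le_two) hδ_inv
  have hχ_le (l : ℕ) (hl : l ≤ j) (t : ℝ) : |iteratedDeriv l χ t| ≤ K * (1 / δ) ^ l := by
    simpa using hχ.abs_iteratedDeriv_comp_two_pow_mul_le 0 (by lia : l ≤ 4) t
  calc ‖dq^[i] (dp^[j] (cutoffPart χ n a)) x‖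
      ≤ 2 ^ (i + j) * (K * K * A * (2 ^ n * (1 / δ)) ^ i * (1 / δ) ^ j) :=
        ha.norm_iterate_smul_smul_le (u := fun t => χ (2 ^ n * t)) (hχ.smooth.comp (by fun_prop))
          hχ.smooth hχ.periodic hscale hδ_inv
          (fun k hk => hχ.abs_iteratedDeriv_comp_two_pow_mul_le n (by lia)) hχ_le
          (fun k hk l hl y => by simpa using hA k l (by lia) y) x
    _ ≤ 2 ^ 4 * (K * K * A * (2 ^ n * (1 / δ)) ^ i * (1 / δ) ^ j) := by
        have hKK : 0 ≤ K * K := mul_self_nonneg K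
        gcongr
        exact one_le_two
    _ = 16 * K ^ 2 * A * (2 ^ n * (1 / δ)) ^ i * (1 / δ) ^ j := by ring

end IsCutoff

/-! ### Egorov's theorem for good observables -/

/-- The observable `f` corrected by its heat term of second order: its anti-Wick quantisation with
squeezing `s` is the Weyl quantisation of `f` up to a remainder of fourth order. -/
def antiWickSymbol (N : ℕ) (s : ℝ) (f : ℝ × ℝ → ℂ) (x : ℝ × ℝ) : ℂ :=
  f x - ((1 / (8 * Real.pi * N * s) : ℝ) : ℂ) * dq^[2] f x
    - ((s / (8 * Real.pi * N) : ℝ) : ℂ) * dp^[2] f x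

lemma fourierCoeff₂_sub {f g : ℝ × ℝ → ℂ} (hf : Continuous f) (hg : Continuous g) (k : ℤ × ℤ) :
    fourierCoeff₂ (fun x => f x - g x) k = fourierCoeff₂ f k - fourierCoeff₂ g k := by
  simp_rw [fourierCoeff₂_eq_integral_square, sub_mul]
  let wave (x : ℝ × ℝ) : ℂ :=
    Complex.exp (-(2 * Real.pi * Complex.I * (x.1 * k.2 - x.2 * k.1)))
  have hwave : Continuous wave := by fun_prop
  exact integral_sub (integrable_comp_toPlane (hf.mul hwave))
    (integrable_comp_toPlane (hg.mul hwave))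

lemma fourierCoeff₂_const_mul (c : ℂ) (f : ℝ × ℝ → ℂ) (k : ℤ × ℤ) :
    fourierCoeff₂ (fun x => c * f x) k = c * fourierCoeff₂ f k := by
  simp_rw [fourierCoeff₂, mul_assoc]
  exact integral_const_mul _ _

namespace IsObservable

variable {f : ℝ × ℝ → ℂ}

lemma continuous_antiWickSymbol (hf : IsObservable f) (N : ℕ) (s : ℝ) :
    Continuous (antiWickSymbol N s f) := by
  have hf_cont := hf.smooth.continuous
  have hq := (hf.iterate_dq 2).smooth.continuous
  have hp := (hf.iterate_dp 2).smooth.continuous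
  unfold antiWickSymbol
  fun_prop

lemma fourierCoeff₂_antiWickSymbol (hf : IsObservable f) {N : ℕ} (hN : 0 < N) {s : ℝ} (hs : 0 < s)
    (k : ℤ × ℤ) :
    fourierCoeff₂ (antiWickSymbol N s f) k = (1 + qform N s k : ℝ) * fourierCoeff₂ f k := by
  have hf_cont := hf.smooth.continuous
  have hq := (hf.iterate_dq 2).smooth.continuous
  have hp := (hf.iterate_dp 2).smooth.continuous
  have hN_ne : (N : ℂ) ≠ 0 := mod_cast hN.ne'
  have hs_ne : (s : ℂ) ≠ 0 := mod_cast hs.ne'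
  have : (Real.pi : ℂ) ≠ 0 := mod_cast Real.pi_ne_zero
  have hq_coeff := hf.fourierCoeff₂_iterate 2 0 k
  have hp_coeff := hf.fourierCoeff₂_iterate 0 2 k
  simp only [Function.iterate_zero_apply] at hq_coeff hp_coeff
  unfold antiWickSymbol
  rw [fourierCoeff₂_sub (by fun_prop) (by fun_prop), fourierCoeff₂_sub (by fun_prop) (by fun_prop),
    fourierCoeff₂_const_mul, fourierCoeff₂_const_mul, hq_coeff, hp_coeff, qform]
  push_cast
  field_simp
  rw [Complex.I_sq]
  ring

lemma weyl_sub_antiWick (hf : IsObservable f) {N : ℕ} (hN : 0 < N) {s : ℝ} (hs : 0 < s) :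
    weyl N f - antiWick N s (antiWickSymbol N s f) = transSum N (remCoeff N s f) := by
  have hcoeff (k : ℤ × ℤ) :
      (Real.exp (-qform N s k) : ℂ) * fourierCoeff₂ (antiWickSymbol N s f) k
        = fourierCoeff₂ f k - remCoeff N s f k := by
    rw [hf.fourierCoeff₂_antiWickSymbol hN hs, remCoeff, smoothingDefect]
    push_cast
    ring
  simp_rw [weyl, antiWick, transSum, hcoeff, sub_smul]
  rw [(summable_smul_translation N hf.summable_norm_fourierCoeff₂).tsum_sub
    (summable_smul_translation N (hf.summable_norm_remCoeff N hs)), sub_sub_cancel]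

end IsObservable

lemma DerivBound.norm_antiWickSymbol_le {N : ℕ} {s ρ M : ℝ} {f : ℝ × ℝ → ℂ}
    (hf : DerivBound (s * ρ) ρ M f) (hN : 0 < N) (hs : 0 < s) (hsρ : s * ρ ^ 2 ≤ N) (x : ℝ × ℝ) :
    ‖antiWickSymbol N s f x‖ ≤ 2 * M := by
  have : (0 : ℝ) < N := mod_cast hN
  have hM : 0 ≤ M := (norm_nonneg _).trans (hf.norm_le x)
  have hheat : s * ρ ^ 2 / (8 * Real.pi * N) ≤ 1 / 2 := by
    rw [div_le_iff₀ (by positivity)]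
    nlinarith [Real.pi_gt_three]
  calc ‖antiWickSymbol N s f x‖
      ≤ ‖f x‖ + 1 / (8 * Real.pi * N * s) * ‖dq^[2] f x‖
          + s / (8 * Real.pi * N) * ‖dp^[2] f x‖ := by
        refine (norm_sub_le _ _).trans (add_le_add ((norm_sub_le _ _).trans_eq ?_) (le_of_eq ?_))
        · rw [norm_mul, Complex.norm_real, Real.norm_of_nonneg (by positivity)]
        · rw [norm_mul, Complex.norm_real, Real.norm_of_nonneg (by positivity)]
    _ ≤ M + 1 / (8 * Real.pi * N * s) * (M * (s * ρ) ^ 2)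
          + s / (8 * Real.pi * N) * (M * ρ ^ 2) := by
        gcongr
        exacts [hf.norm_le x, hf.norm_dq_two_le x, hf.norm_dp_two_le x]
    _ = M + 2 * (M * (s * ρ ^ 2 / (8 * Real.pi * N))) := by
        field_simp
        ring
    _ ≤ M + 2 * (M * (1 / 2)) := by gcongr
    _ = 2 * M := by ring

namespace IsGoodObservable

variable {n : ℕ} {δ : ℝ} {f : ℝ × ℝ → ℂ}

lemma antiWickSymbol_eq_zero (hf : IsGoodObservable n δ f) (N : ℕ) (s : ℝ) {x : ℝ × ℝ}
    (hx : ¬ IsGood n δ x) : antiWickSymbol N s f x = 0 := by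
  have hq : QBaker.dq^[2] f x = 0 := (hf.iterate 2 0).eq_zero x hx
  have hp : QBaker.dp^[2] f x = 0 := (hf.iterate 0 2).eq_zero x hx
  rw [antiWickSymbol, hf.eq_zero x hx, hq, hp, mul_zero, mul_zero, sub_zero, sub_zero]

/-- Since `B` dilates `q` and contracts `p` by two, it carries the correction for squeezing `2 ^ n`
to the one for squeezing `1 / 2 ^ n`. -/
lemma antiWickSymbol_compBaker (hf : IsGoodObservable n δ f) (hδ : 0 < δ) (N : ℕ) :
    antiWickSymbol N (1 / 2 ^ n) (QBaker.compBaker f (-n))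
      = QBaker.compBaker (antiWickSymbol N (2 ^ n) f) (-n) := by
  ext y
  have hq := congrFun (hf.iterate_compBaker hδ 2 0) y
  have hp := congrFun (hf.iterate_compBaker hδ 0 2) y
  simp only [Function.iterate_zero_apply] at hq hp
  have hpow : (2 : ℂ) ^ n ≠ 0 := pow_ne_zero _ two_ne_zero
  rw [antiWickSymbol, hq, hp]
  simp only [QBaker.compBaker, antiWickSymbol]
  push_cast
  field_simp

lemma norm_conj_antiWick_antiWickSymbol_sub_le (hf : IsGoodObservable n δ f) (hδ : 0 < δ) {N : ℕ}
    (hN : 0 < N) (hN_even : Even N) (hn : (2 : ℝ) ^ n ≤ N) {M : ℝ}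
    (hM : ∀ x, ‖antiWickSymbol N (2 ^ n) f x‖ ≤ M) :
    ‖quantumBaker N ^ n * antiWick N (2 ^ n) (antiWickSymbol N (2 ^ n) f)
          * star (quantumBaker N ^ n)
        - antiWick N (1 / 2 ^ n) (antiWickSymbol N (1 / 2 ^ n) (QBaker.compBaker f (-n)))‖
      ≤ 14400 * M * n * N ^ 3 * Real.exp (-(Real.pi / 2 * (N * δ ^ 2 / 2 ^ n))) := by
  have hsymbol := hf.antiWickSymbol_compBaker hδ N
  refine norm_conj_antiWick_sub_le hN hN_even hn hδ
    (hf.toIsObservable.continuous_antiWickSymbol N (2 ^ n))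
    ((hf.isObservable_compBaker hδ).continuous_antiWickSymbol N (1 / 2 ^ n)) hM
    (fun x => ?_) (fun y => hf.antiWickSymbol_eq_zero N _) (fun y => ?_)
  · rw [hsymbol]
    exact hM _
  · rw [hsymbol, compBaker_toPlane, zpow_neg, zpow_natCast, ← Equiv.Perm.mul_apply,
      inv_mul_cancel, Equiv.Perm.one_apply]

end IsGoodObservable

lemma norm_conj_sub_le_of_mem_unitary {E : Type*} [NormedRing E] [StarRing E] [CStarRing E] {U : E}
    (hU : U ∈ unitary E) (x a y b : E) :
    ‖U * x * star U - y‖ ≤ ‖x - a‖ + ‖U * a * star U - b‖ + ‖y - b‖ := by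
  have hconj : ‖U * x * star U - U * a * star U‖ = ‖x - a‖ := by
    rw [← sub_mul, ← mul_sub, CStarRing.norm_mul_mem_unitary _ (Unitary.star_mem hU),
      CStarRing.norm_mem_unitary_mul _ hU]
  calc ‖U * x * star U - y‖
      = ‖(U * x * star U - U * a * star U) + (U * a * star U - b) - (y - b)‖ := by
        congr 1
        abel
    _ ≤ ‖U * x * star U - U * a * star U‖ + ‖U * a * star U - b‖ + ‖y - b‖ :=
        (norm_sub_le _ _).trans (add_le_add_left (norm_add_le _ _) _)
    _ = ‖x - a‖ + ‖U * a * star U - b‖ + ‖y - b‖ := by rw [hconj]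

lemma norm_star_conj_sub_of_mem_unitary {E : Type*} [NormedRing E] [StarRing E] [CStarRing E]
    {U : E} (hU : U ∈ unitary E) (x y : E) : ‖star U * y * U - x‖ = ‖U * x * star U - y‖ := by
  have hconj : U * (star U * y * U - x) * star U = y - U * x * star U := by
    have hU_star := Unitary.mul_star_self_of_mem hU
    calc U * (star U * y * U - x) * star U
        = (U * star U) * y * (U * star U) - U * x * star U := by noncomm_ring
      _ = y - U * x * star U := by rw [hU_star, one_mul, mul_one]
  rw [norm_sub_rev (U * x * star U), ← hconj,
    CStarRing.norm_mul_mem_unitary _ (Unitary.star_mem hU), CStarRing.norm_mem_unitary_mul _ hU]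

/-- The distance between the quantum evolution of `f` for the time `n` and the quantisation of its
classical evolution. -/
def egorovError (N : ℕ) (n : ℤ) (f : ℝ × ℝ → ℂ) : ℝ :=
  ‖quantumBaker N ^ n * weyl N f * quantumBaker N ^ (-n) - weyl N (compBaker f (-n))‖

lemma quantumBaker_zpow_neg_natCast {N : ℕ} (hN : 0 < N) (hN_even : Even N) (n : ℕ) :
    quantumBaker N ^ (-(n : ℤ)) = star (quantumBaker N ^ n) := by
  rw [Matrix.zpow_neg_natCast]
  exact Matrix.inv_eq_left_inv
    (Unitary.star_mul_self_of_mem (pow_mem (quantumBaker_mem_unitary hN hN_even) n))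

lemma IsObservable.egorovError_neg {f : ℝ × ℝ → ℂ} (hf : IsObservable f) {N : ℕ} (hN : 0 < N)
    (hN_even : Even N) (n : ℕ) : egorovError N (-n) f = egorovError N n (compBaker f n) := by
  rw [egorovError, egorovError, neg_neg, hf.compBaker_compBaker_neg, zpow_natCast,
    quantumBaker_zpow_neg_natCast hN hN_even,
    norm_star_conj_sub_of_mem_unitary (pow_mem (quantumBaker_mem_unitary hN hN_even) n)]

lemma cast_mul_pow_mul_exp_le {N n : ℕ} {δ h : ℝ} (hnN : (2 : ℝ) ^ n ≤ N) (hh : 0 < h)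
    (hn : 2 ^ n ≤ h * N * δ ^ 2) :
    n * (N : ℝ) ^ 3 * Real.exp (-(Real.pi / 2 * (N * δ ^ 2 / 2 ^ n)))
      ≤ N ^ 4 * Real.exp (-(Real.pi / 2 * (1 / h))) := by
  have hn_le : (n : ℝ) ≤ N := le_trans (mod_cast Nat.lt_two_pow_self.le) hnN
  have hexponent : 1 / h ≤ N * δ ^ 2 / 2 ^ n := by
    rw [div_le_div_iff₀ hh (by positivity)]
    linarith
  calc n * (N : ℝ) ^ 3 * Real.exp (-(Real.pi / 2 * (N * δ ^ 2 / 2 ^ n)))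
      ≤ N * (N : ℝ) ^ 3 * Real.exp (-(Real.pi / 2 * (1 / h))) := by gcongr
    _ = N ^ 4 * Real.exp (-(Real.pi / 2 * (1 / h))) := by ring

lemma IsGoodObservable.egorovError_le {n : ℕ} {δ : ℝ} {f : ℝ × ℝ → ℂ} (hf : IsGoodObservable n δ f)
    {M : ℝ} (hD : DerivBound (2 ^ n * (1 / δ)) (1 / δ) M f) (hδ : 0 < δ) (hδ_le : δ ≤ 1) {N : ℕ}
    (hN : 0 < N) (hN_even : Even N) {h : ℝ} (hh : 0 < h) (hhδ : h ≤ δ ^ 2)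
    (hn : 2 ^ n ≤ h * N * δ ^ 2) :
    egorovError N n f
      ≤ M * (60 * h + 28800 * (N ^ 4 * Real.exp (-(Real.pi / 2 * (1 / h))))) := by
  have hs : (0 : ℝ) < 2 ^ n := by positivity
  have hM : 0 ≤ M := (norm_nonneg _).trans (hD.norm_le 0)
  have hδ_sq : δ ^ 2 ≤ 1 := pow_le_one₀ hδ.le hδ_le
  have hh_le : h ≤ 1 := hhδ.trans hδ_sq
  have hhN : h * N ≤ N := mul_le_of_le_one_left N.cast_nonneg hh_le
  have hnN : (2 : ℝ) ^ n ≤ N := hn.trans ((mul_le_of_le_one_right (by positivity) hδ_sq).trans hhN)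
  have hρ : (1 / δ) ^ 2 ≤ 1 / h := by
    rw [one_div_pow]
    exact one_div_le_one_div_of_le hh hhδ
  have hsρ : 2 ^ n * (1 / δ) ^ 2 ≤ h * N := by
    rwa [one_div_pow, mul_one_div, div_le_iff₀ (by positivity)]
  set g := QBaker.compBaker f (-n)
  have hg : IsObservable g := hf.isObservable_compBaker hδ
  have hsymbol_le := hD.norm_antiWickSymbol_le hN hs (hsρ.trans hhN)
  have hremainder := norm_transSum_remCoeff_le hf.toIsObservable hN hs hh hh_le hM hρ hsρ
    hD.fourthDerivBound
  have hremainder' := norm_transSum_remCoeff_one_div_le hg hN hs hh hh_le hM hρ hsρ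
    (hD.compBaker hδ hf).fourthDerivBound
  have hantiWick := hf.norm_conj_antiWick_antiWickSymbol_sub_le hδ hN hN_even hnN hsymbol_le
  rw [← hf.toIsObservable.weyl_sub_antiWick hN hs] at hremainder
  rw [← hg.weyl_sub_antiWick hN (by positivity)] at hremainder'
  rw [egorovError, zpow_natCast, quantumBaker_zpow_neg_natCast hN hN_even]
  have hU := pow_mem (quantumBaker_mem_unitary hN hN_even) n
  refine (norm_conj_sub_le_of_mem_unitary hU _ _ _ _).trans
    ((add_le_add (add_le_add hremainder hantiWick) hremainder').trans ?_)
  linear_combination 28800 * M * cast_mul_pow_mul_exp_le hnN hh hn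

/-! ### The good part up to the Ehrenfest time -/

lemma goodPart_natCast (χ : ℝ → ℝ) (a : ℝ × ℝ → ℂ) (n : ℕ) :
    goodPart χ a n = cutoffPart χ n a := by
  ext x
  simp only [goodPart, torusCutoff, cutoffPart, Complex.real_smul, Int.natCast_nonneg, if_true,
    Int.natAbs_natCast]
  push_cast
  ring

lemma goodPart_neg_natCast (χ : ℝ → ℝ) (a : ℝ × ℝ → ℂ) (n : ℕ) :
    goodPart χ a (-n) = cutoffPart χ n (a ∘ Prod.swap) ∘ Prod.swap := by
  ext x
  rcases n.eq_zero_or_pos with rfl | hn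
  · simp only [goodPart, torusCutoff, cutoffPart, Nat.cast_zero, neg_zero, le_refl, if_true,
      Int.natAbs_zero, pow_zero, one_mul, Function.comp_apply, Prod.fst_swap, Prod.snd_swap,
      Prod.swap_swap, Complex.real_smul]
    push_cast
    ring
  · have hneg : ¬ (0 : ℤ) ≤ -n := by lia
    simp only [goodPart, torusCutoff, cutoffPart, Complex.real_smul, hneg, if_false, Int.natAbs_neg,
      Int.natAbs_natCast, Function.comp_apply, Prod.swap_swap, Prod.fst_swap, Prod.snd_swap]
    push_cast
    ring

namespace IsCutoff

variable {K δ : ℝ} {χ : ℝ → ℝ} {a : ℝ × ℝ → ℂ}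

lemma isGoodObservable_goodPart_neg_comp_swap (hχ : IsCutoff K δ χ) (ha : IsObservable a) (n : ℕ) :
    IsGoodObservable n δ (goodPart χ a (-n) ∘ Prod.swap) := by
  rw [goodPart_neg_natCast, Function.comp_assoc, Prod.swap_swap_eq, Function.comp_id]
  exact hχ.isGoodObservable_cutoffPart ha.comp_swap n

lemma isObservable_compBaker_goodPart (hχ : IsCutoff K δ χ) (hδ : 0 < δ) (ha : IsObservable a)
    (n : ℤ) : IsObservable (compBaker (goodPart χ a n) (-n)) := by
  obtain ⟨m, rfl | rfl⟩ := n.eq_nat_or_neg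
  · rw [goodPart_natCast]
    exact (hχ.isGoodObservable_cutoffPart ha m).isObservable_compBaker hδ
  · rw [neg_neg]
    exact ((hχ.isGoodObservable_goodPart_neg_comp_swap ha m).compBaker hδ).toIsObservable

lemma derivBound_compBaker_goodPart_neg (hχ : IsCutoff K δ χ) (hδ : 0 < δ) (hδ_le : δ ≤ 1)
    (ha : IsObservable a) (n : ℕ) :
    DerivBound (2 ^ n * (1 / δ)) (1 / δ) (16 * K ^ 2 * cNorm 4 a)
      (compBaker (goodPart χ a (-n)) n) := by
  have hgood := hχ.isGoodObservable_cutoffPart ha.comp_swap n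
  have hD := hχ.derivBound_cutoffPart hδ hδ_le ha.comp_swap
    (ha.derivBound_cNorm.comp_swap ha) n
  have hcomp := compBaker_comp_swap (cutoffPart χ n (a ∘ Prod.swap) ∘ Prod.swap) n
  rw [Function.comp_assoc, Prod.swap_swap_eq, Function.comp_id] at hcomp
  have hswap := (hD.compBaker hδ hgood).comp_swap (hgood.isObservable_compBaker hδ)
  rwa [hcomp, Function.comp_assoc, Prod.swap_swap_eq, Function.comp_id, ← goodPart_neg_natCast]
    at hswap

lemma egorovError_goodPart_le (hχ : IsCutoff K δ χ) (hδ : 0 < δ) (hδ_le : δ ≤ 1)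
    (ha : IsObservable a) {N : ℕ} (hN : 0 < N) (hN_even : Even N) {h : ℝ} (hh : 0 < h)
    (hhδ : h ≤ δ ^ 2) {n : ℤ} (hn : 2 ^ n.natAbs ≤ h * N * δ ^ 2) :
    egorovError N n (goodPart χ a n) ≤ 16 * K ^ 2 * cNorm 4 a
      * (60 * h + 28800 * (N ^ 4 * Real.exp (-(Real.pi / 2 * (1 / h))))) := by
  obtain ⟨m, rfl | rfl⟩ := n.eq_nat_or_neg
  · rw [Int.natAbs_natCast] at hn
    rw [goodPart_natCast]
    exact (hχ.isGoodObservable_cutoffPart ha m).egorovError_le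
      (hχ.derivBound_cutoffPart hδ hδ_le ha ha.derivBound_cNorm m) hδ hδ_le hN hN_even hh hhδ hn
  · rw [Int.natAbs_neg, Int.natAbs_natCast] at hn
    have hobs : IsObservable (goodPart χ a (-m)) :=
      (hχ.isGoodObservable_goodPart_neg_comp_swap ha m).toIsObservable.comp_swap
    rw [hobs.egorovError_neg hN hN_even]
    exact ((hχ.isGoodObservable_goodPart_neg_comp_swap ha m).compBaker hδ).egorovError_le
      (hχ.derivBound_compBaker_goodPart_neg hδ hδ_le ha m) hδ hδ_le hN hN_even hh hhδ hn

end IsCutoff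

lemma two_pow_natAbs_le_rpow {ε : ℝ} {N : ℕ} (hN : 0 < N) {n : ℤ}
    (hn : |(n : ℝ)| ≤ (1 - ε) * ehrenfestTime N) : (2 : ℝ) ^ n.natAbs ≤ (N : ℝ) ^ (1 - ε) := by
  rw [← Real.rpow_natCast, Nat.cast_natAbs, Int.cast_abs, Real.rpow_def_of_pos two_pos,
    Real.rpow_def_of_pos (mod_cast hN), Real.exp_le_exp]
  calc Real.log 2 * |(n : ℝ)| ≤ Real.log 2 * ((1 - ε) * ehrenfestTime N) := by gcongr
    _ = Real.log N * (1 - ε) := by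
        have := Real.log_pos one_lt_two
        rw [ehrenfestTime]
        field_simp

lemma IsCutoff.egorovError_goodPart_le_rpow {K δ : ℝ} {χ : ℝ → ℝ} {a : ℝ × ℝ → ℂ}
    (hχ : IsCutoff K δ χ) (ha : IsObservable a) {N : ℕ} (hN : 0 < N) (hN_even : Even N) {ε : ℝ}
    (hδ : (N : ℝ) ^ (-(ε / 4)) ≤ δ) (hδ_le : δ ≤ 1) {n : ℤ}
    (hn : |(n : ℝ)| ≤ (1 - ε) * ehrenfestTime N) :
    egorovError N n (goodPart χ a n) ≤ 16 * K ^ 2 * cNorm 4 a * (60 * (N : ℝ) ^ (-(ε / 2))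
      + 28800 * (N ^ 4 * Real.exp (-(Real.pi / 2 * (N : ℝ) ^ (ε / 2))))) := by
  have hN_pos : (0 : ℝ) < N := mod_cast hN
  have hδ_pos : 0 < δ := lt_of_lt_of_le (by positivity) hδ
  have hhδ : (N : ℝ) ^ (-(ε / 2)) ≤ δ ^ 2 := by
    calc (N : ℝ) ^ (-(ε / 2)) = ((N : ℝ) ^ (-(ε / 4))) ^ 2 := by
          rw [← Real.rpow_mul_natCast hN_pos.le]
          congr 1
          push_cast
          ring
      _ ≤ δ ^ 2 := by gcongr
  have hpow : (2 : ℝ) ^ n.natAbs ≤ (N : ℝ) ^ (-(ε / 2)) * N * δ ^ 2 := by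
    calc (2 : ℝ) ^ n.natAbs ≤ (N : ℝ) ^ (1 - ε) := two_pow_natAbs_le_rpow hN hn
      _ = (N : ℝ) ^ (-(ε / 2)) * N * (N : ℝ) ^ (-(ε / 2)) := by
          rw [← Real.rpow_add_one hN_pos.ne', ← Real.rpow_add hN_pos]
          congr 1
          ring
      _ ≤ (N : ℝ) ^ (-(ε / 2)) * N * δ ^ 2 := by gcongr
  have hbound := hχ.egorovError_goodPart_le hδ_pos hδ_le ha hN hN_even (by positivity) hhδ hpow
  rwa [one_div, ← Real.rpow_neg hN_pos.le, neg_neg] at hbound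

lemma eventually_rpow_neg_le {r c : ℝ} (hr : 0 < r) (hc : 0 < c) :
    ∀ᶠ N : ℕ in atTop, (N : ℝ) ^ (-r) ≤ c :=
  ((tendsto_rpow_neg_atTop hr).comp tendsto_natCast_atTop_atTop).eventually_le_const hc

lemma eventually_pow_mul_exp_neg_rpow_le {r b : ℝ} (hr : 0 < r) (hb : 0 < b) (k : ℕ) :
    ∀ᶠ N : ℕ in atTop, (N : ℝ) ^ k * Real.exp (-(b * (N : ℝ) ^ r)) ≤ (N : ℝ) ^ (-r) := by
  have hlim : Tendsto (fun N : ℕ => ((N : ℝ) ^ r) ^ (k / r + 1) * Real.exp (-b * (N : ℝ) ^ r))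
      atTop (𝓝 0) :=
    ((tendsto_rpow_mul_exp_neg_mul_atTop_nhds_zero (k / r + 1) b hb).comp
      (tendsto_rpow_atTop hr)).comp tendsto_natCast_atTop_atTop
  filter_upwards [hlim.eventually_le_const zero_lt_one, eventually_gt_atTop 0] with N hle hN
  have hN_pos : (0 : ℝ) < N := mod_cast hN
  have hexponent : ((N : ℝ) ^ r) ^ (k / r + 1) = (N : ℝ) ^ k * (N : ℝ) ^ r := by
    rw [← Real.rpow_mul hN_pos.le, mul_add, mul_div_cancel₀ _ hr.ne', mul_one,
      Real.rpow_add hN_pos, Real.rpow_natCast]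
  rw [hexponent, neg_mul, mul_right_comm] at hle
  rwa [Real.rpow_neg hN_pos.le, ← one_div, le_div_iff₀ (by positivity)]

end QBaker

end

theorem mainTheorem3 :
    ∃ N₀ : ℝ → ℕ, ∀ K : ℝ, ∃ C : ℝ, 0 < C ∧
      ∀ ε : ℝ, 0 < ε →
      ∀ a : ℝ × ℝ → ℂ, QBaker.IsObservable a →
      ∀ N : ℕ, Even N → 0 < N → N₀ ε ≤ N →
      ∀ (δ : ℝ) (χ : ℝ → ℝ), δ < 1 / 4 → min ((N : ℝ) ^ (-(ε / 4))) (1 / 10) ≤ δ →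
        QBaker.IsCutoff K δ χ →
      ∀ n : ℤ, |(n : ℝ)| ≤ (1 - ε) * QBaker.ehrenfestTime N →
        QBaker.IsObservable (QBaker.compBaker (QBaker.goodPart χ a n) (-n)) ∧
        QBaker.opNorm
            (QBaker.quantumBaker N ^ n * QBaker.weyl N (QBaker.goodPart χ a n)
                * QBaker.quantumBaker N ^ (-n)
              - QBaker.weyl N (QBaker.compBaker (QBaker.goodPart χ a n) (-n)))
          ≤ C * (QBaker.supNorm a * (N : ℝ) ^ (3 / 2 : ℝ)
                    * Real.exp (-(Real.pi * (N : ℝ) ^ (ε / 2)))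
                  + QBaker.cNorm 4 a / (N : ℝ) ^ (ε / 2)) := by
  choose! N₀ hN₀ using fun (ε : ℝ) (hε : 0 < ε) => Filter.eventually_atTop.mp
    ((QBaker.eventually_rpow_neg_le (r := ε / 4) (c := 1 / 10) (by positivity) (by norm_num)).and
      (QBaker.eventually_pow_mul_exp_neg_rpow_le (half_pos hε) Real.pi_div_two_pos 4))
  refine ⟨N₀, fun K => ⟨461760 * K ^ 2 + 1, by positivity, ?_⟩⟩
  intro ε hε a ha N hN_even hN hN₀_le δ χ hδ_lt hδ hχ n hn
  obtain ⟨hmin, hexp⟩ := hN₀ ε hε N hN₀_le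
  rw [min_eq_left hmin] at hδ
  have hδ_pos : 0 < δ := lt_of_lt_of_le (by positivity) hδ
  have hA : 0 ≤ QBaker.cNorm 4 a := QBaker.cNorm_nonneg 4 a
  have hS : 0 ≤ QBaker.supNorm a := QBaker.supNorm_nonneg a
  refine ⟨hχ.isObservable_compBaker_goodPart hδ_pos ha n, ?_⟩
  calc QBaker.egorovError N n (QBaker.goodPart χ a n)
      ≤ 16 * K ^ 2 * QBaker.cNorm 4 a * (60 * (N : ℝ) ^ (-(ε / 2))
          + 28800 * (N ^ 4 * Real.exp (-(Real.pi / 2 * (N : ℝ) ^ (ε / 2))))) :=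
        hχ.egorovError_goodPart_le_rpow ha hN hN_even hδ (by linarith) hn
    _ ≤ 16 * K ^ 2 * QBaker.cNorm 4 a * (60 * (N : ℝ) ^ (-(ε / 2))
          + 28800 * (N : ℝ) ^ (-(ε / 2))) := by gcongr
    _ = 461760 * K ^ 2 * (QBaker.cNorm 4 a / (N : ℝ) ^ (ε / 2)) := by
        rw [Real.rpow_neg N.cast_nonneg]
        ring
    _ ≤ _ := by
        gcongr
        · exact le_add_of_nonneg_right zero_le_one
        · exact le_add_of_nonneg_left (by positivity)
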